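/- **Setting.** Let $\mathbb B^n$ be the closed Euclidean unit ball of $\mathbb R^n$, let $\psi_d(\mathbf x)$ be the vector with entries $\frac{1}{\sqrt{d+1}}\prod_{j=1}^i x_{k_j}$, indexed by all tuples $(k_1,\dots,k_i)\in[n]^i$ with $0\le i\le d$, and let $\mathcal K_d(\mathbf x,\mathbf y)=\langle\psi_d(\mathbf x),\psi_d(\mathbf y)\rangle$. Let $B,L,\zeta,\epsilon>0$, let $u:\mathbb R\to[0,1]$ be non-decreasing and $L$-Lipschitz, and let $\mathcal D$ be a probability distribution on $\mathbb B^n\times[0,1]$ such that $\mathbb E[y\mid\mathbf x]=u(\langle\mathbf v,\psi_d(\mathbf x)\rangle+\xi(\mathbf x))$ for some $\mathbf v$ with $\|\mathbf v\|_2\le B$ and some $\xi:\mathbb R^n\to[-\zeta,\zeta]$ with $\mathbb E[\xi(\mathbf x)^2]\le\epsilon$. For a hypothesis $h$ put $\varepsilon(h)=\mathbb E_{(\mathbf x,y)\sim\mathcal D}[(h(\mathbf x)-\mathbb E[y\mid\mathbf x])^2]$. Let $m_1\ge1$, $\delta\in(0,1)$, $\epsilon_I>0$, $T=\lceil CBL\sqrt{m_1/\log(1/\delta)}\,\rceil$,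 $m_2=\lceil C'm_1\log(T/\delta)\rceil$, $m=m_1+m_2$, and $$A_2=L\sqrt\epsilon+L\zeta\Big(\tfrac{\log(1/\delta)}{m_1}\Big)^{1/4}+BL\sqrt{\tfrac{\log(1/\delta)}{m_1}} .$$ Draw a training set $(\mathbf x_i,y_i)_{i\le m_1}$ and a validation set $(\mathbf a_j,b_j)_{j\le m_2}$ iid from $\mathcal D$, and let $K_{ji}=\mathcal K_d(\mathbf x_j,\mathbf x_i)$, $K'_{ji}=\mathcal K_d(\mathbf a_j,\mathbf x_i)$. Let $K_{\max}$ be a known number that almost surely bounds all $|K_{ji}|$ and $|K'_{ji}|$. **Algorithm** (Alphatron_with_Kernel_and_Sampling). It reads the entries of $K$, $K'$ by queries and runs on a randomized real RAM on which each arithmetic operation, comparison, rounding of a real up to an integer, memory access, loop or index operation, biased coin flip, evaluation of $u$, reading of a label, and query costs one step. Set $\alpha^0=0\in\mathbb R^{m_1}$. For $t=0,\dots,T-1$: prepare a data structure (the partial sums of the $|\alpha^t_i|$) that allows one to sample $i$ with probability $|\alpha_i^t|/\|\alpha^t\|_1$; for each $j\le m_1$ compute an estimate $r^t_j$ of $\sum_i\alpha^t_iK_{ji}$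 and set $\alpha^{t+1}_j=\alpha^t_j+\frac{1}{Lm_1}(y_j-u(r^t_j))$; for each $j\le m_2$ compute an estimate $s^t_j$ of $\sum_i\alpha^t_iK'_{ji}$. Output $\alpha^{t_{\rm out}}$, where $t_{\rm out}$ minimizes $\frac1{m_2}\sum_j(u(s^t_j)-b_j)^2$ over $0\le t<T$. To estimate $\alpha\cdot v$ (accuracy $\epsilon_I$, failure probability $\delta'$, where $\delta'=\delta/(2Tm_1)$ for the $r^t_j$ and $\delta'=\delta/(2Tm_2)$ for the $s^t_j$), return $0$ if $\|\alpha\|_1K_{\max}\le\epsilon_I$; otherwise return the median of $\lceil 6\log(1/\delta')\rceil$ means, each over $\lceil 9\|\alpha\|_1^2K_{\max}^2/(2\epsilon_I^2)\rceil$ independent samples of $\operatorname{sgn}(\alpha_i)\|\alpha\|_1v_i$ with $i$ drawn with probability $|\alpha_i|/\|\alpha\|_1$. **Theorem.** There are $C_0,C_0'>0$ such that for all $C\ge C_0$ and $C'\ge C_0'$ there is $C''>0$ such that in every setting as above the output hypothesis $h(\mathbf x)=u\big(\sum_i\alpha_i^{t_{\rm out}}\mathcal K_d(\mathbf x,\mathbf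 x_i)\big)$ satisfies, with probability at least $1-3\delta$ over the data and the internal randomness, $$\varepsilon(h)\le C''\,(A_2+L\epsilon_I+L^2\epsilon_I^2).$$ On all data and for all outcomes of the internal randomness, the number of steps is $$\tilde O\Big(Tm+T^3m\,\frac{K_{\max}^2}{L^2\epsilon_I^2}\log\frac1\delta\Big),$$ where $\tilde O$ hides a power of $\log(2+Tm)$ and a constant, and both depend only on $C$, $C'$ and, for the constant, on an upper bound $\delta_0<1$ for $\delta$. Moreover, if $A_2\le1$ and $\epsilon_I=\sqrt\epsilon$, then with probability at least $1-3\delta$ we have $\varepsilon(h)\le C''A_2$, and the number of steps is $\tilde O\big(Tm+T^3m\frac{K_{\max}^2}{L^2\epsilon}\log\frac1\delta\big)$. -/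

import Mathlib

open MeasureTheory

noncomputable section

namespace Alphatron

/-! ### Feature map, kernel, learning setting -/

/-- The closed unit ball of `ℝⁿ` with the Euclidean norm (the input space). -/
abbrev Ball (n : ℕ) : Type := Metric.closedBall (0 : EuclideanSpace ℝ (Fin n)) 1

/-- The label space `[0,1]`. -/
abbrev Label : Type := Set.Icc (0 : ℝ) 1

/-- Indices of the monomials of degree at most `d`: tuples `(k₁, …, kᵢ) ∈ [n]ⁱ`, `0 ≤ i ≤ d`. -/
abbrev MonoIdx (n d : ℕ) : Type := Σ i : Fin (d + 1), (Fin (i : ℕ) → Fin n)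

/-- The normalized feature map `ψ_d`. -/
def featureMap (n d : ℕ) (x : EuclideanSpace ℝ (Fin n)) : EuclideanSpace ℝ (MonoIdx n d) :=
  WithLp.toLp 2 fun k => 1 / Real.sqrt ((d : ℝ) + 1) * ∏ j, x (k.2 j)

/-- The normalized multinomial kernel `K_d(x, y) = ⟨ψ_d(x), ψ_d(y)⟩`. -/
def kernel (n d : ℕ) (x y : EuclideanSpace ℝ (Fin n)) : ℝ :=
  inner ℝ (featureMap n d x) (featureMap n d y)

/-- The conditional expectation `E[y | x]`, as a function on the sample space. -/
def condMean {n : ℕ} (D : Measure (Ball n × Label)) : Ball n × Label → ℝ :=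
  condExp (MeasurableSpace.comap Prod.fst inferInstance) D fun p => (p.2 : ℝ)

/-- The generalization error `ε(h) = E[(h(x) - E[y | x])²]`. -/
def genErr {n : ℕ} (D : Measure (Ball n × Label)) (h : EuclideanSpace ℝ (Fin n) → ℝ) : ℝ :=
  ∫ p, (h (p.1 : EuclideanSpace ℝ (Fin n)) - condMean D p) ^ 2 ∂D

/-- `u : ℝ → [0,1]` is `L`-Lipschitz and non-decreasing. -/
structure IsActivation (L : ℝ) (u : ℝ → ℝ) : Prop where
  mem_Icc : ∀ t, u t ∈ Set.Icc (0 : ℝ) 1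
  monotone : Monotone u
  lipschitz : ∀ s t, |u s - u t| ≤ L * |s - t|

/-- The distribution `D` satisfies `E[y | x] = u(⟨v, ψ_d(x)⟩ + ξ(x))` for some `v` with `‖v‖₂ ≤ B`
and some noise function `ξ : ℝⁿ → [-ζ, ζ]` with `E[ξ(x)²] ≤ ε`. -/
def IsConceptDistribution (n d : ℕ) (B ζ ε : ℝ) (u : ℝ → ℝ) (D : Measure (Ball n × Label)) :
    Prop :=
  ∃ (v : EuclideanSpace ℝ (MonoIdx n d)) (ξ : EuclideanSpace ℝ (Fin n) → ℝ),
    ‖v‖ ≤ B ∧ Measurable ξ ∧ (∀ x, ξ x ∈ Set.Icc (-ζ) ζ) ∧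
    ∫ p, ξ (p.1 : EuclideanSpace ℝ (Fin n)) ^ 2 ∂D ≤ ε ∧
    condMean D =ᵐ[D] fun p =>
      u (inner ℝ v (featureMap n d (p.1 : EuclideanSpace ℝ (Fin n))) +
        ξ (p.1 : EuclideanSpace ℝ (Fin n)))

/-! ### A randomized real RAM with unit-cost instructions -/

/-- What a program can access: the labels `y`, `b`, the function `u`, and the entries of the two
kernel matrices `K` (size `m₁ × m₁`) and `K'` (size `m₂ × m₁`). -/
structure Input (m₁ m₂ : ℕ) where
  y : Fin m₁ → ℝ
  b : Fin m₂ → ℝ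
  u : ℝ → ℝ
  K : Fin m₁ → Fin m₁ → ℝ
  Kval : Fin m₂ → Fin m₁ → ℝ

/-- The instructions. Each of them costs one time step. `Instr β` are those with a result
in `β`. -/
inductive Instr (m₁ m₂ : ℕ) : Type → Type
  /-- loop control, index arithmetic, pointer moves -/
  | tick : Instr m₁ m₂ Unit
  | add (x y : ℝ) : Instr m₁ m₂ ℝ
  | sub (x y : ℝ) : Instr m₁ m₂ ℝ
  | mul (x y : ℝ) : Instr m₁ m₂ ℝ
  | div (x y : ℝ) : Instr m₁ m₂ ℝ
  | abs (x : ℝ) : Instr m₁ m₂ ℝ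
  | le (x y : ℝ) : Instr m₁ m₂ Bool
  | ceil (x : ℝ) : Instr m₁ m₂ ℕ
  /-- a fresh random bit which is `true` with probability `p` -/
  | coin (p : ℝ) : Instr m₁ m₂ Bool
  /-- read a cell of an array of reals -/
  | load {k : ℕ} (a : Fin k → ℝ) (i : Fin k) : Instr m₁ m₂ ℝ
  /-- overwrite a cell of an array of reals -/
  | store {k : ℕ} (a : Fin k → ℝ) (i : Fin k) (x : ℝ) : Instr m₁ m₂ (Fin k → ℝ)
  | evalU (x : ℝ) : Instr m₁ m₂ ℝ
  | readY (i : Fin m₁) : Instr m₁ m₂ ℝ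
  | readB (j : Fin m₂) : Instr m₁ m₂ ℝ
  /-- query an entry of `K` -/
  | queryK (j i : Fin m₁) : Instr m₁ m₂ ℝ
  /-- query an entry of `K'` -/
  | queryKval (j : Fin m₂) (i : Fin m₁) : Instr m₁ m₂ ℝ

/-- The (random) result of an instruction. -/
def Instr.exec {m₁ m₂ : ℕ} (I : Input m₁ m₂) : {β : Type} → Instr m₁ m₂ β → PMF β
  | _, .tick => PMF.pure ()
  | _, .add x y => PMF.pure (x + y)
  | _, .sub x y => PMF.pure (x - y)
  | _, .mul x y => PMF.pure (x * y)
  | _, .div x y => PMF.pure (x / y)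
  | _, .abs x => PMF.pure |x|
  | _, .le x y => PMF.pure (@decide (x ≤ y) (Classical.propDecidable _))
  | _, .ceil x => PMF.pure ⌈x⌉₊
  | _, .coin p => PMF.bernoulli (min p.toNNReal 1) (min_le_right _ _)
  | _, .load a i => PMF.pure (a i)
  | _, .store a i x => PMF.pure (Function.update a i x)
  | _, .evalU x => PMF.pure (I.u x)
  | _, .readY i => PMF.pure (I.y i)
  | _, .readB j => PMF.pure (I.b j)
  | _, .queryK j i => PMF.pure (I.K j i)
  | _, .queryKval j i => PMF.pure (I.Kval j i)

/-- Programs: sequences of instructions, each of which may depend on the earlier results. A program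
does not depend on the `Input`, except through the results of its instructions. -/
inductive Prog (m₁ m₂ : ℕ) (α : Type) : Type 1
  | ret (a : α) : Prog m₁ m₂ α
  | step {β : Type} (i : Instr m₁ m₂ β) (k : β → Prog m₁ m₂ α) : Prog m₁ m₂ α

/-- Sequential composition. -/
def Prog.seq {m₁ m₂ : ℕ} {α γ : Type} :
    Prog m₁ m₂ α → (α → Prog m₁ m₂ γ) → Prog m₁ m₂ γ
  | .ret a, f => f a
  | .step i k, f => .step i fun r => (k r).seq f

instance Prog.instMonad (m₁ m₂ : ℕ) : Monad (Prog m₁ m₂) where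
  pure := Prog.ret
  bind := Prog.seq

/-- The joint distribution of the result of a program and the number of instructions that it
executes. -/
def Prog.run {m₁ m₂ : ℕ} (I : Input m₁ m₂) {α : Type} : Prog m₁ m₂ α → PMF (α × ℕ)
  | .ret a => PMF.pure (a, 0)
  | .step i k => (i.exec I).bind fun r => ((k r).run I).map fun p => (p.1, p.2 + 1)

section Programs

variable {m₁ m₂ : ℕ}

/-- Execute one instruction. -/
def op {β : Type} (i : Instr m₁ m₂ β) : Prog m₁ m₂ β := Prog.step i Prog.ret

/-- `for i = 0, …, k - 1`, with loop state `s`. -/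
def forLoop {σ : Type} (k : ℕ) (s : σ) (body : Fin k → σ → Prog m₁ m₂ σ) : Prog m₁ m₂ σ :=
  (List.finRange k).foldlM (fun s i => do
    op .tick
    body i s) s

/-- Fill a fresh array, cell by cell. -/
def fillArray (k : ℕ) (f : Fin k → Prog m₁ m₂ ℝ) : Prog m₁ m₂ (Fin k → ℝ) :=
  forLoop k (fun _ => 0) fun i a => do
    let x ← f i
    op (.store a i x)

/-! ### The `ℓ₁`-sampling data structure and the inner product estimation -/

/-- The `ℓ₁`-sampling data structure of `a`: the array of the partial sums
`S k = ∑_{i < k} |a i|`, `0 ≤ k ≤ m`. Its last entry is `‖a‖₁`. -/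
def prepareSampler {m : ℕ} (a : Fin m → ℝ) : Prog m₁ m₂ (Fin (m + 1) → ℝ) :=
  forLoop m (fun _ => 0) fun i S => do
    let x ← op (.load a i)
    let w ← op (.abs x)
    let s ← op (.load S i.castSucc)
    let s' ← op (.add s w)
    op (.store S i.succ s')

/-- Sample an index in `lo, …, lo + len - 1` with probability proportional to `|a i|`, by bisection
with biased coins; `S` is the array of partial sums. -/
def drawIndex {m : ℕ} (S : Fin (m + 1) → ℝ) (lo len : ℕ) (hpos : 0 < len) (hle : lo + len ≤ m) :
    Prog m₁ m₂ (Fin m) :=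
  if h1 : len = 1 then do
    op .tick
    pure ⟨lo, by omega⟩
  else do
    op .tick
    let s₀ ← op (.load S ⟨lo, by omega⟩)
    let s₁ ← op (.load S ⟨lo + len / 2, by omega⟩)
    let s₂ ← op (.load S ⟨lo + len, by omega⟩)
    let left ← op (.sub s₁ s₀)
    let total ← op (.sub s₂ s₀)
    let p ← op (.div left total)
    let c ← op (.coin p)
    if c then drawIndex S lo (len / 2) (by omega) (by omega)
    else drawIndex S (lo + len / 2) (len - len / 2) (by omega) (by omega)
termination_by len
decreasing_by all_goals omega

/-- One sample of the random variable `Z = sgn(a i) ‖a‖₁ v i`, with `i` drawn with probability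
`|a i| / ‖a‖₁`; `norm` is `‖a‖₁` and `query i` queries `v i`. -/
def sampleZ {m : ℕ} [NeZero m] (a : Fin m → ℝ) (S : Fin (m + 1) → ℝ) (norm : ℝ)
    (query : Fin m → Prog m₁ m₂ ℝ) : Prog m₁ m₂ ℝ := do
  let i ← drawIndex S 0 m (Nat.pos_of_ne_zero (NeZero.ne m)) (by omega)
  let x ← op (.load a i)
  let v ← query i
  let z ← op (.mul norm v)
  let nonneg ← op (.le 0 x)
  if nonneg then pure z else op (.sub 0 z)

/-- The mean of `N` runs of `one`. -/
def meanOf (N : ℕ) (one : Prog m₁ m₂ ℝ) : Prog m₁ m₂ ℝ := do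
  let total ← forLoop N (0 : ℝ) fun _ s => do
    let z ← one
    op (.add s z)
  op (.div total (N : ℝ))

/-- Merge two sorted lists. -/
def mergeSorted : List ℝ → List ℝ → Prog m₁ m₂ (List ℝ)
  | [], r => do
    op .tick
    pure r
  | l, [] => do
    op .tick
    pure l
  | x :: l, y :: r => do
    op .tick
    let c ← op (.le x y)
    if c then do
      let rest ← mergeSorted l (y :: r)
      pure (x :: rest)
    else do
      let rest ← mergeSorted (x :: l) r
      pure (y :: rest)
termination_by l r => l.length + r.length

/-- The results of `q` runs of `one`, sorted (merge sort). -/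
def sortedRuns (one : Prog m₁ m₂ ℝ) (q : ℕ) : Prog m₁ m₂ (List ℝ) :=
  if _h0 : q = 0 then do
    op .tick
    pure []
  else if _h1 : q = 1 then do
    op .tick
    let x ← one
    pure [x]
  else do
    op .tick
    let l ← sortedRuns one (q / 2)
    let r ← sortedRuns one (q - q / 2)
    mergeSorted l r
termination_by q
decreasing_by all_goals omega

/-- Walk to the entry number `k` of a linked list. -/
def entryAt : List ℝ → ℕ → Prog m₁ m₂ ℝ
  | [], _ => pure 0
  | x :: _, 0 => do
    op .tick
    pure x
  | _ :: l, k + 1 => do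
    op .tick
    entryAt l k

/-- The median of `q` runs of `one`. -/
def medianOf (q : ℕ) (one : Prog m₁ m₂ ℝ) : Prog m₁ m₂ ℝ := do
  let l ← sortedRuns one q
  entryAt l (q / 2)

/-- The number `6 log(1/δ')` of repetitions, rounded up. -/
def numReps (δ' : ℝ) : ℕ := ⌈6 * Real.log (1 / δ')⌉₊

/-- Estimate `a · v` to additive accuracy `acc` with success probability `1 - δ'` by `ℓ₁`-sampling
from `a`, where `vmax` is an upper bound on the `|v i|`: the median of `6 log(1/δ')` means of
`9 ‖a‖₁² vmax² / (2 acc²)` samples of `Z`. No samples are needed, and the estimate is `0`, if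
`‖a‖₁ vmax ≤ acc`. -/
def estimateInner {m : ℕ} [NeZero m] (acc δ' vmax : ℝ) (a : Fin m → ℝ) (S : Fin (m + 1) → ℝ)
    (query : Fin m → Prog m₁ m₂ ℝ) : Prog m₁ m₂ ℝ := do
  let norm ← op (.load S (Fin.last m))
  let bound ← op (.mul norm vmax)
  let small ← op (.le bound acc)
  if small then pure 0
  else do
    let ratio ← op (.div bound acc)
    let ratioSq ← op (.mul ratio ratio)
    let num ← op (.mul (9 / 2) ratioSq)
    let N ← op (.ceil num)
    medianOf (numReps δ') (meanOf N (sampleZ a S norm query))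

/-! ### The algorithm -/

/-- The parameters of the algorithm. -/
structure Params where
  /-- number of iterations -/
  T : ℕ
  /-- learning rate -/
  rate : ℝ
  /-- accuracy of the inner product estimations -/
  epsI : ℝ
  /-- failure probability -/
  delta : ℝ
  /-- bound on the entries of the kernel matrices -/
  Kmax : ℝ

variable [NeZero m₁]

/-- One iteration: from `α^t`, compute `α^{t+1}` and the estimates `s^t`. -/
def iteration (P : Params) (α : Fin m₁ → ℝ) :
    Prog m₁ m₂ ((Fin m₁ → ℝ) × (Fin m₂ → ℝ)) := do
  let S ← prepareSampler α
  let α' ← fillArray m₁ fun j => do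
    let r ← estimateInner P.epsI (P.delta / (2 * P.T * m₁)) P.Kmax α S fun i => op (.queryK j i)
    let g ← op (.evalU r)
    let y ← op (.readY j)
    let e ← op (.sub y g)
    let c ← op (.mul (P.rate / m₁) e)
    let x ← op (.load α j)
    op (.add x c)
  let s ← fillArray m₂ fun j =>
    estimateInner P.epsI (P.delta / (2 * P.T * m₂)) P.Kmax α S fun i => op (.queryKval j i)
  pure (α', s)

/-- `k` iterations, starting from `α`; the result is the list of the pairs `(α^t, s^t)`. -/
def iterations (P : Params) : ℕ → (Fin m₁ → ℝ) → Prog m₁ m₂ (List ((Fin m₁ → ℝ) × (Fin m₂ → ℝ)))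
  | 0, _ => pure []
  | k + 1, α => do
    op .tick
    let next ← iteration P α
    let rest ← iterations P k next.1
    pure ((α, next.2) :: rest)

/-- The estimated validation error `(1/m₂) ∑ⱼ (u(sⱼ) - bⱼ)²`. -/
def validationError (s : Fin m₂ → ℝ) : Prog m₁ m₂ ℝ := do
  let total ← forLoop m₂ (0 : ℝ) fun j acc => do
    let x ← op (.load s j)
    let g ← op (.evalU x)
    let b ← op (.readB j)
    let e ← op (.sub g b)
    let e2 ← op (.mul e e)
    op (.add acc e2)
  op (.div total (m₂ : ℝ))

/-- The `α` with the least validation error in a list, where `best` is the best one so far. -/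
def selectBest (best : Fin m₁ → ℝ) (bestErr : ℝ) :
    List ((Fin m₁ → ℝ) × (Fin m₂ → ℝ)) → Prog m₁ m₂ (Fin m₁ → ℝ)
  | [] => pure best
  | (α, s) :: rest => do
    op .tick
    let e ← validationError s
    let keep ← op (.le bestErr e)
    if keep then selectBest best bestErr rest else selectBest α e rest

/-- `Alphatron_with_Kernel_and_Sampling`. The result is `α^{t_out}`, where `t_out` minimizes the
estimated validation error over `t = 0, …, T - 1`. -/
def alphatronSampling (m₁ m₂ : ℕ) [NeZero m₁] (P : Params) : Prog m₁ m₂ (Fin m₁ → ℝ) := do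
  let α₀ ← fillArray m₁ fun _ => pure 0
  let hist ← iterations P P.T α₀
  match hist with
  | [] => pure α₀
  | (α, s) :: rest => do
    let e ← validationError s
    selectBest α e rest

end Programs

/-! ### The algorithm in the learning setting -/

/-- A sample of size `m`. -/
abbrev Sample (n m : ℕ) : Type := Fin m → Ball n × Label

/-- The law of the training set (`m₁` iid samples from `D`) and of the independent validation set
(`m₂` iid samples from `D`). -/
def dataLaw {n : ℕ} (D : Measure (Ball n × Label)) (m₁ m₂ : ℕ) :
    Measure (Sample n m₁ × Sample n m₂) :=
  (Measure.pi fun _ : Fin m₁ => D).prod (Measure.pi fun _ : Fin m₂ => D)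

/-- The input of the algorithm that belongs to a training and a validation set:
`K j i = K_d(x_j, x_i)` and `K' j i = K_d(a_j, x_i)`. -/
def inputOf {n m₁ m₂ : ℕ} (d : ℕ) (u : ℝ → ℝ) (S : Sample n m₁ × Sample n m₂) :
    Input m₁ m₂ where
  y i := ((S.1 i).2 : ℝ)
  b j := ((S.2 j).2 : ℝ)
  u := u
  K j i := kernel n d ((S.1 j).1 : EuclideanSpace ℝ (Fin n)) (S.1 i).1
  Kval j i := kernel n d ((S.2 j).1 : EuclideanSpace ℝ (Fin n)) (S.1 i).1

/-- The hypothesis `h(x) = u(∑ᵢ αᵢ K_d(x, xᵢ))`. -/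
def hypothesis {n m₁ : ℕ} (d : ℕ) (u : ℝ → ℝ) (X : Sample n m₁) (α : Fin m₁ → ℝ) :
    EuclideanSpace ℝ (Fin n) → ℝ :=
  fun x => u (∑ i, α i * kernel n d x (X i).1)

/-- The distribution of the output and of the number of steps of the algorithm on given data. -/
def outcome {n m₁ m₂ : ℕ} [NeZero m₁] (d : ℕ) (u : ℝ → ℝ) (P : Params)
    (S : Sample n m₁ × Sample n m₂) : PMF ((Fin m₁ → ℝ) × ℕ) :=
  (alphatronSampling m₁ m₂ P).run (inputOf d u S)

/-- The probability, over the data and the internal randomness of the algorithm, that the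
generalization error of the output hypothesis exceeds `bound`. -/
def failureProb {n : ℕ} (d m₁ m₂ : ℕ) [NeZero m₁] (u : ℝ → ℝ) (P : Params)
    (D : Measure (Ball n × Label)) (bound : ℝ) : ENNReal :=
  ∫⁻ S, (outcome d u P S).toOuterMeasure
    {o | bound < genErr D (hypothesis d u S.1 o.1)} ∂(dataLaw D m₁ m₂)

/-- `T = C B L √(m₁ / log(1/δ))`, rounded up. -/
def numIter (C B L δ : ℝ) (m₁ : ℕ) : ℕ := ⌈C * B * L * Real.sqrt (m₁ / Real.log (1 / δ))⌉₊

/-- `m₂ = C' m₁ log(T/δ)`, rounded up. -/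
def numVal (C' δ : ℝ) (m₁ T : ℕ) : ℕ := ⌈C' * m₁ * Real.log (T / δ)⌉₊

/-- `A₂ = L √ε + L ζ (log(1/δ)/m₁)^{1/4} + B L √(log(1/δ)/m₁)`. -/
def A₂ (B L ζ ε δ : ℝ) (m₁ : ℕ) : ℝ :=
  L * Real.sqrt ε + L * ζ * (Real.log (1 / δ) / m₁) ^ (1 / 4 : ℝ)
    + B * L * Real.sqrt (Real.log (1 / δ) / m₁)

/-- The run time expression `T m + T³ m K_max² / (L² ε_I²) log(1/δ)`, with the square of `ε_I` as
argument `epsSq`. -/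
def timeExpr (T m : ℕ) (L Kmax epsSq δ : ℝ) : ℝ :=
  T * m + T ^ 3 * m * (Kmax ^ 2 / (L ^ 2 * epsSq)) * Real.log (1 / δ)

end Alphatron

end

/-! # Learning with kernels and sampling: analysis of `alphatronSampling` -/

/-! In feature space a coefficient vector `α` is the linear hypothesis `w = ∑ αᵢ ψ(xᵢ)`, and an
iteration moves `w` along the mean of `(yᵢ - u(rᵢ)) ψ(xᵢ)`. As `u` is monotone and `L`-Lipschitz,
`(u s - u t)² ≤ L (u s - u t)(s - t)`. Hence, as long as the mean of `(E[yᵢ | xᵢ] - u(rᵢ))²` over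
the training set exceeds a threshold made of the noise `ξ`, the estimation accuracy and the mean
residual `(y - E[y | x]) ψ(x)`, a step lowers `‖w - v‖²` by a fixed amount (`norm_step_sub_sq_le`).
This potential starts below `B²`, so one of the `T` iterates falls under the threshold while within
distance `B` of `v` (`exists_lt_of_descent`).

Passing to the distribution takes three deviation bounds on the training set: a dimension-free
Hoeffding bound for the residual vector (`measure_norm_sum_ge_le`), a Bernstein bound for `ξ²`
(`measure_sum_ge_le`), and a one-sided bound for `(u⟨w, ψ⟩ - u⟨v, ψ⟩)²`, uniform over the ball of
radius `B` about `v`. For the last one, the exponential moment of the supremum is bounded directly,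
one coordinate at a time, by symmetrization, contraction and the potential `√(1 + ‖·‖²)`
(`lintegral_pi_iSup_eexp_le`).

The iterates do not depend on the validation set. For fixed `w`, the excess loss over the
conditional mean has expectation `err w` and second moment at most `4 err w`, so the Bernstein bound
compares errors up to a constant factor (`measure_badVal_le`). A union bound over the `T` iterates
is affordable because `m₂ ≥ m₁ log(T/δ)`.

An `ℓ₁`-sample is an unbiased estimate of the inner product with bounded second moment. By Chebyshev
a mean fails with probability at most `2/9`, and the median of `q` means with probability at most
`exp(-q/6)` (`fail_medianOf_le`). Since labels and `u` lie in `[0,1]`, `‖α^t‖₁ ≤ t/L` on every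
execution, which bounds the sample counts and hence the time in the worst case.

Failed training deviations, inaccurate estimates and failed validation deviations have probability
at most `δ` each. Programs are analysed by recursion on their syntax, through `Prog.ev` and
`Prog.Sat`; independence of separate runs is built into this recursion. -/

noncomputable section

open scoped ENNReal

namespace Alphatron

/-! ### Expectations and path properties of programs -/

section Semantics

variable {m₁ m₂ : ℕ} {α γ : Type}

/-- The expectation of `f` under the distribution of the result of a program. -/
def Prog.ev (I : Input m₁ m₂) {α : Type} : Prog m₁ m₂ α → (α → ℝ≥0∞) → ℝ≥0∞
  | .ret a, f => f a
  | .step i k, f => ∑' r, i.exec I r * (k r).ev I f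

/-- All executions of positive probability have a result and a number of steps satisfying `Q`. -/
def Prog.Sat (I : Input m₁ m₂) {α : Type} : Prog m₁ m₂ α → (α → ℕ → Prop) → Prop
  | .ret a, Q => Q a 0
  | .step i k, Q => ∀ r ∈ (i.exec I).support, (k r).Sat I fun a n => Q a (n + 1)

/-- All executions take at most `c` steps, and their results satisfy `R`. -/
def Prog.Costs (I : Input m₁ m₂) (p : Prog m₁ m₂ α) (c : ℕ) (R : α → Prop) : Prop :=
  p.Sat I fun a n => n ≤ c ∧ R a

/-- The instruction does not access the validation set. -/
def Instr.IsTrain {m₁ m₂ : ℕ} : {β : Type} → Instr m₁ m₂ β → Prop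
  | _, .readB _ => False
  | _, .queryKval _ _ => False
  | _, _ => True

/-- The program does not access the validation set. -/
def Prog.IsTrain {α : Type} : Prog m₁ m₂ α → Prop
  | .ret _ => True
  | .step i k => i.IsTrain ∧ ∀ r, (k r).IsTrain

variable (I : Input m₁ m₂)

theorem Prog.bind_eq (p : Prog m₁ m₂ α) (g : α → Prog m₁ m₂ γ) : p >>= g = p.seq g := rfl

@[simp] theorem Prog.ev_pure (a : α) (f : α → ℝ≥0∞) : (pure a : Prog m₁ m₂ α).ev I f = f a := rfl

@[simp] theorem Prog.ev_bind (p : Prog m₁ m₂ α) (g : α → Prog m₁ m₂ γ) (f : γ → ℝ≥0∞) :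
    (p >>= g).ev I f = p.ev I fun a => (g a).ev I f := by
  rw [Prog.bind_eq]
  induction p with
  | ret a => rfl
  | step i k ih => simp only [Prog.seq, Prog.ev, ih]

theorem tsum_pure_mul {β : Type} (b : β) (f : β → ℝ≥0∞) : ∑' r, PMF.pure b r * f r = f b := by
  rw [tsum_eq_single b]
  · simp
  · intro r hr
    simp [PMF.pure_apply, hr]

theorem ev_op {β : Type} (i : Instr m₁ m₂ β) (f : β → ℝ≥0∞) :
    (op i).ev I f = ∑' r, i.exec I r * f r := rfl

@[simp] theorem ev_tick (f : Unit → ℝ≥0∞) : (op (m₁ := m₁) (m₂ := m₂) .tick).ev I f = f () :=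
  tsum_pure_mul _ _
@[simp] theorem ev_add (x y : ℝ) (f : ℝ → ℝ≥0∞) : (op (.add x y)).ev I f = f (x + y) :=
  tsum_pure_mul _ _
@[simp] theorem ev_sub (x y : ℝ) (f : ℝ → ℝ≥0∞) : (op (.sub x y)).ev I f = f (x - y) :=
  tsum_pure_mul _ _
@[simp] theorem ev_mul (x y : ℝ) (f : ℝ → ℝ≥0∞) : (op (.mul x y)).ev I f = f (x * y) :=
  tsum_pure_mul _ _
@[simp] theorem ev_div (x y : ℝ) (f : ℝ → ℝ≥0∞) : (op (.div x y)).ev I f = f (x / y) :=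
  tsum_pure_mul _ _

@[simp] theorem ev_le (x y : ℝ) (f : Bool → ℝ≥0∞) :
    (op (.le x y)).ev I f = f (@decide (x ≤ y) (Classical.propDecidable _)) :=
  tsum_pure_mul _ _
@[simp] theorem ev_ceil (x : ℝ) (f : ℕ → ℝ≥0∞) : (op (.ceil x)).ev I f = f ⌈x⌉₊ :=
  tsum_pure_mul _ _
@[simp] theorem ev_load {k : ℕ} (a : Fin k → ℝ) (i : Fin k) (f : ℝ → ℝ≥0∞) :
    (op (.load a i)).ev I f = f (a i) :=
  tsum_pure_mul _ _

@[simp] theorem ev_evalU (x : ℝ) (f : ℝ → ℝ≥0∞) : (op (.evalU x)).ev I f = f (I.u x) :=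
  tsum_pure_mul _ _
@[simp] theorem ev_readY (i : Fin m₁) (f : ℝ → ℝ≥0∞) : (op (.readY i)).ev I f = f (I.y i) :=
  tsum_pure_mul _ _

@[simp] theorem ev_queryK (j i : Fin m₁) (f : ℝ → ℝ≥0∞) :
    (op (.queryK j i)).ev I f = f (I.K j i) :=
  tsum_pure_mul _ _
@[simp] theorem ev_queryKval (j : Fin m₂) (i : Fin m₁) (f : ℝ → ℝ≥0∞) :
    (op (.queryKval j i)).ev I f = f (I.Kval j i) :=
  tsum_pure_mul _ _

set_option linter.deprecated false in
theorem ev_coin {p : ℝ} (h0 : 0 ≤ p) (h1 : p ≤ 1) (f : Bool → ℝ≥0∞) :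
    (op (.coin p)).ev I f
      = ENNReal.ofReal p * f true + ENNReal.ofReal (1 - p) * f false := by
  rw [ev_op, tsum_bool, add_comm]
  have hp : min p.toNNReal 1 = p.toNNReal := min_eq_left (by simpa using h1)
  have h2 : ((1 : NNReal) - p.toNNReal : NNReal) = (1 - p).toNNReal := by
    refine NNReal.eq ?_
    rw [NNReal.coe_sub (by simpa using h1), Real.coe_toNNReal _ h0,
      Real.coe_toNNReal _ (sub_nonneg.2 h1), NNReal.coe_one]
  simp only [Instr.exec, PMF.bernoulli_apply, cond_true, cond_false, hp]
  congr 2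
  rw [ENNReal.ofReal, ← h2]

variable {I}

theorem Prog.ev_const (p : Prog m₁ m₂ α) (c : ℝ≥0∞) : p.ev I (fun _ => c) = c := by
  induction p with
  | ret a => rfl
  | step i k ih => simp only [Prog.ev, ih, ENNReal.tsum_mul_right, PMF.tsum_coe, one_mul]

theorem Prog.ev_mono_of_sat {p : Prog m₁ m₂ α} {f g : α → ℝ≥0∞}
    (h : p.Sat I fun a _ => f a ≤ g a) : p.ev I f ≤ p.ev I g := by
  induction p with
  | ret a => exact h
  | step i k ih =>
    refine ENNReal.tsum_le_tsum fun r => ?_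
    by_cases hr : r ∈ (i.exec I).support
    · exact mul_le_mul_right (ih r (h r hr)) _
    · rw [PMF.mem_support_iff, not_not] at hr
      simp [hr]

theorem Prog.Sat.mono {p : Prog m₁ m₂ α} {Q R : α → ℕ → Prop} (h : p.Sat I Q)
    (hQR : ∀ a n, Q a n → R a n) : p.Sat I R := by
  induction p generalizing Q R with
  | ret a => exact hQR _ _ h
  | step i k ih => exact fun r hr => ih r (h r hr) fun a n => hQR a (n + 1)

theorem Prog.sat_of_forall {p : Prog m₁ m₂ α} {Q : α → ℕ → Prop} (h : ∀ a n, Q a n) :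
    p.Sat I Q := by
  induction p generalizing Q with
  | ret a => exact h _ _
  | step i k ih => exact fun r _ => ih r fun a n => h a (n + 1)

theorem Prog.ev_mono (p : Prog m₁ m₂ α) {f g : α → ℝ≥0∞} (h : ∀ a, f a ≤ g a) :
    p.ev I f ≤ p.ev I g :=
  Prog.ev_mono_of_sat (Prog.sat_of_forall fun a _ => h a)

theorem Prog.Sat.bind {p : Prog m₁ m₂ α} {g : α → Prog m₁ m₂ γ} {Q : γ → ℕ → Prop}
    (h : p.Sat I fun a n => (g a).Sat I fun b k => Q b (k + n)) : (p >>= g).Sat I Q := by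
  rw [Prog.bind_eq]
  induction p generalizing Q with
  | ret a => exact h
  | step i k ih => exact fun r hr => ih r (h r hr)

theorem Prog.Costs.bind {p : Prog m₁ m₂ α} {g : α → Prog m₁ m₂ γ} {c d : ℕ} {R : α → Prop}
    {Q : γ → Prop} (hp : p.Costs I c R) (hg : ∀ a, R a → (g a).Costs I d Q) :
    (p >>= g).Costs I (c + d) Q :=
  Prog.Sat.bind (hp.mono fun a n h => (hg a h.2).mono fun b k h' => ⟨by omega, h'.2⟩)

theorem Prog.Costs.mono {p : Prog m₁ m₂ α} {c d : ℕ} {R Q : α → Prop} (hp : p.Costs I c R)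
    (hcd : c ≤ d) (h : ∀ a, R a → Q a) : p.Costs I d Q :=
  Prog.Sat.mono hp fun a _ h' => ⟨h'.1.trans hcd, h a h'.2⟩

theorem Prog.Costs.weaken {p : Prog m₁ m₂ α} {c d : ℕ} {R : α → Prop} (hp : p.Costs I c R)
    (hcd : c ≤ d) : p.Costs I d R := hp.mono hcd fun _ h => h

theorem Prog.costs_pure {a : α} {R : α → Prop} (h : R a) (c : ℕ) :
    (pure a : Prog m₁ m₂ α).Costs I c R := ⟨Nat.zero_le _, h⟩

theorem costs_op {β : Type} {i : Instr m₁ m₂ β} {R : β → Prop}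
    (h : ∀ r ∈ (i.exec I).support, R r) : (op i).Costs I 1 R :=
  fun r hr => ⟨le_rfl, h r hr⟩

theorem costs_op_bind {β : Type} {i : Instr m₁ m₂ β} {g : β → Prog m₁ m₂ γ} {d : ℕ} {Q : γ → Prop}
    (h : ∀ r ∈ (i.exec I).support, (g r).Costs I d Q) : (op i >>= g).Costs I (d + 1) Q := by
  rw [add_comm]
  exact (costs_op (R := fun r => r ∈ (i.exec I).support) fun _ h => h).bind h

/-- Instructions with a deterministic result. -/
theorem costs_det_bind {β : Type} {i : Instr m₁ m₂ β} {g : β → Prog m₁ m₂ γ} {d : ℕ}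
    {Q : γ → Prop} (b : β) (hb : i.exec I = PMF.pure b) (h : (g b).Costs I d Q) :
    (op i >>= g).Costs I (d + 1) Q :=
  costs_op_bind fun r hr => by
    rw [hb, PMF.support_pure, Set.mem_singleton_iff] at hr
    exact hr ▸ h

theorem costs_det {β : Type} {i : Instr m₁ m₂ β} {R : β → Prop} (b : β)
    (hb : i.exec I = PMF.pure b) (h : R b) : (op i).Costs I 1 R :=
  costs_op fun r hr => by
    rw [hb, PMF.support_pure, Set.mem_singleton_iff] at hr
    exact hr ▸ h

theorem Prog.sat_of_mem_support_run {p : Prog m₁ m₂ α} {Q : α → ℕ → Prop} (h : p.Sat I Q)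
    {o : α × ℕ} (ho : o ∈ (p.run I).support) : Q o.1 o.2 := by
  induction p generalizing Q o with
  | ret a =>
    simp only [Prog.run, PMF.support_pure, Set.mem_singleton_iff] at ho
    exact ho ▸ h
  | step i k ih =>
    simp only [Prog.run, PMF.mem_support_bind_iff, PMF.mem_support_map_iff] at ho
    obtain ⟨r, hr, o', ho', rfl⟩ := ho
    exact ih r (h r hr) ho'

-- Connects the semantics `Prog.run`, which carries the step count, with `Prog.ev`, which forgets
-- it: probabilities of events about the result alone can be computed by `Prog.ev`.
open Classical in
theorem Prog.toOuterMeasure_run (p : Prog m₁ m₂ α) (A : Set α) :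
    (p.run I).toOuterMeasure {o | o.1 ∈ A} = p.ev I (A.indicator fun _ => 1) := by
  induction p with
  | ret a => simp [Prog.run, Prog.ev, Set.indicator_apply, PMF.toOuterMeasure_pure_apply]
  | step i k ih =>
    simp only [Prog.run, Prog.ev, PMF.toOuterMeasure_bind_apply, PMF.toOuterMeasure_map_apply]
    exact tsum_congr fun r => by rw [← ih r]; rfl

/-! ### Union bounds -/

/-- The probability that the result of a program violates `Q`. -/
def Prog.fail (I : Input m₁ m₂) (p : Prog m₁ m₂ α) (Q : α → Prop) : ℝ≥0∞ :=
  p.ev I ({a | ¬ Q a}.indicator fun _ => 1)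

theorem Prog.fail_pure {a : α} {Q : α → Prop} (h : Q a) :
    (pure a : Prog m₁ m₂ α).fail I Q = 0 := by
  simp [Prog.fail, h]

theorem Prog.ev_add_const (p : Prog m₁ m₂ α) (f g : α → ℝ≥0∞) :
    p.ev I (fun a => f a + g a) = p.ev I f + p.ev I g := by
  induction p with
  | ret a => rfl
  | step i k ih => simp only [Prog.ev, ih, mul_add, ENNReal.tsum_add]

/-- The union bound for sequential composition. On results violating `Q` the second failure
probability is only bounded by `1`; elsewhere it is at most `c`. -/
theorem Prog.fail_bind_le {p : Prog m₁ m₂ α} {g : α → Prog m₁ m₂ γ} {Q : α → Prop} {R : γ → Prop}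
    {b c : ℝ≥0∞} (hp : p.fail I Q ≤ b) (hg : ∀ a, Q a → (g a).fail I R ≤ c) :
    (p >>= g).fail I R ≤ b + c := by
  classical
  have hle : ∀ f : γ → ℝ≥0∞, (∀ x, f x ≤ 1) → ∀ a, (g a).ev I f ≤ 1 := fun f hf a =>
    ((g a).ev_mono hf).trans ((g a).ev_const 1).le
  calc (p >>= g).fail I R
      = p.ev I fun a => (g a).fail I R := by simp [Prog.fail]
    _ ≤ p.ev I fun a => {a | ¬ Q a}.indicator (fun _ => 1) a + c := by
        refine p.ev_mono fun a => ?_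
        by_cases ha : Q a
        · exact (hg a ha).trans le_add_self
        · refine (hle _ (fun x => ?_) a).trans ?_
          · exact Set.indicator_le_self' (fun _ _ => zero_le_one) x
          · simp [ha]
    _ = p.fail I Q + c := by rw [Prog.ev_add_const, Prog.ev_const, Prog.fail]
    _ ≤ b + c := add_le_add_left hp c

theorem Prog.fail_le_of_sat {p : Prog m₁ m₂ α} {Q : α → Prop} (h : p.Sat I fun a _ => Q a) :
    p.fail I Q = 0 := by
  have : p.ev I ({a | ¬ Q a}.indicator fun _ => 1) ≤ p.ev I fun _ => 0 :=
    Prog.ev_mono_of_sat (h.mono fun a _ ha => by simp [ha])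
  rw [Prog.ev_const] at this
  exact le_antisymm this zero_le

theorem Prog.fail_mono {p : Prog m₁ m₂ α} {Q R : α → Prop} (h : ∀ a, Q a → R a) :
    p.fail I R ≤ p.fail I Q := by
  refine p.ev_mono fun a => ?_
  by_cases hQ : Q a
  · simp [h a hQ]
  · by_cases hR : R a <;> simp [hQ, hR]

/-! ### Loops -/

theorem costs_foldlM {ι σ : Type} (R : σ → Prop) (c : ℕ) (body : ι → σ → Prog m₁ m₂ σ)
    (h : ∀ i s, R s → (body i s).Costs I c R) (l : List ι) {s : σ} (hs : R s) :
    (l.foldlM (fun s i => (do op .tick; body i s : Prog m₁ m₂ σ)) s).Costs I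
      (l.length * (c + 1)) R := by
  induction l generalizing s with
  | nil => exact Prog.costs_pure hs _
  | cons i l ih =>
    rw [List.foldlM_cons]
    refine (Prog.Costs.bind (costs_op_bind fun _ _ => h i s hs) fun s' hs' => ih hs').weaken ?_
    simp only [List.length_cons]
    exact le_of_eq (by ring)

theorem costs_forLoop {σ : Type} (R : σ → Prop) {k c : ℕ} {s : σ} {body : Fin k → σ → Prog m₁ m₂ σ}
    (hs : R s) (h : ∀ i s, R s → (body i s).Costs I c R) :
    (forLoop k s body).Costs I (k * (c + 1)) R := by
  have := costs_foldlM (I := I) R c body h (List.finRange k) hs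
  rwa [List.length_finRange] at this

/-- Loop rule with an invariant that depends on the number of passes. -/
theorem costs_forLoop_inv {σ : Type} {k c : ℕ} {s : σ} {body : Fin k → σ → Prog m₁ m₂ σ}
    (R : ℕ → σ → Prop) (hs : R 0 s)
    (h : ∀ (i : Fin k) s, R i s → (body i s).Costs I c (R (i + 1))) :
    (forLoop k s body).Costs I (k * (c + 1)) (R k) := by
  -- Generalised from `List.finRange k` to lists of consecutive indices starting at `n`, a class
  -- closed under taking tails.
  have key : ∀ (l : List (Fin k)) (n : ℕ) (s : σ), R n s →
      (∀ j (hj : j < l.length), (l[j] : ℕ) = n + j) →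
      (l.foldlM (fun s i => (do op .tick; body i s : Prog m₁ m₂ σ)) s).Costs I
        (l.length * (c + 1)) (R (n + l.length)) := by
    intro l
    induction l with
    | nil => exact fun n s hs _ => Prog.costs_pure hs _
    | cons i l ih =>
      intro n s hs hl
      have hi : (i : ℕ) = n := hl 0 (Nat.succ_pos _)
      rw [List.foldlM_cons]
      refine (Prog.Costs.bind (costs_op_bind fun _ _ => h i s (hi.symm ▸ hs)) fun s' hs' =>
        ih (n + 1) s' (hi ▸ hs') fun j hj => ?_).mono ?_ fun a ha => ?_
      · have := hl (j + 1) (by simpa using hj)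
        simp only [List.getElem_cons_succ] at this
        omega
      · simp only [List.length_cons]
        exact le_of_eq (by ring)
      · rw [List.length_cons, Nat.add_comm l.length, ← Nat.add_assoc]
        exact ha
  have := key (List.finRange k) 0 s hs (by simp)
  simpa [forLoop] using this

theorem fail_forLoop_inv {σ : Type} {k : ℕ} {c : ℝ≥0∞} {s : σ} {body : Fin k → σ → Prog m₁ m₂ σ}
    (R : ℕ → σ → Prop) (hs : R 0 s)
    (h : ∀ (i : Fin k) s, R i s → (body i s).fail I (R (i + 1)) ≤ c) :
    (forLoop k s body).fail I (R k) ≤ k * c := by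
  have key : ∀ (l : List (Fin k)) (n : ℕ) (s : σ), R n s →
      (∀ j (hj : j < l.length), (l[j] : ℕ) = n + j) →
      (l.foldlM (fun s i => (do op .tick; body i s : Prog m₁ m₂ σ)) s).fail I
        (R (n + l.length)) ≤ l.length * c := by
    intro l
    induction l with
    | nil => exact fun n s hs _ => (Prog.fail_pure hs).le.trans zero_le
    | cons i l ih =>
      intro n s hs hl
      have hi : (i : ℕ) = n := hl 0 (Nat.succ_pos _)
      rw [List.foldlM_cons]
      have h1 : (op .tick >>= fun _ => body i s : Prog m₁ m₂ σ).fail I (R (n + 1)) ≤ c := by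
        have := h i s (hi.symm ▸ hs)
        rw [hi] at this
        simpa [Prog.fail] using this
      have h2 := Prog.fail_bind_le (R := R (n + 1 + l.length)) h1 fun s' hs' =>
        ih (n + 1) s' hs' fun j hj => by
          have := hl (j + 1) (by simpa using hj)
          simp only [List.getElem_cons_succ] at this
          omega
      rw [List.length_cons, Nat.add_comm l.length, ← Nat.add_assoc]
      refine h2.trans (le_of_eq ?_)
      push_cast
      ring
  have := key (List.finRange k) 0 s hs (by simp)
  simpa [forLoop] using this

/-! ### Programs without access to the validation set -/

theorem Instr.exec_eq_of_isTrain {J : Input m₁ m₂} (hy : I.y = J.y) (hu : I.u = J.u)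
    (hK : I.K = J.K) {β : Type} {i : Instr m₁ m₂ β} (hi : i.IsTrain) : i.exec I = i.exec J := by
  cases i <;> simp_all [Instr.exec, Instr.IsTrain]

/-- This is how independence of the validation set is expressed: two inputs with the same training
part give the same expectations. -/
theorem Prog.ev_eq_of_isTrain {J : Input m₁ m₂} (hy : I.y = J.y) (hu : I.u = J.u)
    (hK : I.K = J.K) {p : Prog m₁ m₂ α} (hp : p.IsTrain) (f : α → ℝ≥0∞) :
    p.ev I f = p.ev J f := by
  induction p with
  | ret a => rfl
  | step i k ih =>
    simp only [Prog.ev]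
    refine tsum_congr fun r => ?_
    rw [Instr.exec_eq_of_isTrain hy hu hK hp.1, ih r (hp.2 r)]

theorem isTrain_op {β : Type} {i : Instr m₁ m₂ β} (hi : i.IsTrain) : (op i).IsTrain :=
  ⟨hi, fun _ => trivial⟩

theorem Prog.IsTrain.bind {p : Prog m₁ m₂ α} {g : α → Prog m₁ m₂ γ} (hp : p.IsTrain)
    (hg : ∀ a, (g a).IsTrain) : (p >>= g).IsTrain := by
  rw [Prog.bind_eq]
  induction p with
  | ret a => exact hg a
  | step i k ih => exact ⟨hp.1, fun r => ih r (hp.2 r)⟩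

theorem isTrain_op_bind {β : Type} {i : Instr m₁ m₂ β} {g : β → Prog m₁ m₂ γ} (hi : i.IsTrain)
    (hg : ∀ a, (g a).IsTrain) : (op i >>= g).IsTrain := (isTrain_op hi).bind hg

theorem isTrain_forLoop {σ : Type} {k : ℕ} {s : σ} {body : Fin k → σ → Prog m₁ m₂ σ}
    (h : ∀ i s, (body i s).IsTrain) : (forLoop k s body).IsTrain := by
  unfold forLoop
  generalize List.finRange k = l
  induction l generalizing s with
  | nil => trivial
  | cons i l ih =>
    rw [List.foldlM_cons]
    exact (isTrain_op_bind (i := .tick) (by simp [Instr.IsTrain]) fun _ => h i s).bind fun _ => ih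

/-- Integration of a parameter and the expectation over the randomness of a program commute. -/
theorem measurable_ev_and_lintegral_ev {Ω : Type*} [MeasurableSpace Ω] (μ : Measure Ω)
    (p : Prog m₁ m₂ α) {f : Ω → α → ℝ≥0∞} (hf : ∀ a, Measurable fun ω => f ω a) :
    (Measurable fun ω => p.ev I (f ω)) ∧
      ∫⁻ ω, p.ev I (f ω) ∂μ = p.ev I fun a => ∫⁻ ω, f ω a ∂μ := by
  induction p with
  | ret a => exact ⟨hf a, rfl⟩
  | @step β i k ih =>
    -- The result type `β` may be uncountable. Restricting to the countable support makes countable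
    -- measurability and the exchange of sum and integral available.
    have hsupp : ∀ g : β → ℝ≥0∞, ∑' r, i.exec I r * g r
        = ∑' r : (i.exec I).support, i.exec I r * g r := fun g => by
      refine (tsum_subtype_eq_of_support_subset fun r hr => ?_).symm
      rw [PMF.mem_support_iff]
      exact left_ne_zero_of_mul hr
    have : Countable (i.exec I).support := (i.exec I).support_countable.to_subtype
    simp only [Prog.ev, hsupp]
    have hm : ∀ r : (i.exec I).support,
        Measurable fun ω => i.exec I r * (k r).ev I (f ω) := fun r => (ih r).1.const_mul _
    refine ⟨Measurable.tsum hm, ?_⟩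
    rw [lintegral_tsum fun r => (hm r).aemeasurable]
    refine tsum_congr fun r => ?_
    rw [lintegral_const_mul _ (ih r).1, (ih r).2]

end Semantics

/-! ### Correctness of the inner product estimation -/

section Sampling

variable {m₁ m₂ : ℕ} {I : Input m₁ m₂}

/-- The partial sums `∑_{i < k} |a i|`. -/
def partialSum {m : ℕ} (a : Fin m → ℝ) (k : ℕ) : ℝ :=
  ∑ i with i.val < k, |a i|

theorem partialSum_zero {m : ℕ} (a : Fin m → ℝ) : partialSum a 0 = 0 := by
  simp [partialSum]

theorem partialSum_last {m : ℕ} (a : Fin m → ℝ) : partialSum a m = ∑ i, |a i| := by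
  simp [partialSum]

theorem partialSum_succ {m : ℕ} (a : Fin m → ℝ) (i : Fin m) :
    partialSum a (i + 1) = partialSum a i + |a i| := by
  have : Finset.univ.filter (fun j : Fin m => j.val < i + 1)
      = insert i (Finset.univ.filter fun j : Fin m => j.val < i) := by
    ext j
    simp only [Finset.mem_filter, Finset.mem_univ, true_and, Finset.mem_insert, Fin.ext_iff]
    omega
  rw [partialSum, this, Finset.sum_insert (by simp), add_comm]
  rfl

theorem costs_prepareSampler {m : ℕ} (a : Fin m → ℝ) :
    (prepareSampler (m₁ := m₁) (m₂ := m₂) a).Costs I (m * 6)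
      (fun S => S = fun k : Fin (m + 1) => partialSum a k) := by
  refine (costs_forLoop_inv (fun n S => ∀ j : Fin (m + 1), j.val ≤ n → S j = partialSum a j)
    (fun j hj => ?_) fun i S hS => ?_).mono le_rfl fun S hS => funext fun j => hS j (by omega)
  · rw [Nat.le_zero.1 hj, partialSum_zero]
  · refine costs_det_bind _ rfl (costs_det_bind _ rfl (costs_det_bind _ rfl
      (costs_det_bind _ rfl (costs_det _ rfl fun j hj => ?_))))
    by_cases h : j = i.succ
    · subst h
      rw [Function.update_self, hS i.castSucc (by simp), Fin.val_succ, partialSum_succ,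
        Fin.val_castSucc]
    · rw [Function.update_of_ne h]
      refine hS j ?_
      have : j.val ≠ i + 1 := fun h' => h (Fin.ext (by simpa using h'))
      omega

theorem partialSum_sub {m : ℕ} (a : Fin m → ℝ) {lo hi : ℕ} (h : lo ≤ hi) :
    partialSum a hi - partialSum a lo = ∑ i with lo ≤ i.val ∧ i.val < hi, |a i| := by
  rw [sub_eq_iff_eq_add, partialSum, partialSum, ← Finset.sum_union]
  · congr 1
    ext i
    simp only [Finset.mem_filter, Finset.mem_univ, true_and, Finset.mem_union]
    omega
  · rw [Finset.disjoint_filter]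
    intro i _ hi
    omega

/-- The probabilities along the bisection telescope, since each coin has bias (left mass)/(block
mass). Multiplying by the block mass avoids division and keeps the statement true for blocks of mass
zero, which can occur in the recursion. -/
theorem ev_drawIndex {m : ℕ} (a : Fin m → ℝ) (f : Fin m → ℝ≥0∞) (len : ℕ) :
    ∀ (lo : ℕ) (hpos : 0 < len) (hle : lo + len ≤ m),
    ENNReal.ofReal (partialSum a (lo + len) - partialSum a lo) *
      (drawIndex (m₁ := m₁) (m₂ := m₂) (fun k => partialSum a k) lo len hpos hle).ev I f
      = ∑ i with lo ≤ i.val ∧ i.val < lo + len, ENNReal.ofReal |a i| * f i := by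
  induction len using Nat.strong_induction_on with
  | _ len ih =>
  intro lo hpos hle
  rw [drawIndex]
  by_cases h1 : len = 1
  · subst h1
    have hs : Finset.univ.filter (fun i : Fin m => lo ≤ i.val ∧ i.val < lo + 1)
        = {⟨lo, by omega⟩} := by
      ext i
      simp only [Finset.mem_filter, Finset.mem_univ, true_and, Finset.mem_singleton, Fin.ext_iff]
      omega
    rw [partialSum_sub a (by omega), hs]
    simp
  · set total := partialSum a (lo + len) - partialSum a lo with htotal
    have htot0 : 0 ≤ total := by
      rw [htotal, partialSum_sub a (by omega)]
      positivity
    -- For a block of mass zero the coin has bias `0 / 0`, but both sides vanish.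
    rcases htot0.eq_or_lt with h0 | h0
    · rw [← h0, ENNReal.ofReal_zero, zero_mul]
      refine (Finset.sum_eq_zero fun i hi => ?_).symm
      have h2 := h0
      rw [htotal, partialSum_sub a (by omega), eq_comm,
        Finset.sum_eq_zero_iff_of_nonneg fun _ _ => abs_nonneg _] at h2
      rw [h2 i hi, ENNReal.ofReal_zero, zero_mul]
    · set left := partialSum a (lo + len / 2) - partialSum a lo with hleft
      set right := partialSum a (lo + len) - partialSum a (lo + len / 2) with hright
      have hl0 : 0 ≤ left := by
        rw [hleft, partialSum_sub a (by omega)]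
        positivity
      have hr0 : 0 ≤ right := by
        rw [hright, partialSum_sub a (by omega)]
        positivity
      have hsum : total = left + right := by rw [htotal, hleft, hright]; ring
      have ihl := ih (len / 2) (by omega) lo (by omega) (by omega)
      have ihr := ih (len - len / 2) (by omega) (lo + len / 2) (by omega) (by omega)
      simp only [show lo + len / 2 + (len - len / 2) = lo + len by omega, ← hright] at ihr
      rw [← hleft] at ihl
      have hsplit : Finset.univ.filter (fun i : Fin m => lo ≤ i.val ∧ i.val < lo + len)
          = Finset.univ.filter (fun i : Fin m => lo ≤ i.val ∧ i.val < lo + len / 2) ∪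
            Finset.univ.filter (fun i : Fin m => lo + len / 2 ≤ i.val ∧ i.val < lo + len) := by
        ext i
        simp only [Finset.mem_filter, Finset.mem_univ, true_and, Finset.mem_union]
        omega
      rw [hsplit, Finset.sum_union, ← ihl, ← ihr]
      · simp only [h1, dite_false, Prog.ev_bind, ev_tick, ev_load, ev_sub, ev_div]
        rw [ev_coin I (div_nonneg hl0 h0.le) (div_le_one_of_le₀ (by linarith) h0.le)]
        simp only [if_true, Bool.false_eq_true, if_false]
        rw [mul_add, ← mul_assoc, ← mul_assoc, ← ENNReal.ofReal_mul h0.le,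
          ← ENNReal.ofReal_mul h0.le]
        have e1 : total * (left / total) = left := by field_simp
        have e2 : total * (1 - left / total) = right := by
          rw [mul_sub, e1, hsum]; ring
        rw [e1, e2]
      · rw [Finset.disjoint_filter]
        intro i _ hi
        omega

/-- The values of the estimator `Z`. -/
def zValue {m : ℕ} (a v : Fin m → ℝ) (i : Fin m) : ℝ :=
  if 0 ≤ a i then (∑ j, |a j|) * v i else 0 - (∑ j, |a j|) * v i

theorem ev_sampleZ {m : ℕ} [NeZero m] (a v : Fin m → ℝ) {query : Fin m → Prog m₁ m₂ ℝ}
    (hq : ∀ i g, (query i).ev I g = g (v i)) (f : ℝ → ℝ≥0∞) :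
    ENNReal.ofReal (∑ i, |a i|) *
      (sampleZ a (fun k => partialSum a k) (∑ i, |a i|) query).ev I f
      = ∑ i, ENNReal.ofReal |a i| * f (zValue a v i) := by
  have h := ev_drawIndex (I := I) a (fun i => f (zValue a v i)) m 0
    (Nat.pos_of_ne_zero (NeZero.ne m)) (by omega)
  simp only [zero_add, partialSum_zero, sub_zero, partialSum_last] at h
  have hs : Finset.univ.filter (fun i : Fin m => 0 ≤ i.val ∧ i.val < m) = Finset.univ := by
    ext i; simp
  rw [hs] at h
  rw [← h, sampleZ]
  simp only [Prog.ev_bind, ev_load, hq, ev_mul, ev_le]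
  congr 2
  funext i
  by_cases hi : 0 ≤ a i <;> simp [hi, zValue]

theorem ev_sampleZ_ofReal {m : ℕ} [NeZero m] (a v : Fin m → ℝ) {query : Fin m → Prog m₁ m₂ ℝ}
    (hq : ∀ i g, (query i).ev I g = g (v i)) (ha : 0 < ∑ i, |a i|) {g : ℝ → ℝ} (hg : ∀ z, 0 ≤ g z) :
    (sampleZ a (fun k => partialSum a k) (∑ i, |a i|) query).ev I (fun z => ENNReal.ofReal (g z))
      = ENNReal.ofReal ((∑ i, |a i| * g (zValue a v i)) / ∑ i, |a i|) := by
  have h := ev_sampleZ (I := I) a v hq fun z => ENNReal.ofReal (g z)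
  rw [ENNReal.ofReal_div_of_pos ha,
    ENNReal.eq_div_iff (by simpa using ha) ENNReal.ofReal_ne_top, h,
    ENNReal.ofReal_sum_of_nonneg fun i _ => mul_nonneg (abs_nonneg _) (hg _)]
  exact Finset.sum_congr rfl fun i _ => (ENNReal.ofReal_mul (abs_nonneg _)).symm

/-- Unbiasedness before summation: adding up over `i` and dividing by `‖a‖₁` gives `E[Z] = a · v`.
-/
theorem abs_mul_zValue {m : ℕ} (a v : Fin m → ℝ) (i : Fin m) :
    |a i| * zValue a v i = (∑ j, |a j|) * (a i * v i) := by
  unfold zValue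
  split_ifs with h
  · rw [abs_of_nonneg h]; ring
  · rw [abs_of_neg (not_le.1 h)]; ring

theorem zValue_sq {m : ℕ} (a v : Fin m → ℝ) (i : Fin m) :
    zValue a v i ^ 2 = ((∑ j, |a j|) * v i) ^ 2 := by
  unfold zValue
  split_ifs <;> ring

/-- The second moment bound for `Z`. -/
theorem ev_sampleZ_sq_le {m : ℕ} [NeZero m] (a v : Fin m → ℝ) {query : Fin m → Prog m₁ m₂ ℝ}
    (hq : ∀ i g, (query i).ev I g = g (v i)) (ha : 0 < ∑ i, |a i|) {K : ℝ} (hv : ∀ i, |v i| ≤ K)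
    (x : ℝ) {r : ℝ} (hr : 0 ≤ r) :
    (sampleZ a (fun k => partialSum a k) (∑ i, |a i|) query).ev I
      (fun z => ENNReal.ofReal ((x + z) ^ 2 + r))
      ≤ ENNReal.ofReal ((x + ∑ i, a i * v i) ^ 2 + ((∑ i, |a i|) * K) ^ 2 + r) := by
  rw [ev_sampleZ_ofReal a v hq ha (g := fun z => (x + z) ^ 2 + r) fun z => by positivity]
  refine ENNReal.ofReal_le_ofReal ?_
  set A := ∑ i, |a i| with hA
  set μ := ∑ i, a i * v i with hμ
  rw [div_le_iff₀ ha]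
  have h1 : ∑ i, |a i| * ((x + zValue a v i) ^ 2 + r)
      = A * (x ^ 2 + r) + 2 * x * (A * μ) + ∑ i, |a i| * zValue a v i ^ 2 := by
    rw [hA, hμ, Finset.mul_sum, Finset.mul_sum, Finset.sum_mul, ← Finset.sum_add_distrib,
      ← Finset.sum_add_distrib]
    refine Finset.sum_congr rfl fun i _ => ?_
    have := abs_mul_zValue a v i
    linear_combination 2 * x * this
  have h2 : ∑ i, |a i| * zValue a v i ^ 2 ≤ A * (A * K) ^ 2 := by
    rw [hA, Finset.sum_mul]
    refine Finset.sum_le_sum fun i _ => mul_le_mul_of_nonneg_left ?_ (abs_nonneg _)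
    rw [zValue_sq, mul_pow, mul_pow]
    refine mul_le_mul_of_nonneg_left ?_ (sq_nonneg _)
    rw [← sq_abs (v i)]
    exact pow_le_pow_left₀ (abs_nonneg _) (hv i) 2
  rw [h1]
  -- Completing the square to `(x + μ)²` leaves a surplus `A μ²`, which is discarded: the variance
  -- is bounded by the second moment.
  nlinarith [mul_nonneg ha.le (sq_nonneg μ)]

theorem Prog.ev_mul_left {α : Type} (p : Prog m₁ m₂ α) (c : ℝ≥0∞) (f : α → ℝ≥0∞) :
    p.ev I (fun a => c * f a) = c * p.ev I f := by
  induction p with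
  | ret a => rfl
  | step i k ih =>
    simp only [Prog.ev, ih, ← ENNReal.tsum_mul_left]
    exact tsum_congr fun r => by ring

/-- The mean of `N` independent runs deviates by at most `acc`, except with probability `2/9`. -/
theorem fail_meanOf_le {one : Prog m₁ m₂ ℝ} {μ V acc : ℝ} (hV : 0 ≤ V) (hacc : 0 < acc)
    (hone : ∀ x r : ℝ, 0 ≤ r → one.ev I (fun z => ENNReal.ofReal ((x + z) ^ 2 + r))
      ≤ ENNReal.ofReal ((x + μ) ^ 2 + V + r))
    {N : ℕ} (hN0 : 0 < N) (hN : 9 / 2 * (V / acc ^ 2) ≤ N) :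
    (meanOf N one).fail I (fun z => |z - μ| ≤ acc) ≤ ENNReal.ofReal (2 / 9) := by
  -- The second moment of the final sum about `c`, by induction on the remaining passes: each adds
  -- `μ` to the centre and `V` to the spread. The shift `x` and the constant `r` in `hone` are there
  -- for this induction.
  have loop : ∀ {ι : Type} (l : List ι) (s c : ℝ),
      (l.foldlM (fun s _ => (do op .tick; let z ← one; op (.add s z) : Prog m₁ m₂ ℝ)) s).ev I
        (fun t => ENNReal.ofReal ((t - c) ^ 2))
      ≤ ENNReal.ofReal ((s + l.length * μ - c) ^ 2 + l.length * V) := by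
    intro ι l
    induction l with
    | nil => intro s c; simp
    | cons i l ih =>
      intro s c
      simp only [List.foldlM_cons, Prog.ev_bind, ev_tick, ev_add]
      calc _ ≤ one.ev I (fun z => ENNReal.ofReal ((s + l.length * μ - c + z) ^ 2
              + l.length * V)) := by
            refine one.ev_mono fun z => (ih (s + z) c).trans (le_of_eq ?_)
            congr 2
            ring
        _ ≤ _ := (hone _ _ (by positivity)).trans (le_of_eq ?_)
      congr 1
      simp only [List.length_cons]
      push_cast
      ring
  have hNr : (0 : ℝ) < N := by exact_mod_cast hN0
  have h := loop (List.finRange N) 0 (N * μ)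
  rw [List.length_finRange, zero_add, sub_self] at h
  unfold meanOf Prog.fail
  simp only [Prog.ev_bind, ev_div]
  -- The Chebyshev factor for the sum; the sum deviates by more than `N * acc` exactly when the mean
  -- deviates by more than `acc`.
  set c : ℝ≥0∞ := ENNReal.ofReal (1 / (N * acc) ^ 2) with hc
  calc _ ≤ (forLoop N (0 : ℝ) fun _ s => (do let z ← one; op (.add s z) : Prog m₁ m₂ ℝ)).ev I
        (fun t => c * ENNReal.ofReal ((t - N * μ) ^ 2)) := by
        refine Prog.ev_mono _ fun t => ?_
        by_cases ht : |t / N - μ| ≤ acc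
        · simp [ht]
        · simp only [Set.indicator, Set.mem_ofPred_eq, ht, not_false_eq_true, if_true]
          rw [hc, ← ENNReal.ofReal_mul (by positivity), ← ENNReal.ofReal_one]
          refine ENNReal.ofReal_le_ofReal ?_
          rw [one_div, ← div_eq_inv_mul, one_le_div (by positivity),
            ← sq_abs (t - N * μ)]
          refine pow_le_pow_left₀ (by positivity) ?_ 2
          have : t - N * μ = N * (t / N - μ) := by field_simp
          rw [this, abs_mul, abs_of_pos hNr]
          exact mul_le_mul_of_nonneg_left (not_le.1 ht).le hNr.le
    _ ≤ c * ENNReal.ofReal (0 ^ 2 + N * V) := by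
        rw [Prog.ev_mul_left]
        exact mul_le_mul_right h _
    _ ≤ ENNReal.ofReal (2 / 9) := by
        rw [hc, ← ENNReal.ofReal_mul (by positivity)]
        refine ENNReal.ofReal_le_ofReal ?_
        have h3 : 9 / 2 * V ≤ N * acc ^ 2 := by
          have := mul_le_mul_of_nonneg_right hN (sq_nonneg acc)
          have e : 9 / 2 * (V / acc ^ 2) * acc ^ 2 = 9 / 2 * V := by field_simp
          linarith
        rw [div_mul_eq_mul_div, div_le_div_iff₀ (by positivity) (by norm_num)]
        nlinarith

/-! ### Sorting and the median -/

/-- The permutation property is kept apart from sortedness because it alone makes products over the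
entries invariant. The time is two steps per output entry before one list runs out, and one final
step. -/
theorem costs_mergeSorted : ∀ l r : List ℝ, (mergeSorted (m₁ := m₁) (m₂ := m₂) l r).Costs I
    (2 * (l.length + r.length) + 1) (fun s => s.Perm (l ++ r) ∧
      (l.Pairwise (· ≤ ·) → r.Pairwise (· ≤ ·) → s.Pairwise (· ≤ ·)))
  | [], r => by
    rw [mergeSorted]
    exact (costs_det_bind _ rfl (Prog.costs_pure (by simp) 0)).weaken (by omega)
  | x :: l, [] => by
    rw [mergeSorted]
    · exact (costs_det_bind _ rfl (Prog.costs_pure (by simp) 0)).weaken (by omega)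
    · simp
  | x :: l, y :: r => by
    have ih1 := costs_mergeSorted l (y :: r)
    have ih2 := costs_mergeSorted (x :: l) r
    rw [mergeSorted]
    refine (costs_det_bind _ rfl (costs_det_bind _ rfl (d := 2 * (l.length + r.length + 1) + 1)
      ?_)).weaken (by simp only [List.length_cons]; omega)
    by_cases h : x ≤ y
    · simp only [h, decide_true, if_true]
      refine (ih1.bind (d := 0) fun s hs => Prog.costs_pure ?_ _).weaken
        (by simp only [List.length_cons]; omega)
      refine ⟨(hs.1.cons x), fun hl hr => ?_⟩
      rw [List.pairwise_cons] at hl ⊢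
      refine ⟨fun z hz => ?_, hs.2 hl.2 hr⟩
      rcases List.mem_append.1 (hs.1.mem_iff.1 hz) with hz | hz
      · exact hl.1 z hz
      · rcases List.mem_cons.1 hz with rfl | hz
        · exact h
        · exact h.trans ((List.pairwise_cons.1 hr).1 z hz)
    · simp only [h, decide_false, Bool.false_eq_true, if_false]
      refine (ih2.bind (d := 0) fun s hs => Prog.costs_pure ?_ _).weaken
        (by simp only [List.length_cons]; omega)
      refine ⟨(hs.1.cons y).trans (List.perm_middle.symm), fun hl hr => ?_⟩
      rw [List.pairwise_cons] at hr ⊢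
      refine ⟨fun z hz => ?_, hs.2 hl hr.2⟩
      rcases List.mem_append.1 (hs.1.mem_iff.1 hz) with hz | hz
      · rcases List.mem_cons.1 hz with rfl | hz
        · exact (not_le.1 h).le
        · exact (not_le.1 h).le.trans ((List.pairwise_cons.1 hl).1 z hz)
      · exact hr.1 z hz
termination_by l r => l.length + r.length

/-- `e` bounds the depth of the recursion. The merges on one level together cost a multiple of `q`,
which gives the term `6 * q * e`. -/
theorem costs_sortedRuns {one : Prog m₁ m₂ ℝ} {c : ℕ} (hone : one.Costs I c fun _ => True) (q : ℕ) :
    ∀ e : ℕ, q ≤ 2 ^ e → (sortedRuns one q).Costs I (q * c + 1 + 6 * q * e)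
      (fun l => l.length = q ∧ l.Pairwise (· ≤ ·)) := by
  induction q using Nat.strong_induction_on with
  | _ q ih =>
  intro e he
  rw [sortedRuns]
  by_cases h0 : q = 0
  · simp only [h0, dite_true]
    exact (costs_det_bind _ rfl (Prog.costs_pure (by simp) 0)).weaken (by omega)
  by_cases h1 : q = 1
  · subst h1
    simp only [one_ne_zero, dite_true, dite_false]
    refine (costs_det_bind _ rfl (hone.bind (d := 0) fun x _ => Prog.costs_pure (by simp) _)).weaken
      ?_
    omega
  simp only [h0, h1, dite_false]
  obtain ⟨e, rfl⟩ : ∃ e', e = e' + 1 := by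
    refine Nat.exists_eq_succ_of_ne_zero ?_
    rintro rfl
    omega
  rw [pow_succ] at he
  have hc1 := ih (q / 2) (by omega) e (by omega)
  have hc2 := ih (q - q / 2) (by omega) e (by omega)
  refine (costs_det_bind _ rfl (hc1.bind fun l hl => hc2.bind (d := 2 * q + 1) fun r hr =>
    (costs_mergeSorted l r).mono ?_ fun s hs => ?_)).weaken ?_
  · omega
  · refine ⟨?_, hs.2 hl.2 hr.2⟩
    rw [hs.1.length_eq, List.length_append]
    omega
  · have e1 : q / 2 * c + (q - q / 2) * c = q * c := by
      rw [← Nat.add_mul]; congr 1; omega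
    have e2 : 6 * (q / 2) * e + 6 * (q - q / 2) * e = 6 * q * e := by
      rw [← Nat.add_mul]; congr 1; omega
    have e3 : 6 * q * (e + 1) = 6 * q * e + 6 * q := by ring
    omega

theorem ev_mergeSorted (w : ℝ → ℝ≥0∞) (l r : List ℝ) :
    (mergeSorted (m₁ := m₁) (m₂ := m₂) l r).ev I (fun s => (s.map w).prod)
      = (l.map w).prod * (r.map w).prod := by
  rw [← Prog.ev_const (I := I) (mergeSorted (m₁ := m₁) (m₂ := m₂) l r)
    ((l.map w).prod * (r.map w).prod)]
  have h : (mergeSorted (m₁ := m₁) (m₂ := m₂) l r).Sat I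
      fun s _ => (s.map w).prod = (l.map w).prod * (r.map w).prod :=
    Prog.Sat.mono (costs_mergeSorted l r) fun s _ hs => by
      rw [(hs.2.1.map w).prod_eq, List.map_append, List.prod_append]
  exact le_antisymm (Prog.ev_mono_of_sat (h.mono fun _ _ h => h.le))
    (Prog.ev_mono_of_sat (h.mono fun _ _ h => h.ge))

/-- Independence of the runs in the form a Chernoff bound needs. A product of weights ignores the
order of the entries, so sorting does not affect it, and it factors over the recursive calls. -/
theorem ev_sortedRuns (one : Prog m₁ m₂ ℝ) (w : ℝ → ℝ≥0∞) (q : ℕ) :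
    (sortedRuns one q).ev I (fun s => (s.map w).prod) = one.ev I w ^ q := by
  induction q using Nat.strong_induction_on with
  | _ q ih =>
  rw [sortedRuns]
  by_cases h0 : q = 0
  · simp [h0]
  by_cases h1 : q = 1
  · simp [h1]
  simp only [h0, h1, dite_false, Prog.ev_bind, ev_tick, ev_mergeSorted, Prog.ev_mul_left]
  rw [ih _ (by omega)]
  simp only [mul_comm _ (one.ev I w ^ (q - q / 2)), Prog.ev_mul_left]
  rw [ih _ (by omega), ← pow_add]
  congr 1
  omega

theorem costs_entryAt (l : List ℝ) (k : ℕ) :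
    (entryAt (m₁ := m₁) (m₂ := m₂) l k).Costs I (k + 1) (fun x => x = l.getD k 0) := by
  induction l generalizing k with
  | nil => exact Prog.costs_pure (by simp) _
  | cons y l ih =>
    cases k with
    | zero => exact costs_det_bind _ rfl (Prog.costs_pure (by simp) 0)
    | succ k => exact costs_det_bind _ rfl ((ih k).mono le_rfl fun x hx => by simpa using hx)

theorem costs_medianOf {one : Prog m₁ m₂ ℝ} {c : ℕ} (hone : one.Costs I c fun _ => True) {q e : ℕ}
    (he : q ≤ 2 ^ e) :
    (medianOf q one).Costs I (q * c + 1 + 6 * q * e + (q + 1)) fun _ => True :=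
  (costs_sortedRuns hone q e he).bind fun l _ =>
    (costs_entryAt l (q / 2)).mono (by omega) fun _ _ => trivial

/-- If the median of a sorted list lies outside of an interval, so do at least half of the
entries. -/
theorem one_le_prod_of_median_bad {l : List ℝ} (hl : l.Pairwise (· ≤ ·)) {lo hi s : ℝ} (hs : 1 ≤ s)
    (hq : l ≠ []) (hbad : ¬ (lo ≤ l.getD (l.length / 2) 0 ∧ l.getD (l.length / 2) 0 ≤ hi)) :
    1 ≤ (l.map fun x => if lo ≤ x ∧ x ≤ hi then s⁻¹ else s).prod := by
  set w : ℝ → ℝ := fun x => if lo ≤ x ∧ x ≤ hi then s⁻¹ else s with hw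
  have hs0 : 0 < s := by linarith
  have hpos : 0 < l.length := List.length_pos_iff.2 hq
  have hk : l.length / 2 < l.length := by omega
  set k := l.length / 2 with hk_def
  have hlow : ∀ t : List ℝ, s⁻¹ ^ t.length ≤ (t.map w).prod := by
    intro t
    induction t with
    | nil => simp
    | cons x t ih =>
      rw [List.length_cons, pow_succ', List.map_cons, List.prod_cons]
      refine mul_le_mul ?_ ih (by positivity) ?_
      · simp only [hw]
        split_ifs
        · rfl
        · exact (inv_le_one_of_one_le₀ hs).trans hs
      · simp only [hw]
        split_ifs <;> positivity
  have hall : ∀ t : List ℝ, (∀ x ∈ t, ¬ (lo ≤ x ∧ x ≤ hi)) → (t.map w).prod = s ^ t.length := by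
    intro t ht
    rw [List.prod_eq_pow_card _ s, List.length_map]
    intro y hy
    obtain ⟨x, hx, rfl⟩ := List.mem_map.1 hy
    simp only [hw, ht x hx, if_false]
  have hfin : ∀ a b : ℕ, b ≤ a → 1 ≤ s ^ a * s⁻¹ ^ b := by
    intro a b hab
    obtain ⟨c, rfl⟩ := Nat.exists_eq_add_of_le hab
    have : s ^ (b + c) * s⁻¹ ^ b = s ^ c := by
      rw [pow_add, inv_pow]; field_simp
    rw [this]
    exact one_le_pow₀ hs
  rw [List.getD_eq_getElem _ _ hk] at hbad
  have hdrop := List.drop_eq_getElem_cons hk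
  -- If the median is below `lo`, so are the first `k + 1` entries; if it is above `hi`, so are all
  -- entries from `k` on. Either way the factors `s` are at least as many as the possible factors
  -- `s⁻¹`.
  rcases not_and_or.1 hbad with h | h
  · have htake : l.take (k + 1) = l.take k ++ [l[k]] := (List.take_concat_get' l k hk).symm
    have hp : (l.take (k + 1)).Pairwise (· ≤ ·) := hl.sublist (List.take_sublist _ _)
    have hb : ∀ x ∈ l.take (k + 1), ¬ (lo ≤ x ∧ x ≤ hi) := by
      intro x hx hx'
      rw [htake] at hx hp
      rcases List.mem_append.1 hx with hx | hx
      · exact h (hx'.1.trans ((List.pairwise_append.1 hp).2.2 x hx _ (by simp)))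
      · rw [List.mem_singleton] at hx
        exact h (hx ▸ hx'.1)
    have e : (l.map w).prod = ((l.take (k + 1)).map w).prod * ((l.drop (k + 1)).map w).prod := by
      rw [← List.prod_append, ← List.map_append, List.take_append_drop]
    rw [e, hall _ hb]
    refine (hfin (l.take (k + 1)).length (l.drop (k + 1)).length ?_).trans
      (mul_le_mul_of_nonneg_left (hlow _) (by positivity))
    rw [List.length_take, List.length_drop]
    omega
  · have hp : (l.drop k).Pairwise (· ≤ ·) := hl.sublist (List.drop_sublist _ _)
    have hb : ∀ x ∈ l.drop k, ¬ (lo ≤ x ∧ x ≤ hi) := by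
      intro x hx hx'
      rw [hdrop] at hx hp
      rcases List.mem_cons.1 hx with rfl | hx
      · exact h hx'.2
      · exact h (((List.pairwise_cons.1 hp).1 x hx).trans hx'.2)
    have e : (l.map w).prod = ((l.drop k).map w).prod * ((l.take k).map w).prod := by
      rw [mul_comm, ← List.prod_append, ← List.map_append, List.take_append_drop]
    rw [e, hall _ hb]
    refine (hfin (l.drop k).length (l.take k).length ?_).trans
      (mul_le_mul_of_nonneg_left (hlow _) (by positivity))
    rw [List.length_take, List.length_drop]
    omega

/-- A Chernoff argument: weigh a bad run by `s` and a good one by `s⁻¹`. A bad median makes the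
product of the weights at least `1`, and its expectation is the `q`-th power of the expected weight
of one run. -/
theorem fail_medianOf_le {one : Prog m₁ m₂ ℝ} {μ acc : ℝ}
    (hone : one.fail I (fun z => |z - μ| ≤ acc) ≤ ENNReal.ofReal (2 / 9))
    {c : ℕ} (hcost : one.Costs I c fun _ => True) {q : ℕ} (hq : q ≠ 0) :
    (medianOf q one).fail I (fun z => |z - μ| ≤ acc) ≤ ENNReal.ofReal (Real.exp (-(q / 6))) := by
  -- The minimiser of `p s + (1 - p) / s` for `p = 2/9` is `√((1 - p) / p)`; the minimum is `14 / (9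
  -- s)`.
  set s : ℝ := Real.sqrt (7 / 2) with hs
  have hss : s * s = 7 / 2 := Real.mul_self_sqrt (by norm_num)
  have hs1 : 1 ≤ s := Real.one_le_sqrt.2 (by norm_num)
  have hs0 : 0 < s := by linarith
  set w : ℝ → ℝ := fun x => if μ - acc ≤ x ∧ x ≤ μ + acc then s⁻¹ else s with hw
  have hw0 : ∀ x, 0 ≤ w x := fun x => by simp only [hw]; split_ifs <;> positivity
  have hiff : ∀ x, (μ - acc ≤ x ∧ x ≤ μ + acc) ↔ |x - μ| ≤ acc := fun x => by
    rw [abs_le]; constructor <;> rintro ⟨h1, h2⟩ <;> constructor <;> linarith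
  have hprod : ∀ l : List ℝ, (l.map fun x => ENNReal.ofReal (w x)).prod
      = ENNReal.ofReal (l.map w).prod := by
    intro l
    induction l with
    | nil => simp
    | cons x l ih => simp [ih, ENNReal.ofReal_mul (hw0 x)]
  have hevw : one.ev I (fun x => ENNReal.ofReal (w x)) ≤ ENNReal.ofReal (14 / 9 * s⁻¹) := by
    calc one.ev I (fun x => ENNReal.ofReal (w x))
        ≤ one.ev I (fun x => ENNReal.ofReal (s - s⁻¹) *
            {z | ¬ |z - μ| ≤ acc}.indicator (fun _ => 1) x + ENNReal.ofReal s⁻¹) := by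
          refine one.ev_mono fun x => ?_
          by_cases hx : |x - μ| ≤ acc
          · simp only [hw, hiff, hx, if_true]
            exact le_add_self
          · have : s⁻¹ ≤ s := (inv_le_one_of_one_le₀ hs1).trans hs1
            simp only [hw, hiff, hx, if_false, Set.indicator, Set.mem_ofPred_eq, not_false_eq_true,
              if_true, mul_one]
            rw [← ENNReal.ofReal_add (by linarith) (by positivity)]
            simp
      _ ≤ ENNReal.ofReal (s - s⁻¹) * ENNReal.ofReal (2 / 9) + ENNReal.ofReal s⁻¹ := by
          rw [Prog.ev_add_const, Prog.ev_mul_left, Prog.ev_const]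
          gcongr
          exact hone
      _ = ENNReal.ofReal (14 / 9 * s⁻¹) := by
          have : s⁻¹ ≤ s := (inv_le_one_of_one_le₀ hs1).trans hs1
          rw [← ENNReal.ofReal_mul (by linarith), ← ENNReal.ofReal_add
            (mul_nonneg (by linarith) (by norm_num)) (by positivity)]
          congr 1
          have : s = 7 / 2 * s⁻¹ := by field_simp; linarith
          linear_combination (2 / 9 : ℝ) * this
  -- After taking sixth powers the claim is `(56/81)³ ≤ 1/e`.
  have hexp : 14 / 9 * s⁻¹ ≤ Real.exp (-(1 / 6)) := by
    refine le_of_pow_le_pow_left₀ (n := 6) (by norm_num) (Real.exp_pos _).le ?_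
    rw [← Real.exp_nat_mul]
    have h6 : (14 / 9 * s⁻¹) ^ 6 = (56 / 81) ^ 3 := by
      have : (14 / 9 * s⁻¹) ^ 2 = 56 / 81 := by
        rw [mul_pow, inv_pow, pow_two s, hss]; norm_num
      rw [show (6 : ℕ) = 2 * 3 by norm_num, pow_mul, this]
    rw [h6, show ((6 : ℕ) : ℝ) * -(1 / 6) = -1 by norm_num, Real.exp_neg,
      le_inv_comm₀ (by positivity) (Real.exp_pos _)]
    exact Real.exp_one_lt_d9.le.trans (by norm_num)
  obtain ⟨e, he⟩ : ∃ e, q ≤ 2 ^ e := ⟨q, Nat.lt_two_pow_self.le⟩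
  calc (medianOf q one).fail I (fun z => |z - μ| ≤ acc)
      ≤ (sortedRuns one q).ev I (fun l => (l.map fun x => ENNReal.ofReal (w x)).prod) := by
        unfold Prog.fail medianOf
        rw [Prog.ev_bind]
        refine Prog.ev_mono_of_sat (Prog.Sat.mono (costs_sortedRuns hcost q e he) fun l _ hl => ?_)
        have h2 : (entryAt (m₁ := m₁) (m₂ := m₂) l (q / 2)).ev I
            ({a | ¬ |a - μ| ≤ acc}.indicator fun _ => 1)
            ≤ (entryAt (m₁ := m₁) (m₂ := m₂) l (q / 2)).ev I fun _ =>
              {a | ¬ |a - μ| ≤ acc}.indicator (fun _ => 1) (l.getD (q / 2) 0) :=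
          Prog.ev_mono_of_sat (Prog.Sat.mono (costs_entryAt l (q / 2)) fun x _ hx => by rw [hx.2])
        rw [Prog.ev_const] at h2
        refine h2.trans ?_
        by_cases hx : |l.getD (q / 2) 0 - μ| ≤ acc
        · rw [Set.indicator_of_notMem (not_not.2 hx)]
          exact zero_le
        · simp only [Set.indicator, Set.mem_ofPred_eq, hx, not_false_eq_true, if_true]
          rw [hprod, ENNReal.one_le_ofReal]
          rw [← hl.2.1] at hx hq
          exact one_le_prod_of_median_bad hl.2.2 hs1 (fun h => hq (by simp [h]))
            (by rw [hiff]; exact hx)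
    _ ≤ ENNReal.ofReal (Real.exp (-(1 / 6))) ^ q := by
        rw [ev_sortedRuns]
        exact pow_le_pow_left₀ zero_le (hevw.trans (ENNReal.ofReal_le_ofReal hexp)) q
    _ = ENNReal.ofReal (Real.exp (-(q / 6))) := by
        rw [← ENNReal.ofReal_pow (Real.exp_pos _).le, ← Real.exp_nat_mul]
        congr 2
        ring

end Sampling

/-! ### Inner product estimation: running time, failure probability, no access to the validation set
-/

section Estimation

variable {m₁ m₂ : ℕ} {I : Input m₁ m₂}

theorem costs_drawIndex {m : ℕ} (S : Fin (m + 1) → ℝ) (len : ℕ) :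
    ∀ (e : ℕ) (_ : len ≤ 2 ^ e) (lo : ℕ) (hpos : 0 < len) (hle : lo + len ≤ m),
    (drawIndex (m₁ := m₁) (m₂ := m₂) S lo len hpos hle).Costs I (8 * e + 1) fun _ => True := by
  induction len using Nat.strong_induction_on with
  | _ len ih =>
  intro e he lo hpos hle
  rw [drawIndex]
  by_cases h1 : len = 1
  · simp only [h1, dite_true]
    exact (costs_det_bind _ rfl (Prog.costs_pure trivial 0)).weaken (by omega)
  · simp only [h1, dite_false]
    obtain ⟨e, rfl⟩ : ∃ e', e = e' + 1 := by
      refine Nat.exists_eq_succ_of_ne_zero ?_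
      rintro rfl
      omega
    rw [pow_succ] at he
    refine (costs_det_bind _ rfl (costs_det_bind _ rfl (costs_det_bind _ rfl (costs_det_bind _ rfl
      (costs_det_bind _ rfl (costs_det_bind _ rfl (costs_det_bind _ rfl
        (costs_op_bind (d := 8 * e + 1) fun c _ => ?_)))))))).weaken (by omega)
    by_cases hc : c = true
    · simp only [hc, if_true]
      exact ih (len / 2) (by omega) e (by omega) lo (by omega) (by omega)
    · simp only [hc]
      exact ih (len - len / 2) (by omega) e (by omega) (lo + len / 2) (by omega) (by omega)

theorem costs_sampleZ {m : ℕ} [NeZero m] (a : Fin m → ℝ) (S : Fin (m + 1) → ℝ) (norm : ℝ)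
    {query : Fin m → Prog m₁ m₂ ℝ} (hq : ∀ i, (query i).Costs I 1 fun _ => True) {e : ℕ}
    (he : m ≤ 2 ^ e) : (sampleZ a S norm query).Costs I (8 * e + 6) fun _ => True := by
  unfold sampleZ
  refine ((costs_drawIndex S m e he 0 _ _).bind (d := 5) fun i _ =>
    costs_det_bind _ rfl (Prog.Costs.weaken ((hq i).bind (d := 3) fun v _ => costs_det_bind _ rfl
      (costs_det_bind _ rfl (d := 1) ?_)) (by omega))).weaken (by omega)
  split_ifs
  · exact Prog.costs_pure trivial 1
  · exact costs_op fun _ _ => trivial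

theorem costs_meanOf {one : Prog m₁ m₂ ℝ} {c : ℕ} (hone : one.Costs I c fun _ => True) (N : ℕ) :
    (meanOf N one).Costs I (N * (c + 2) + 1) fun _ => True :=
  (costs_forLoop (fun _ => True) trivial fun _ _ _ => hone.bind (d := 1) fun _ _ =>
    costs_op fun _ _ => trivial).bind fun _ _ => costs_op fun _ _ => trivial

/-- The number of samples per mean. -/
def numSamples (acc vmax norm : ℝ) : ℕ :=
  ⌈(9 / 2 : ℝ) * (norm * vmax / acc * (norm * vmax / acc))⌉₊

/-- The budget `c` only has to cover the sampling when `‖a‖₁ vmax > acc`. In that case the ratio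
exceeds `1`, so the rounding in the sample count can be absorbed by its square. -/
theorem costs_estimateInner {m : ℕ} [NeZero m] (acc δ' vmax : ℝ) (a : Fin m → ℝ)
    (S : Fin (m + 1) → ℝ) {query : Fin m → Prog m₁ m₂ ℝ}
    (hq : ∀ i, (query i).Costs I 1 fun _ => True) {e e' c : ℕ} (he : m ≤ 2 ^ e)
    (he' : numReps δ' ≤ 2 ^ e')
    (hc : acc < S (Fin.last m) * vmax →
      numReps δ' * (numSamples acc vmax (S (Fin.last m)) * (8 * e + 8) + 1) + 1
        + 6 * numReps δ' * e' + (numReps δ' + 1) ≤ c) :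
    (estimateInner acc δ' vmax a S query).Costs I (c + 7) fun _ => True := by
  unfold estimateInner
  refine (costs_det_bind _ rfl (costs_det_bind _ rfl (costs_det_bind _ rfl (d := c + 4)
    ?_))).weaken (by omega)
  by_cases h : S (Fin.last m) * vmax ≤ acc
  · simp only [h, decide_true, if_true]
    exact Prog.costs_pure trivial _
  · simp only [h, decide_false, Bool.false_eq_true, if_false]
    refine costs_det_bind _ rfl (costs_det_bind _ rfl (costs_det_bind _ rfl
      (costs_det_bind _ rfl ?_)))
    exact (costs_medianOf (costs_meanOf (costs_sampleZ a S _ hq he) _) he').weaken (hc (not_le.1 h))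

/-- If `‖a‖₁ vmax ≤ acc`, the answer `0` is accurate since `|a · v| ≤ ‖a‖₁ vmax`. Otherwise each
mean fails with probability at most `2/9`, and `6 log(1/δ')` repetitions turn `exp(-q/6)` into at
most `δ'`. -/
theorem fail_estimateInner_le {m : ℕ} [NeZero m] {acc δ' vmax : ℝ} (hacc : 0 < acc) (hδ : 0 < δ')
    (hδ1 : δ' < 1) (a v : Fin m → ℝ) (hv : ∀ i, |v i| ≤ vmax) {query : Fin m → Prog m₁ m₂ ℝ}
    (hq : ∀ i g, (query i).ev I g = g (v i)) (hqc : ∀ i, (query i).Costs I 1 fun _ => True) :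
    (estimateInner acc δ' vmax a (fun k => partialSum a k) query).fail I
      (fun r => |r - ∑ i, a i * v i| ≤ acc) ≤ ENNReal.ofReal δ' := by
  have hlast : partialSum a (Fin.last m : Fin (m + 1)) = ∑ i, |a i| := partialSum_last a
  set A := ∑ i, |a i| with hA
  unfold estimateInner Prog.fail
  simp only [Prog.ev_bind, ev_load, ev_mul, ev_le, hlast]
  by_cases h : A * vmax ≤ acc
  · simp only [h, decide_true, if_true, Prog.ev_pure]
    rw [Set.indicator_of_notMem]
    · exact zero_le
    · rw [Set.mem_ofPred_eq, not_not, zero_sub, abs_neg]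
      refine le_trans ?_ h
      rw [hA, Finset.sum_mul]
      refine (Finset.abs_sum_le_sum_abs _ _).trans (Finset.sum_le_sum fun i _ => ?_)
      rw [abs_mul]
      exact mul_le_mul_of_nonneg_left (hv i) (abs_nonneg _)
  · simp only [h, decide_false, Bool.false_eq_true, if_false, Prog.ev_bind, ev_div, ev_mul, ev_ceil]
    rw [not_le] at h
    have hA0 : 0 < A := by
      refine lt_of_le_of_ne (by positivity) fun h0 => ?_
      rw [← h0, zero_mul] at h
      linarith
    have hratio : 0 < A * vmax / acc := div_pos (hacc.trans h) hacc
    obtain ⟨e, he⟩ : ∃ e, m ≤ 2 ^ e := ⟨m, Nat.lt_two_pow_self.le⟩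
    have hmean := fail_meanOf_le (I := I) (sq_nonneg (A * vmax)) hacc
      (fun x r hr => ev_sampleZ_sq_le a v hq hA0 hv x hr)
      (N := ⌈9 / 2 * (A * vmax / acc * (A * vmax / acc))⌉₊) (by positivity) (by
        refine le_trans (le_of_eq ?_) (Nat.le_ceil _)
        rw [← pow_two, div_pow])
    have hlog : 0 < Real.log (1 / δ') := Real.log_pos (by rw [one_div]; exact (one_lt_inv₀ hδ).2 hδ1)
    have hreps : numReps δ' ≠ 0 := (Nat.ceil_pos.2 (by positivity)).ne'
    refine (fail_medianOf_le hmean (costs_meanOf (costs_sampleZ a _ _ hqc he) _) hreps).trans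
      (ENNReal.ofReal_le_ofReal ?_)
    rw [← Real.le_log_iff_exp_le hδ]
    have h1 : 6 * Real.log (1 / δ') ≤ numReps δ' := Nat.le_ceil _
    rw [one_div, Real.log_inv] at h1
    linarith

theorem isTrain_drawIndex {m : ℕ} (S : Fin (m + 1) → ℝ) (len : ℕ) :
    ∀ (lo : ℕ) (hpos : 0 < len) (hle : lo + len ≤ m),
    (drawIndex (m₁ := m₁) (m₂ := m₂) S lo len hpos hle).IsTrain := by
  induction len using Nat.strong_induction_on with
  | _ len ih =>
  intro lo hpos hle
  rw [drawIndex]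
  split_ifs with h1
  · exact isTrain_op_bind (by simp [Instr.IsTrain]) fun _ => trivial
  · refine isTrain_op_bind (by simp [Instr.IsTrain]) fun _ => ?_
    refine isTrain_op_bind (by simp [Instr.IsTrain]) fun _ => ?_
    refine isTrain_op_bind (by simp [Instr.IsTrain]) fun _ => ?_
    refine isTrain_op_bind (by simp [Instr.IsTrain]) fun _ => ?_
    refine isTrain_op_bind (by simp [Instr.IsTrain]) fun _ => ?_
    refine isTrain_op_bind (by simp [Instr.IsTrain]) fun _ => ?_
    refine isTrain_op_bind (by simp [Instr.IsTrain]) fun _ => ?_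
    refine isTrain_op_bind (by simp [Instr.IsTrain]) fun _ => ?_
    split_ifs
    · exact ih (len / 2) (by omega) lo (by omega) (by omega)
    · exact ih (len - len / 2) (by omega) (lo + len / 2) (by omega) (by omega)

theorem isTrain_sampleZ {m : ℕ} [NeZero m] (a : Fin m → ℝ) (S : Fin (m + 1) → ℝ) (norm : ℝ)
    {query : Fin m → Prog m₁ m₂ ℝ} (hq : ∀ i, (query i).IsTrain) :
    (sampleZ a S norm query).IsTrain := by
  refine (isTrain_drawIndex S m 0 _ _).bind fun i => ?_
  refine isTrain_op_bind (by simp [Instr.IsTrain]) fun _ => (hq i).bind fun _ => ?_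
  refine isTrain_op_bind (by simp [Instr.IsTrain]) fun _ => ?_
  refine isTrain_op_bind (by simp [Instr.IsTrain]) fun _ => ?_
  split_ifs
  · trivial
  · exact isTrain_op (by simp [Instr.IsTrain])

theorem isTrain_meanOf {one : Prog m₁ m₂ ℝ} (h : one.IsTrain) (N : ℕ) : (meanOf N one).IsTrain :=
  (isTrain_forLoop fun _ _ => h.bind fun _ => isTrain_op (by simp [Instr.IsTrain])).bind fun _ =>
    isTrain_op (by simp [Instr.IsTrain])

theorem isTrain_mergeSorted : ∀ l r : List ℝ, (mergeSorted (m₁ := m₁) (m₂ := m₂) l r).IsTrain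
  | [], r => by
    rw [mergeSorted]
    exact isTrain_op_bind (by simp [Instr.IsTrain]) fun _ => trivial
  | x :: l, [] => by
    rw [mergeSorted]
    · exact isTrain_op_bind (by simp [Instr.IsTrain]) fun _ => trivial
    · simp
  | x :: l, y :: r => by
    have ih1 := isTrain_mergeSorted l (y :: r)
    have ih2 := isTrain_mergeSorted (x :: l) r
    rw [mergeSorted]
    refine isTrain_op_bind (by simp [Instr.IsTrain]) fun _ =>
      isTrain_op_bind (by simp [Instr.IsTrain]) fun _ => ?_
    split_ifs
    · exact ih1.bind fun _ => trivial
    · exact ih2.bind fun _ => trivial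
termination_by l r => l.length + r.length

theorem isTrain_sortedRuns {one : Prog m₁ m₂ ℝ} (h : one.IsTrain) (q : ℕ) :
    (sortedRuns one q).IsTrain := by
  induction q using Nat.strong_induction_on with
  | _ q ih =>
  rw [sortedRuns]
  split_ifs with h0 h1
  · exact isTrain_op_bind (by simp [Instr.IsTrain]) fun _ => trivial
  · exact isTrain_op_bind (by simp [Instr.IsTrain]) fun _ => h.bind fun _ => trivial
  · exact isTrain_op_bind (by simp [Instr.IsTrain]) fun _ =>
      (ih _ (by omega)).bind fun _ => (ih _ (by omega)).bind fun _ => isTrain_mergeSorted _ _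

theorem isTrain_entryAt (l : List ℝ) (k : ℕ) :
    (entryAt (m₁ := m₁) (m₂ := m₂) l k).IsTrain := by
  induction l generalizing k with
  | nil => trivial
  | cons y l ih =>
    cases k with
    | zero => exact isTrain_op_bind (by simp [Instr.IsTrain]) fun _ => trivial
    | succ k => exact isTrain_op_bind (by simp [Instr.IsTrain]) fun _ => ih k

theorem isTrain_estimateInner {m : ℕ} [NeZero m] (acc δ' vmax : ℝ) (a : Fin m → ℝ)
    (S : Fin (m + 1) → ℝ) {query : Fin m → Prog m₁ m₂ ℝ} (hq : ∀ i, (query i).IsTrain) :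
    (estimateInner acc δ' vmax a S query).IsTrain := by
  unfold estimateInner
  refine isTrain_op_bind (by simp [Instr.IsTrain]) fun _ => ?_
  refine isTrain_op_bind (by simp [Instr.IsTrain]) fun _ => ?_
  refine isTrain_op_bind (by simp [Instr.IsTrain]) fun _ => ?_
  split_ifs
  · trivial
  · refine isTrain_op_bind (by simp [Instr.IsTrain]) fun _ => ?_
    refine isTrain_op_bind (by simp [Instr.IsTrain]) fun _ => ?_
    refine isTrain_op_bind (by simp [Instr.IsTrain]) fun _ => ?_
    refine isTrain_op_bind (by simp [Instr.IsTrain]) fun _ => ?_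
    exact (isTrain_sortedRuns (isTrain_meanOf (isTrain_sampleZ a S _ hq) _) _).bind fun _ =>
      isTrain_entryAt _ _

theorem isTrain_prepareSampler {m : ℕ} (a : Fin m → ℝ) :
    (prepareSampler (m₁ := m₁) (m₂ := m₂) a).IsTrain := by
  refine isTrain_forLoop fun _ _ => ?_
  refine isTrain_op_bind (by simp [Instr.IsTrain]) fun _ => ?_
  refine isTrain_op_bind (by simp [Instr.IsTrain]) fun _ => ?_
  refine isTrain_op_bind (by simp [Instr.IsTrain]) fun _ => ?_
  refine isTrain_op_bind (by simp [Instr.IsTrain]) fun _ => ?_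
  exact isTrain_op (by simp [Instr.IsTrain])

/-! ### Filling an array -/

theorem isTrain_fillArray {k : ℕ} {f : Fin k → Prog m₁ m₂ ℝ} (h : ∀ i, (f i).IsTrain) :
    (fillArray k f).IsTrain :=
  isTrain_forLoop fun i _ => (h i).bind fun _ => isTrain_op (by simp [Instr.IsTrain])

theorem costs_fillArray {k c : ℕ} {f : Fin k → Prog m₁ m₂ ℝ} {R : Fin k → ℝ → Prop}
    (h : ∀ i, (f i).Costs I c (R i)) :
    (fillArray k f).Costs I (k * (c + 2)) fun a => ∀ i, R i (a i) := by
  refine (costs_forLoop_inv (c := c + 1) (fun n (a : Fin k → ℝ) => ∀ i : Fin k, i.val < n → R i (a i))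
    (fun i hi => absurd hi (Nat.not_lt_zero _)) fun i a ha => (h i).bind (d := 1) fun x hx =>
      costs_det _ rfl fun j hj => ?_).mono le_rfl fun a ha i => ha i i.2
  by_cases hji : j = i
  · subst hji
    rwa [Function.update_self]
  · rw [Function.update_of_ne hji]
    have : j.val ≠ i.val := fun h' => hji (Fin.ext h')
    exact ha j (by omega)

theorem fail_fillArray_le {k : ℕ} {c : ℝ≥0∞} {f : Fin k → Prog m₁ m₂ ℝ} {R : Fin k → ℝ → Prop}
    (h : ∀ i, (f i).fail I (R i) ≤ c) :
    (fillArray k f).fail I (fun a => ∀ i, R i (a i)) ≤ k * c := by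
  refine (Prog.fail_mono fun (a : Fin k → ℝ) (ha : ∀ i : Fin k, i.val < k → R i (a i)) i => ha i i.2).trans
    (fail_forLoop_inv (fun n (a : Fin k → ℝ) => ∀ i : Fin k, i.val < n → R i (a i))
      (fun i hi => absurd hi (Nat.not_lt_zero _)) fun i a ha => ?_)
  rw [← add_zero c]
  refine Prog.fail_bind_le (h i) fun x hx => ?_
  refine (Prog.fail_le_of_sat (Prog.Sat.mono (costs_det _ rfl fun j hj => ?_) fun _ _ h => h.2)).le
  by_cases hji : j = i
  · subst hji
    rwa [Function.update_self]
  · rw [Function.update_of_ne hji]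
    have : j.val ≠ i.val := fun h' => hji (Fin.ext h')
    exact ha j (by omega)

end Estimation

/-! ### The iterations and the selection of the output -/

section Iterations

variable {m₁ m₂ : ℕ} {I : Input m₁ m₂}

/-- The update from `α` to `α'` and the estimates `s` rest on estimates with accuracy `epsI`. -/
def IsAccurateStep (I : Input m₁ m₂) (P : Params) (α α' : Fin m₁ → ℝ) (s : Fin m₂ → ℝ) : Prop :=
  (∀ j, ∃ r, |r - ∑ i, α i * I.K j i| ≤ P.epsI ∧ α' j = α j + P.rate / m₁ * (I.y j - I.u r)) ∧
    ∀ j, |s j - ∑ i, α i * I.Kval j i| ≤ P.epsI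

/-- A history of `k` iterations starting from `α` all of which rest on accurate estimates. -/
def IsAccurateHistory (I : Input m₁ m₂) (P : Params) (k : ℕ) (α : Fin m₁ → ℝ)
    (l : List ((Fin m₁ → ℝ) × (Fin m₂ → ℝ))) : Prop :=
  ∃ (A : ℕ → Fin m₁ → ℝ) (s : ℕ → Fin m₂ → ℝ), A 0 = α ∧
    l = (List.range k).map (fun t => (A t, s t)) ∧
    ∀ t < k, IsAccurateStep I P (A t) (A (t + 1)) (s t)

theorem IsAccurateHistory.cons {P : Params} {k : ℕ} {α α' : Fin m₁ → ℝ} {s : Fin m₂ → ℝ}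
    {l : List ((Fin m₁ → ℝ) × (Fin m₂ → ℝ))} (h : IsAccurateStep I P α α' s)
    (hl : IsAccurateHistory I P k α' l) : IsAccurateHistory I P (k + 1) α ((α, s) :: l) := by
  obtain ⟨A, S, hA, rfl, hstep⟩ := hl
  refine ⟨fun t => Nat.casesOn t α A, fun t => Nat.casesOn t s S, rfl, ?_, ?_⟩
  · rw [List.range_succ_eq_map, List.map_cons, List.map_map]
    rfl
  · intro t ht
    cases t with
    | zero => simpa [hA] using h
    | succ t => exact hstep t (by omega)

theorem costs_fillArray_zero (k : ℕ) :
    (fillArray k fun _ => (pure 0 : Prog m₁ m₂ ℝ)).Costs I (k * 2) fun a => a = fun _ => 0 :=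
  (costs_fillArray (c := 0) (R := fun _ x => x = 0) fun _ =>
    Prog.costs_pure (m₁ := m₁) (m₂ := m₂) (I := I) rfl 0).mono le_rfl fun _ h => funext h

/-! ### The selection -/

/-- The value of the estimated validation error. -/
def valError (I : Input m₁ m₂) (s : Fin m₂ → ℝ) : ℝ := (∑ j, (I.u (s j) - I.b j) ^ 2) / m₂

theorem costs_validationError (s : Fin m₂ → ℝ) :
    (validationError (m₁ := m₁) s).Costs I (m₂ * 7 + 1) fun x => x = valError I s := by
  refine (costs_forLoop_inv (fun n x => x = ∑ j with j.val < n, (I.u (s j) - I.b j) ^ 2)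
    (by simp) fun i x hx => ?_).bind fun x hx => costs_det _ rfl ?_
  · refine costs_det_bind _ rfl (costs_det_bind _ rfl (costs_det_bind _ rfl (costs_det_bind _ rfl
      (costs_det_bind _ rfl (costs_det _ rfl ?_)))))
    have : Finset.univ.filter (fun j : Fin m₂ => j.val < i + 1)
        = insert i (Finset.univ.filter fun j : Fin m₂ => j.val < i) := by
      ext j
      simp only [Finset.mem_filter, Finset.mem_univ, true_and, Finset.mem_insert, Fin.ext_iff]
      omega
    rw [this, Finset.sum_insert (by simp), hx]
    ring
  · simp only [hx, valError, Fin.is_lt, Finset.filter_true]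

/-- `r` is the `α` of a pair in the list with the least estimated validation error. -/
def IsBest (I : Input m₁ m₂) (l : List ((Fin m₁ → ℝ) × (Fin m₂ → ℝ))) (r : Fin m₁ → ℝ) : Prop :=
  ∃ p ∈ l, r = p.1 ∧ ∀ p' ∈ l, valError I p.2 ≤ valError I p'.2

theorem costs_selectBest (l : List ((Fin m₁ → ℝ) × (Fin m₂ → ℝ))) :
    ∀ (best : Fin m₁ → ℝ) (s₀ : Fin m₂ → ℝ),
    (selectBest best (valError I s₀) l).Costs I (l.length * (m₂ * 7 + 3))
      (IsBest I ((best, s₀) :: l)) := by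
  induction l with
  | nil =>
    intro best s₀
    exact Prog.costs_pure ⟨(best, s₀), by simp, rfl, by simp⟩ _
  | cons q l ih =>
    obtain ⟨α, s⟩ := q
    intro best s₀
    rw [selectBest]
    refine Prog.Costs.weaken (costs_det_bind _ rfl ((costs_validationError s).bind
      (d := l.length * (m₂ * 7 + 3) + 1) fun e he => costs_det_bind _ rfl ?_)) (le_of_eq ?_)
    · subst he
      by_cases h : valError I s₀ ≤ valError I s
      · simp only [h, decide_true, if_true]
        refine (ih best s₀).mono le_rfl fun r ⟨p, hp, hr, hmin⟩ => ⟨p, ?_, hr, ?_⟩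
        · rcases List.mem_cons.1 hp with rfl | hp <;> simp [*]
        · intro p' hp'
          rcases List.mem_cons.1 hp' with rfl | hp'
          · exact hmin _ (by simp)
          rcases List.mem_cons.1 hp' with rfl | hp'
          · exact (hmin (best, s₀) (by simp)).trans h
          · exact hmin p' (by simp [hp'])
      · simp only [h, decide_false, Bool.false_eq_true, if_false]
        refine (ih α s).mono le_rfl fun r ⟨p, hp, hr, hmin⟩ => ⟨p, ?_, hr, ?_⟩
        · exact List.mem_cons_of_mem _ hp
        · intro p' hp'
          rcases List.mem_cons.1 hp' with rfl | hp'
          · exact (hmin (α, s) (by simp)).trans (not_le.1 h).le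
          · exact hmin p' hp'
    · rw [List.length_cons]; ring

variable [NeZero m₁]

/-- The part of an iteration that computes `α^{t+1}`. -/
def trainStep (P : Params) (α : Fin m₁ → ℝ) : Prog m₁ m₂ (Fin m₁ → ℝ) := do
  let S ← prepareSampler α
  fillArray m₁ fun j => do
    let r ← estimateInner P.epsI (P.delta / (2 * P.T * m₁)) P.Kmax α S fun i => op (.queryK j i)
    let g ← op (.evalU r)
    let y ← op (.readY j)
    let e ← op (.sub y g)
    let c ← op (.mul (P.rate / m₁) e)
    let x ← op (.load α j)
    op (.add x c)

/-- The sequence of the `α^t`, computed without the validation set. -/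
def trainIterations (P : Params) : ℕ → (Fin m₁ → ℝ) → Prog m₁ m₂ (List (Fin m₁ → ℝ))
  | 0, _ => pure []
  | k + 1, α => do
    op .tick
    let next ← trainStep P α
    let rest ← trainIterations P k next
    pure (α :: rest)

theorem isTrain_trainStep (P : Params) (α : Fin m₁ → ℝ) :
    (trainStep (m₂ := m₂) P α).IsTrain := by
  refine (isTrain_prepareSampler α).bind fun S => isTrain_fillArray fun j => ?_
  refine (isTrain_estimateInner _ _ _ _ _ fun i => isTrain_op (by simp [Instr.IsTrain])).bind
    fun r => ?_
  refine isTrain_op_bind (by simp [Instr.IsTrain]) fun _ => ?_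
  refine isTrain_op_bind (by simp [Instr.IsTrain]) fun _ => ?_
  refine isTrain_op_bind (by simp [Instr.IsTrain]) fun _ => ?_
  refine isTrain_op_bind (by simp [Instr.IsTrain]) fun _ => ?_
  refine isTrain_op_bind (by simp [Instr.IsTrain]) fun _ => ?_
  exact isTrain_op (by simp [Instr.IsTrain])

theorem isTrain_trainIterations (P : Params) (k : ℕ) (α : Fin m₁ → ℝ) :
    (trainIterations (m₂ := m₂) P k α).IsTrain := by
  induction k generalizing α with
  | zero => trivial
  | succ k ih =>
    exact isTrain_op_bind (by simp [Instr.IsTrain]) fun _ => (isTrain_trainStep P α).bind fun α' =>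
      (ih α').bind fun _ => trivial

/-- The validation estimates never feed back into the `α^t`, so they can be dropped without changing
the law of the iterates. What remains is a program that does not access the validation set. -/
theorem ev_iterations_fst (P : Params) (k : ℕ) (α : Fin m₁ → ℝ)
    (F : List (Fin m₁ → ℝ) → ℝ≥0∞) :
    (iterations P k α).ev I (fun l : List ((Fin m₁ → ℝ) × (Fin m₂ → ℝ)) => F (l.map Prod.fst))
      = (trainIterations (m₂ := m₂) P k α).ev I F := by
  induction k generalizing α F with
  | zero => rfl
  | succ k ih =>
    simp only [iterations, trainIterations, trainStep, iteration, Prog.ev_bind,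
      Prog.ev_pure, List.map_cons, Prog.ev_const]
    have ih' := fun α' => ih α' fun l => F (α :: l)
    simp only [ih']

theorem costs_trainIterations_length (P : Params) (k : ℕ) (α : Fin m₁ → ℝ) :
    (trainIterations (m₂ := m₂) P k α).Sat I fun l _ => l.length = k := by
  induction k generalizing α with
  | zero => exact List.length_nil
  | succ k ih =>
    refine Prog.Sat.bind (Prog.sat_of_forall fun _ _ => Prog.Sat.bind (Prog.sat_of_forall
      fun α' _ => Prog.Sat.bind ((ih α').mono fun l _ hl => ?_)))
    change (α :: l).length = k + 1
    rw [List.length_cons, hl]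

/-- Each entry of an array of length `m` fails with probability at most `δ/(2Tm)`, hence each of the
two arrays with probability at most `δ/(2T)`. -/
theorem fail_iteration_le {P : Params} (hT : 0 < P.T) (heps : 0 < P.epsI) (hδ : 0 < P.delta)
    (hδ1 : P.delta < 1) (hK : ∀ j i, |I.K j i| ≤ P.Kmax) (hK' : ∀ j i, |I.Kval j i| ≤ P.Kmax)
    (α : Fin m₁ → ℝ) :
    (iteration P α).fail I (fun p : (Fin m₁ → ℝ) × (Fin m₂ → ℝ) =>
      IsAccurateStep I P α p.1 p.2) ≤ ENNReal.ofReal (P.delta / P.T) := by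
  have hTr : (1 : ℝ) ≤ P.T := by exact_mod_cast hT
  have hsmall : ∀ m : ℕ, 0 < m → 0 < P.delta / (2 * P.T * m) ∧ P.delta / (2 * P.T * m) < 1 := by
    intro m hm
    have hmr : (1 : ℝ) ≤ m := by exact_mod_cast hm
    have h1 : (1 : ℝ) ≤ 2 * P.T * m := by nlinarith
    exact ⟨by positivity, (div_le_self hδ.le h1).trans_lt hδ1⟩
  have hm₁ : 0 < m₁ := Nat.pos_of_ne_zero (NeZero.ne m₁)
  have hmul : ∀ m : ℕ, (m : ℝ≥0∞) * ENNReal.ofReal (P.delta / (2 * P.T * m))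
      ≤ ENNReal.ofReal (P.delta / (2 * P.T)) := by
    intro m
    rcases Nat.eq_zero_or_pos m with rfl | hm
    · simp
    · have hmr : (0 : ℝ) < m := by exact_mod_cast hm
      rw [← ENNReal.ofReal_natCast, ← ENNReal.ofReal_mul hmr.le]
      refine ENNReal.ofReal_le_ofReal (le_of_eq ?_)
      field_simp
  have htotal : ENNReal.ofReal (P.delta / P.T)
      = 0 + (ENNReal.ofReal (P.delta / (2 * P.T)) + (ENNReal.ofReal (P.delta / (2 * P.T)) + 0)) := by
    rw [zero_add, add_zero, ← ENNReal.ofReal_add (by positivity) (by positivity)]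
    congr 1
    field_simp
    norm_num
  have hop : ∀ {β : Type} (i : Instr m₁ m₂ β), (op i).Costs I 1 fun _ => True := fun i =>
    costs_op fun _ _ => trivial
  rw [htotal]
  unfold iteration
  refine Prog.fail_bind_le (Q := fun S => S = fun k : Fin (m₁ + 1) => partialSum α k)
    (Prog.fail_le_of_sat (Prog.Sat.mono (costs_prepareSampler α) fun _ _ h => h.2)).le
    fun S hS => ?_
  subst hS
  refine Prog.fail_bind_le (Q := fun α' : Fin m₁ → ℝ => ∀ j, ∃ r,
    |r - ∑ i, α i * I.K j i| ≤ P.epsI ∧ α' j = α j + P.rate / m₁ * (I.y j - I.u r))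
    ((fail_fillArray_le (R := fun j x => ∃ r,
      |r - ∑ i, α i * I.K j i| ≤ P.epsI ∧ x = α j + P.rate / m₁ * (I.y j - I.u r))
      fun j => ?_).trans (hmul m₁)) fun α' hα' => ?_
  · rw [← add_zero (ENNReal.ofReal _)]
    refine Prog.fail_bind_le (fail_estimateInner_le heps (hsmall m₁ hm₁).1 (hsmall m₁ hm₁).2 α
      (fun i => I.K j i) (fun i => hK j i) (fun i g => ev_queryK I j i g) fun i => hop _)
      fun r hr => ?_
    simp only [Prog.fail, Prog.ev_bind, ev_evalU, ev_readY, ev_sub, ev_mul, ev_load, ev_add]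
    rw [Set.indicator_of_notMem]
    exact not_not.2 ⟨r, hr, rfl⟩
  · refine Prog.fail_bind_le (Q := fun s : Fin m₂ → ℝ => ∀ j,
      |s j - ∑ i, α i * I.Kval j i| ≤ P.epsI)
      ((fail_fillArray_le (R := fun j x => |x - ∑ i, α i * I.Kval j i| ≤ P.epsI)
        fun j => ?_).trans (hmul m₂)) fun s hs => (Prog.fail_pure ⟨hα', hs⟩).le
    exact fail_estimateInner_le heps (hsmall m₂ j.pos).1 (hsmall m₂ j.pos).2 α
      (fun i => I.Kval j i) (fun i => hK' j i) (fun i g => ev_queryKval I j i g) fun i => hop _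

theorem fail_iterations_le {P : Params} (hT : 0 < P.T) (heps : 0 < P.epsI) (hδ : 0 < P.delta)
    (hδ1 : P.delta < 1) (hK : ∀ j i, |I.K j i| ≤ P.Kmax) (hK' : ∀ j i, |I.Kval j i| ≤ P.Kmax)
    (k : ℕ) (α : Fin m₁ → ℝ) :
    (iterations P k α).fail I (IsAccurateHistory I P k α)
      ≤ k * ENNReal.ofReal (P.delta / P.T) := by
  induction k generalizing α with
  | zero => exact (Prog.fail_pure ⟨fun _ => α, fun _ _ => 0, rfl, rfl, by simp⟩).le.trans zero_le
  | succ k ih =>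
    have h : (k + 1 : ℕ) * ENNReal.ofReal (P.delta / P.T)
        = 0 + (ENNReal.ofReal (P.delta / P.T) + (k * ENNReal.ofReal (P.delta / P.T) + 0)) := by
      push_cast; ring
    rw [h]
    refine Prog.fail_bind_le (Q := fun _ => True) (Prog.fail_le_of_sat
      (Prog.sat_of_forall fun _ _ => trivial)).le fun _ _ => ?_
    refine Prog.fail_bind_le (fail_iteration_le hT heps hδ hδ1 hK hK' α) fun p hp => ?_
    exact Prog.fail_bind_le (ih p.1) fun l hl => (Prog.fail_pure (IsAccurateHistory.cons hp hl)).le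

/-- Initialisation and selection are deterministic, so all randomness lies in the iterations. -/
theorem fail_alphatronSampling_le {P : Params} {Q : (Fin m₁ → ℝ) → Prop}
    {R : List ((Fin m₁ → ℝ) × (Fin m₂ → ℝ)) → Prop}
    (h : ∀ l, R l → l ≠ [] ∧ ∀ r, IsBest I l r → Q r) :
    (alphatronSampling m₁ m₂ P).fail I Q
      ≤ (iterations P P.T (fun _ : Fin m₁ => 0)).fail I R := by
  unfold alphatronSampling
  rw [← zero_add ((iterations P P.T (fun _ : Fin m₁ => 0)).fail I R)]
  refine Prog.fail_bind_le (Q := fun a => a = fun _ => 0) (Prog.fail_le_of_sat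
    (Prog.Sat.mono (costs_fillArray_zero m₁) fun _ _ h => h.2)).le fun α₀ hα₀ => ?_
  subst hα₀
  rw [← add_zero ((iterations P P.T (fun _ : Fin m₁ => 0)).fail I R)]
  refine Prog.fail_bind_le le_rfl fun l hl => ?_
  obtain ⟨hne, hbest⟩ := h l hl
  cases l with
  | nil => exact absurd rfl hne
  | cons q l =>
    refine (Prog.fail_le_of_sat (Prog.Sat.mono (Prog.Costs.bind (d := l.length * (m₂ * 7 + 3))
      (costs_validationError q.2) fun e he => ?_) fun r _ hr => hbest r hr.2)).le
    subst he
    exact costs_selectBest l q.1 q.2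

/-! ### The number of steps -/

theorem costs_iteration {P : Params} {c₁ c₂ : ℕ} (α : Fin m₁ → ℝ)
    (h₁ : ∀ j, (estimateInner P.epsI (P.delta / (2 * P.T * m₁)) P.Kmax α
      (fun k => partialSum α k) fun i => op (m₂ := m₂) (.queryK j i)).Costs I c₁ fun _ => True)
    (h₂ : ∀ j, (estimateInner P.epsI (P.delta / (2 * P.T * m₂)) P.Kmax α
      (fun k => partialSum α k) fun i => op (.queryKval j i)).Costs I c₂ fun _ => True) :
    (iteration P α).Costs I (m₁ * 6 + (m₁ * (c₁ + 8) + m₂ * (c₂ + 2)))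
      fun p : (Fin m₁ → ℝ) × (Fin m₂ → ℝ) =>
        ∀ j, ∃ r, p.1 j = α j + P.rate / m₁ * (I.y j - I.u r) := by
  refine (costs_prepareSampler α).bind fun S hS => ?_
  subst hS
  refine (costs_fillArray (R := fun j x => ∃ r, x = α j + P.rate / m₁ * (I.y j - I.u r))
    (c := c₁ + 6) fun j => (h₁ j).bind fun r _ => ?_).bind fun α' hα' =>
      Prog.Costs.weaken ((costs_fillArray (R := fun _ _ => True) fun j => h₂ j).bind (d := 0)
        fun s _ => Prog.costs_pure hα' _) le_rfl
  exact costs_det_bind _ rfl (costs_det_bind _ rfl (costs_det_bind _ rfl (costs_det_bind _ rfl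
    (costs_det_bind _ rfl (costs_det _ rfl ⟨r, rfl⟩)))))

/-- An update changes each coordinate by at most `ρ / m₁`, whatever the estimate `r` was, because
labels and values of `u` lie in `[0,1]`. So `‖α^t‖₁ ≤ t ρ` on every execution, also after inaccurate
estimates, and the time bound is worst-case. -/
theorem costs_iterations {P : Params} {ρ : ℝ} (hrate : |P.rate| ≤ ρ)
    (hy : ∀ j, I.y j ∈ Set.Icc (0 : ℝ) 1) (hu : ∀ t, I.u t ∈ Set.Icc (0 : ℝ) 1) {c₁ c₂ M : ℕ}
    (h₁ : ∀ α : Fin m₁ → ℝ, ∑ i, |α i| ≤ M * ρ →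
      ∀ j, (estimateInner P.epsI (P.delta / (2 * P.T * m₁)) P.Kmax α
      (fun k => partialSum α k) fun i => op (m₂ := m₂) (.queryK j i)).Costs I c₁ fun _ => True)
    (h₂ : ∀ α : Fin m₁ → ℝ, ∑ i, |α i| ≤ M * ρ →
      ∀ j, (estimateInner P.epsI (P.delta / (2 * P.T * m₂)) P.Kmax α
      (fun k => partialSum α k) fun i => op (.queryKval j i)).Costs I c₂ fun _ => True)
    (k : ℕ) : ∀ (t : ℕ) (α : Fin m₁ → ℝ), t + k ≤ M → ∑ i, |α i| ≤ t * ρ →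
    (iterations P k α).Costs I (k * (m₁ * 6 + (m₁ * (c₁ + 8) + m₂ * (c₂ + 2)) + 1))
      fun l : List ((Fin m₁ → ℝ) × (Fin m₂ → ℝ)) => l.length = k := by
  have hρ : 0 ≤ ρ := (abs_nonneg _).trans hrate
  induction k with
  | zero => exact fun t α _ _ => Prog.costs_pure (m₁ := m₁) (m₂ := m₂) (I := I) List.length_nil _
  | succ k ih =>
    intro t α htk hα
    have hαM : ∑ i, |α i| ≤ M * ρ := hα.trans
      (mul_le_mul_of_nonneg_right (by exact_mod_cast (by omega : t ≤ M)) hρ)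
    refine Prog.Costs.weaken (costs_det_bind _ rfl ((costs_iteration α (h₁ α hαM) (h₂ α hαM)).bind
      fun p hp => (ih (t + 1) p.1 (by omega) ?_).bind (d := 0) fun l hl =>
        Prog.costs_pure (by simp [hl]) _)) (le_of_eq (by ring))
    calc ∑ i, |p.1 i| ≤ ∑ i, (|α i| + ρ / m₁) := by
          refine Finset.sum_le_sum fun j _ => ?_
          obtain ⟨r, hr⟩ := hp j
          rw [hr]
          refine (abs_add_le _ _).trans (add_le_add_right ?_ _)
          rw [abs_mul, abs_div, Nat.abs_cast]
          have h1 : |I.y j - I.u r| ≤ 1 := by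
            rw [abs_le]
            constructor <;> linarith [(hy j).1, (hy j).2, (hu r).1, (hu r).2]
          calc |P.rate| / m₁ * |I.y j - I.u r| ≤ |P.rate| / m₁ * 1 :=
                mul_le_mul_of_nonneg_left h1 (by positivity)
            _ ≤ ρ / m₁ := by rw [mul_one]; gcongr
      _ = ∑ i, |α i| + ρ := by
          rw [Finset.sum_add_distrib, Finset.sum_const, Finset.card_univ, Fintype.card_fin,
            nsmul_eq_mul]
          have : (m₁ : ℝ) ≠ 0 := Nat.cast_ne_zero.2 (NeZero.ne m₁)
          field_simp
      _ ≤ (t + 1 : ℕ) * ρ := by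
          push_cast
          linarith

theorem costs_alphatronSampling {P : Params} {ρ : ℝ} (hrate : |P.rate| ≤ ρ)
    (hy : ∀ j, I.y j ∈ Set.Icc (0 : ℝ) 1) (hu : ∀ t, I.u t ∈ Set.Icc (0 : ℝ) 1) {c₁ c₂ : ℕ}
    (h₁ : ∀ α : Fin m₁ → ℝ, ∑ i, |α i| ≤ P.T * ρ →
      ∀ j, (estimateInner P.epsI (P.delta / (2 * P.T * m₁)) P.Kmax α
      (fun k => partialSum α k) fun i => op (m₂ := m₂) (.queryK j i)).Costs I c₁ fun _ => True)
    (h₂ : ∀ α : Fin m₁ → ℝ, ∑ i, |α i| ≤ P.T * ρ →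
      ∀ j, (estimateInner P.epsI (P.delta / (2 * P.T * m₂)) P.Kmax α
      (fun k => partialSum α k) fun i => op (.queryKval j i)).Costs I c₂ fun _ => True) :
    (alphatronSampling m₁ m₂ P).Costs I (m₁ * 2
      + (P.T * (m₁ * 6 + (m₁ * (c₁ + 8) + m₂ * (c₂ + 2)) + 1) + P.T * (m₂ * 7 + 3)))
      fun _ => True := by
  unfold alphatronSampling
  refine (costs_fillArray_zero m₁).bind fun α₀ hα₀ => (costs_iterations hrate hy hu h₁ h₂ P.T 0 α₀
      (by omega) (by simp [hα₀])).bind fun l hl => ?_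
  cases l with
  | nil => exact Prog.costs_pure trivial _
  | cons q l =>
    refine (Prog.Costs.bind (d := l.length * (m₂ * 7 + 3)) (costs_validationError q.2)
      fun e he => ?_).weaken ?_
    · subst he
      exact (costs_selectBest l q.1 q.2).mono le_rfl fun _ _ => trivial
    · rw [← hl, List.length_cons, Nat.add_mul]
      omega

end Iterations

/-! ### The time bound -/

section Time

theorem exists_pow_two_ge {x : ℕ} (hx : 1 ≤ x) : ∃ e : ℕ, x ≤ 2 ^ e ∧ (e : ℝ) ≤ 2 * Real.log x + 1 := by
  refine ⟨Nat.clog 2 x, Nat.le_pow_clog (by norm_num) x, ?_⟩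
  have hlog : 0 ≤ Real.log x := Real.log_nonneg (by exact_mod_cast hx)
  rcases Nat.eq_zero_or_pos (Nat.clog 2 x) with h | h
  · rw [h, Nat.cast_zero]
    positivity
  · have h1 : 2 ^ (Nat.clog 2 x - 1) < x :=
      (Nat.lt_clog_iff_pow_lt (by norm_num)).1 (by omega)
    have h2 : ((Nat.clog 2 x - 1 : ℕ) : ℝ) * Real.log 2 ≤ Real.log x := by
      rw [← Real.log_pow]
      refine Real.log_le_log (by positivity) ?_
      exact_mod_cast h1.le
    have h3 : ((Nat.clog 2 x - 1 : ℕ) : ℝ) = Nat.clog 2 x - 1 := by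
      rw [Nat.cast_sub h, Nat.cast_one]
    rw [h3] at h2
    have h4 : (0 : ℝ) ≤ (Nat.clog 2 x : ℝ) - 1 := by
      rw [← h3]; positivity
    nlinarith [Real.log_two_gt_d9]

theorem numSamples_le (acc vmax norm : ℝ) : (numSamples acc vmax norm : ℝ)
    ≤ 9 / 2 * (norm * vmax / acc * (norm * vmax / acc)) + 1 := by
  unfold numSamples
  exact (Nat.ceil_lt_add_one (mul_nonneg (by norm_num) (mul_self_nonneg _))).le

/-- The time of an inner product estimation. -/
theorem costs_estimateInner_of_norm_le {m₁ m₂ : ℕ} [NeZero m₁] {I : Input m₁ m₂} {T m₃ : ℕ}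
    {L δ δ₀ εI Kmax : ℝ} (hδ₀ : δ₀ < 1) (hδ : 0 < δ) (hδδ : δ ≤ δ₀) (hL : 0 < L) (hε : 0 < εI)
    (hT : 1 ≤ T) (hm₂ : Real.log (T / δ) ≤ m₂) (hm₃ : 1 ≤ m₃) (hm₃' : m₃ ≤ m₁ + m₂)
    {α : Fin m₁ → ℝ} (hα : ∑ i, |α i| ≤ T * (1 / L)) {query : Fin m₁ → Prog m₁ m₂ ℝ}
    (hq : ∀ i, (query i).Costs I 1 fun _ => True) :
    (estimateInner εI (δ / (2 * T * m₃)) Kmax α (fun k => partialSum α k) query).Costs I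
      (⌊232 * (6 + 13 / Real.log (1 / δ₀)) * Real.log (2 + T * (m₁ + m₂)) ^ 2 * Real.log (1 / δ) *
        (T * Kmax / (L * εI)) ^ 2⌋₊ + 2 + 7) fun _ => True := by
  have hm₁ : 1 ≤ m₁ := Nat.pos_of_ne_zero (NeZero.ne m₁)
  have hm₁r : (1 : ℝ) ≤ m₁ := by exact_mod_cast hm₁
  have hm₂r : (0 : ℝ) ≤ m₂ := Nat.cast_nonneg _
  have hm₃r : (1 : ℝ) ≤ m₃ := by exact_mod_cast hm₃
  have hm₃r' : (m₃ : ℝ) ≤ m₁ + m₂ := by exact_mod_cast hm₃'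
  have hTr : (1 : ℝ) ≤ T := by exact_mod_cast hT
  have hδ1 : δ < 1 := hδδ.trans_lt hδ₀
  set m : ℝ := m₁ + m₂ with hm
  have hm1 : 1 ≤ m := by rw [hm]; linarith
  have hTm : m ≤ T * m := le_mul_of_one_le_left (by linarith) hTr
  have hTm₃ : 1 ≤ (T : ℝ) * m₃ := one_le_mul_of_one_le_of_one_le hTr hm₃r
  have hlog0 : 0 ≤ Real.log (2 * T * m₃) := Real.log_nonneg (by linarith)
  set Λ := Real.log (2 + T * m) with hΛ
  have hΛ1 : 1 ≤ Λ := by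
    rw [hΛ, Real.le_log_iff_exp_le (by positivity)]
    linarith [Real.exp_one_lt_d9]
  have hℓ₀ : 0 < Real.log (1 / δ₀) :=
    Real.log_pos (by rw [one_div]; exact (one_lt_inv₀ (hδ.trans_le hδδ)).2 hδ₀)
  set ℓ₀ := Real.log (1 / δ₀) with hℓ₀def
  have hℓ : ℓ₀ ≤ Real.log (1 / δ) := by
    refine Real.log_le_log (by have := hδ.trans_le hδδ; positivity) ?_
    exact one_div_le_one_div_of_le hδ hδδ
  set ℓ := Real.log (1 / δ) with hℓdef
  have hlogm : Real.log m ≤ Λ := Real.log_le_log (by linarith) (by linarith)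
  have hlog2Tm : Real.log (2 * T * m₃) ≤ 2 * Λ := by
    rw [hΛ, show (2 : ℝ) * Real.log (2 + T * m) = Real.log ((2 + T * m) ^ 2) by
      rw [Real.log_pow]; norm_num]
    refine Real.log_le_log (by positivity) ?_
    have : (T : ℝ) * m₃ ≤ T * m := mul_le_mul_of_nonneg_left hm₃r' (by linarith)
    have h2 : (2 + T * m) ^ 2 = 4 + 4 * (T * m) + (T * m) ^ 2 := by ring
    rw [h2]
    linarith [sq_nonneg ((T : ℝ) * m)]
  set q := numReps (δ / (2 * T * m₃)) with hq_def
  have hlogd : Real.log (1 / (δ / (2 * T * m₃))) = ℓ + Real.log (2 * T * m₃) := by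
    rw [hℓdef, ← Real.log_mul (by positivity) (by positivity)]
    congr 1
    field_simp
  have hpos : 0 ≤ 6 * Real.log (1 / (δ / (2 * T * m₃))) := by
    rw [hlogd]
    linarith
  have hq1 : (q : ℝ) ≤ 6 * (ℓ + Real.log (2 * T * m₃)) + 1 := by
    rw [← hlogd]
    exact (Nat.ceil_lt_add_one hpos).le
  have hq0 : 1 ≤ q := by
    refine Nat.ceil_pos.2 ?_
    rw [hlogd]
    linarith
  set κ := 6 + 13 / ℓ₀ with hκ
  -- The only use of `δ₀`: since `log(1/δ) ≥ log(1/δ₀) > 0`, terms without the factor `log(1/δ)` can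
  -- be charged to it.
  have hqκ : (q : ℝ) ≤ κ * Λ * ℓ := by
    have h1 : 13 * Λ ≤ 13 / ℓ₀ * Λ * ℓ := by
      rw [div_mul_eq_mul_div, div_mul_eq_mul_div, le_div_iff₀ hℓ₀]
      exact mul_le_mul_of_nonneg_left hℓ (by linarith)
    have h2 : ℓ ≤ Λ * ℓ := le_mul_of_one_le_left (by linarith) hΛ1
    have : κ * Λ * ℓ = 6 * Λ * ℓ + 13 / ℓ₀ * Λ * ℓ := by rw [hκ]; ring
    linarith
  have hκ0 : 0 ≤ κ * Λ * ℓ := (Nat.cast_nonneg q).trans hqκ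
  -- The sorting depth is logarithmic in `q`, and `q` grows with `log(1/δ)`. As `m₂ ≥ log(T/δ)`, `q`
  -- is nevertheless linear in `m`, so that depth is `O(Λ)`.
  have hq19 : (q : ℝ) ≤ 19 * m := by
    have h1 : ℓ + Real.log (2 * T * m₃) = Real.log (T / δ) + Real.log (2 * m₃) := by
      rw [hℓdef, ← Real.log_mul (by positivity) (by positivity),
        ← Real.log_mul (by positivity) (by positivity)]
      congr 1
      field_simp
    have h2 : Real.log (2 * m₃) ≤ 2 * m₃ - 1 := Real.log_le_sub_one_of_pos (by positivity)
    rw [h1] at hq1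
    linarith
  obtain ⟨e, he, hecast⟩ := exists_pow_two_ge hm₁
  obtain ⟨e', he', hecast'⟩ := exists_pow_two_ge hq0
  have he3 : (e : ℝ) ≤ 3 * Λ := by
    have : Real.log m₁ ≤ Real.log m := Real.log_le_log (by positivity) (by linarith)
    linarith
  have he9 : (e' : ℝ) ≤ 9 * Λ := by
    have h1 : Real.log q ≤ Real.log 19 + Real.log m := by
      rw [← Real.log_mul (by norm_num) (by positivity)]
      exact Real.log_le_log (by exact_mod_cast hq0) hq19
    have h2 : Real.log 19 ≤ 3 := by
      rw [Real.log_le_iff_le_exp (by norm_num)]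
      have h3 : Real.exp 3 = Real.exp 1 ^ 3 := by rw [← Real.exp_nat_mul]; norm_num
      rw [h3]
      have := Real.exp_one_gt_d9
      calc (19 : ℝ) ≤ 2.7 ^ 3 := by norm_num
        _ ≤ _ := pow_le_pow_left₀ (by norm_num) (by linarith) 3
    linarith
  refine costs_estimateInner _ _ _ _ _ hq he he' fun hbig => ?_
  have hlast : partialSum α (Fin.last m₁ : Fin (m₁ + 1)) = ∑ i, |α i| := partialSum_last α
  rw [hlast] at hbig ⊢
  set A := ∑ i, |α i| with hA
  have hA0 : 0 ≤ A := by rw [hA]; positivity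
  -- Sampling takes place only if `A * Kmax > εI`, which excludes `Kmax ≤ 0`.
  have hKpos : 0 < Kmax := by
    by_contra h
    linarith [mul_nonpos_of_nonneg_of_nonpos hA0 (not_lt.1 h)]
  set x := A * Kmax / εI with hx
  set X := T * Kmax / (L * εI) with hX
  have hx1 : 1 < x := (one_lt_div hε).2 hbig
  have hxX : x ≤ X := by
    have h1 : A * Kmax ≤ T * (1 / L) * Kmax := mul_le_mul_of_nonneg_right hα hKpos.le
    calc x ≤ T * (1 / L) * Kmax / εI := div_le_div_of_nonneg_right h1 hε.le
      _ = X := by rw [hX]; field_simp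
  have hX2 : 1 ≤ X ^ 2 := one_le_pow₀ (by linarith)
  have hN1 := numSamples_le εI Kmax A
  rw [← hx] at hN1
  generalize numSamples εI Kmax A = N at hN1 ⊢
  clear_value q x X κ Λ ℓ ℓ₀ m
  have hxx : x * x ≤ X ^ 2 := by
    rw [sq]
    exact mul_self_le_mul_self (by linarith) hxX
  have hN : (N : ℝ) ≤ 11 / 2 * X ^ 2 := by linarith
  have hsteps : q * (N * (8 * e + 8) + 1) + 1 + 6 * q * e' + (q + 1)
      = q * (N * (8 * e + 8) + 2 + 6 * e') + 2 := by ring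
  rw [← hq_def, hsteps]
  refine Nat.add_le_add_right (Nat.le_floor ?_) 2
  push_cast
  have hNe : (N : ℝ) * (8 * e + 8) ≤ 11 / 2 * X ^ 2 * (32 * Λ) :=
    mul_le_mul hN (by linarith) (by positivity) (by positivity)
  have hrest : (2 : ℝ) + 6 * e' ≤ 56 * Λ * X ^ 2 := by
    have : 56 * Λ * 1 ≤ 56 * Λ * X ^ 2 := mul_le_mul_of_nonneg_left hX2 (by linarith)
    linarith
  -- One factor `Λ` comes from the repetitions, the other from the depths of bisection and sorting;
  -- `232 = 11/2 * 32 + 56`.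
  calc (q : ℝ) * (N * (8 * e + 8) + 2 + 6 * e') ≤ (κ * Λ * ℓ) * (232 * Λ * X ^ 2) :=
        mul_le_mul hqκ (by linarith) (by positivity) hκ0
    _ = _ := by ring

theorem steps_le {n d m₁ m₂ T : ℕ} [NeZero m₁] {L δ δ₀ εI Kmax : ℝ} {u : ℝ → ℝ}
    (hu : ∀ t, u t ∈ Set.Icc (0 : ℝ) 1) (hδ₀ : δ₀ < 1) (hδ : 0 < δ) (hδδ : δ ≤ δ₀) (hL : 0 < L)
    (hε : 0 < εI) (hT : 1 ≤ T) (hm₂ : Real.log (T / δ) ≤ m₂) (S : Sample n m₁ × Sample n m₂)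
    {o : (Fin m₁ → ℝ) × ℕ} (ho : o ∈ (outcome d u
      { T := T, rate := 1 / L, epsI := εI, delta := δ, Kmax := Kmax } S).support) :
    (o.2 : ℝ) ≤ (232 * (6 + 13 / Real.log (1 / δ₀)) + 36) *
      timeExpr T (m₁ + m₂) L Kmax (εI ^ 2) δ * Real.log (2 + T * (m₁ + m₂)) ^ 2 := by
  have hm₁ : 1 ≤ m₁ := Nat.pos_of_ne_zero (NeZero.ne m₁)
  have hTr : (1 : ℝ) ≤ T := by exact_mod_cast hT
  have hℓ₀ : 0 < Real.log (1 / δ₀) :=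
    Real.log_pos (by rw [one_div]; exact (one_lt_inv₀ (hδ.trans_le hδδ)).2 hδ₀)
  have hℓ : 0 < Real.log (1 / δ) :=
    Real.log_pos (by rw [one_div]; exact (one_lt_inv₀ hδ).2 (hδδ.trans_lt hδ₀))
  have hop : ∀ {β : Type} (i : Instr m₁ m₂ β), (op i).Costs (inputOf d u S) 1 fun _ => True :=
    fun i => costs_op fun _ _ => trivial
  have key := costs_alphatronSampling (I := inputOf d u S)
    (P := { T := T, rate := 1 / L, epsI := εI, delta := δ, Kmax := Kmax }) (ρ := 1 / L)
    (abs_of_pos (by positivity)).le (fun j => (S.1 j).2.2) hu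
    (fun α hα j => costs_estimateInner_of_norm_le hδ₀ hδ hδδ hL hε hT hm₂ hm₁ (by omega) hα
      fun i => hop _)
    (fun α hα j => costs_estimateInner_of_norm_le hδ₀ hδ hδδ hL hε hT hm₂ j.pos (by omega) hα
      fun i => hop _)
  have ho2 := (Prog.sat_of_mem_support_run key ho).1
  set Λ := Real.log (2 + T * (m₁ + m₂)) with hΛ
  set κ := 6 + 13 / Real.log (1 / δ₀) with hκ
  have hκ0 : 0 ≤ κ := by positivity
  set Y := 232 * κ * Λ ^ 2 * Real.log (1 / δ) * (T * Kmax / (L * εI)) ^ 2 with hY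
  have hY0 : 0 ≤ Y := by positivity
  have hfloor : (⌊Y⌋₊ : ℝ) ≤ Y := Nat.floor_le hY0
  have hm₁r : (1 : ℝ) ≤ m₁ := by exact_mod_cast hm₁
  have hm₂r : (0 : ℝ) ≤ m₂ := Nat.cast_nonneg _
  have hm1 : (1 : ℝ) ≤ m₁ + m₂ := by linarith
  have hΛ1 : 1 ≤ Λ := by
    rw [hΛ, Real.le_log_iff_exp_le (by positivity)]
    nlinarith [Real.exp_one_lt_d9]
  have h1 : (o.2 : ℝ) ≤ m₁ * 2 + (T * (m₁ * 6 + (m₁ * (⌊Y⌋₊ + 2 + 7 + 8)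
      + m₂ * (⌊Y⌋₊ + 2 + 7 + 2)) + 1) + T * (m₂ * 7 + 3)) := by exact_mod_cast ho2
  have h2 : (o.2 : ℝ) ≤ T * (m₁ + m₂) * (Y + 36) := by
    have e1 : (m₁ : ℝ) * (⌊Y⌋₊ + 2 + 7 + 8) + m₂ * (⌊Y⌋₊ + 2 + 7 + 2)
        ≤ (m₁ + m₂) * (Y + 17) := by nlinarith
    have e2 : (m₁ : ℝ) * 6 + (m₁ * (⌊Y⌋₊ + 2 + 7 + 8) + m₂ * (⌊Y⌋₊ + 2 + 7 + 2)) + 1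
        + (m₂ * 7 + 3) + 2 * m₁ ≤ (m₁ + m₂) * (Y + 36) := by nlinarith
    have e3 : (m₁ : ℝ) * 2 ≤ T * (2 * m₁) := by nlinarith
    have e4 := mul_le_mul_of_nonneg_left e2 (by linarith : (0 : ℝ) ≤ T)
    linarith
  refine h2.trans ?_
  have hΛ2 : 1 ≤ Λ ^ 2 := one_le_pow₀ hΛ1
  have hYeq : T * (m₁ + m₂) * Y = 232 * κ * (T ^ 3 * (m₁ + m₂) * (Kmax ^ 2 / (L ^ 2 * εI ^ 2)) *
      Real.log (1 / δ)) * Λ ^ 2 := by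
    rw [hY]
    field_simp
  set Z := (T : ℝ) ^ 3 * (m₁ + m₂) * (Kmax ^ 2 / (L ^ 2 * εI ^ 2)) * Real.log (1 / δ) with hZ
  have hZ0 : 0 ≤ Z := by positivity
  have htime : timeExpr T (m₁ + m₂) L Kmax (εI ^ 2) δ = T * (m₁ + m₂) + Z := by
    rw [timeExpr, hZ]
    push_cast
    ring
  rw [htime, mul_add, hYeq]
  have hTm0 : (0 : ℝ) ≤ T * (m₁ + m₂) := by positivity
  have f1 : (T : ℝ) * (m₁ + m₂) * 36 ≤ 36 * (T * (m₁ + m₂)) * Λ ^ 2 := by nlinarith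
  have f2 : 0 ≤ 232 * κ * (T * (m₁ + m₂)) * Λ ^ 2 := by positivity
  have f3 : 0 ≤ 36 * Z * Λ ^ 2 := by positivity
  linarith

end Time

/-! ### Concentration inequalities for iid samples -/

section Concentration

variable {Ω : Type*} [MeasurableSpace Ω] {μ : Measure Ω} [IsProbabilityMeasure μ]

theorem lintegral_pi_succ (μ : Measure Ω) [IsProbabilityMeasure μ] {k : ℕ}
    {f : (Fin (k + 1) → Ω) → ℝ≥0∞} (hf : Measurable f) :
    ∫⁻ ω, f ω ∂(Measure.pi fun _ => μ)
      = ∫⁻ ω, ∫⁻ x, f (Fin.cons x ω) ∂μ ∂(Measure.pi fun _ : Fin k => μ) := by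
  have hmp := (measurePreserving_piFinSuccAbove (fun _ : Fin (k + 1) => μ) 0).symm
  rw [← hmp.map_eq, lintegral_map hf hmp.measurable]
  refine (lintegral_prod_symm' (fun p => f ((MeasurableEquiv.piFinSuccAbove
    (fun _ : Fin (k + 1) => Ω) 0).symm p)) (hf.comp hmp.measurable)).trans ?_
  simp only [MeasurableEquiv.piFinSuccAbove_symm_apply, Fin.insertNthEquiv_zero]
  rfl

theorem measurable_cons (k : ℕ) :
    Measurable fun p : Ω × (Fin k → Ω) => (Fin.cons p.1 p.2 : Fin (k + 1) → Ω) := by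
  refine measurable_pi_iff.2 fun i => ?_
  refine Fin.cases ?_ (fun j => ?_) i
  · simpa using measurable_fst
  · exact (measurable_pi_apply j).comp measurable_snd

theorem lintegral_pi_succ' (μ : Measure Ω) [IsProbabilityMeasure μ] {k : ℕ}
    {f : (Fin (k + 1) → Ω) → ℝ≥0∞} (hf : Measurable f) :
    ∫⁻ ω, f ω ∂(Measure.pi fun _ => μ)
      = ∫⁻ x, ∫⁻ ω, f (Fin.cons x ω) ∂(Measure.pi fun _ : Fin k => μ) ∂μ := by
  rw [lintegral_pi_succ μ hf]
  refine lintegral_lintegral_swap (Measurable.aemeasurable ?_)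
  exact hf.comp ((measurable_cons k).comp measurable_swap)

theorem integrable_of_abs_le {f : Ω → ℝ} (hf : Measurable f) {c : ℝ} (h : ∀ x, |f x| ≤ c) :
    Integrable f μ :=
  Integrable.of_bound hf.aestronglyMeasurable c (Filter.Eventually.of_forall h)

/-- An exponential Markov inequality. -/
theorem measure_lt_le_of_lintegral_exp_le {Ω' : Type*} [MeasurableSpace Ω'] {ν : Measure Ω'}
    {F : Ω' → ℝ≥0∞} {A : Set Ω'} {b c : ℝ} (hF : ∫⁻ ω, F ω ∂ν ≤ ENNReal.ofReal (Real.exp b))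
    (hFm : Measurable F) (hA : ∀ ω ∈ A, ENNReal.ofReal (Real.exp c) ≤ F ω) :
    ν A ≤ ENNReal.ofReal (Real.exp (b - c)) := by
  have hpos : ENNReal.ofReal (Real.exp c) ≠ 0 := by simpa using Real.exp_pos c
  rw [Real.exp_sub, ENNReal.ofReal_div_of_pos (Real.exp_pos _),
    ENNReal.le_div_iff_mul_le (Or.inl hpos) (Or.inl ENNReal.ofReal_ne_top), mul_comm]
  refine le_trans ?_ ((mul_meas_ge_le_lintegral hFm (ENNReal.ofReal (Real.exp c))).trans hF)
  exact mul_le_mul_right (measure_mono hA) _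

theorem exp_le_one_add_add_sq {x : ℝ} (hx : |x| ≤ 1) : Real.exp x ≤ 1 + x + x ^ 2 := by
  have := (abs_le.1 (Real.abs_exp_sub_one_sub_id_le hx)).2
  linarith

/-- A Bernstein type inequality. -/
theorem measure_sum_ge_le {f : Ω → ℝ} (hf : Measurable f) (h1 : ∀ x, |f x| ≤ 1) {c : ℝ}
    (hc : ∫ x, f x ∂μ + ∫ x, f x ^ 2 ∂μ ≤ c) (k : ℕ) (τ : ℝ) :
    (Measure.pi fun _ : Fin k => μ) {ω | k * c + τ ≤ ∑ i, f (ω i)}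
      ≤ ENNReal.ofReal (Real.exp (-τ)) := by
  have hint : Integrable f μ := integrable_of_abs_le hf h1
  have hsq : Integrable (fun x => f x ^ 2) μ := integrable_of_abs_le (hf.pow_const 2) (c := 1)
    fun x => by
      rw [abs_pow]
      exact pow_le_one₀ (abs_nonneg _) (h1 x)
  have hadd : Integrable (fun x => 1 + f x) μ := (integrable_const 1).add hint
  -- From `exp f ≤ 1 + f + f²` and `1 + c ≤ exp c`; no optimisation over a parameter is made.
  have hone : ∫⁻ x, ENNReal.ofReal (Real.exp (f x)) ∂μ ≤ ENNReal.ofReal (Real.exp c) := by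
    calc ∫⁻ x, ENNReal.ofReal (Real.exp (f x)) ∂μ
        ≤ ∫⁻ x, ENNReal.ofReal (1 + f x + f x ^ 2) ∂μ :=
          lintegral_mono fun x => ENNReal.ofReal_le_ofReal (exp_le_one_add_add_sq (h1 x))
      _ = ENNReal.ofReal (∫ x, (1 + f x + f x ^ 2) ∂μ) := by
          refine (ofReal_integral_eq_lintegral_ofReal (hadd.add hsq) ?_).symm
          exact Filter.Eventually.of_forall fun x =>
            (Real.exp_pos _).le.trans (exp_le_one_add_add_sq (h1 x))
      _ ≤ ENNReal.ofReal (Real.exp c) := by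
          refine ENNReal.ofReal_le_ofReal ?_
          rw [integral_add hadd hsq,
            integral_add (integrable_const 1) hint]
          simp only [integral_const, probReal_univ, smul_eq_mul, mul_one]
          linarith [Real.add_one_le_exp c]
  have hm : ∀ k : ℕ, Measurable fun ω : Fin k → Ω => ENNReal.ofReal (Real.exp (∑ i, f (ω i))) :=
    fun k => by fun_prop
  have hprod : ∀ k : ℕ, ∫⁻ ω, ENNReal.ofReal (Real.exp (∑ i, f (ω i)))
      ∂(Measure.pi fun _ : Fin k => μ) ≤ ENNReal.ofReal (Real.exp (k * c)) := by
    intro k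
    induction k with
    | zero => simp
    | succ k ih =>
      rw [lintegral_pi_succ μ (hm (k + 1))]
      simp only [Fin.sum_univ_succ, Fin.cons_zero, Fin.cons_succ, Real.exp_add]
      have e : ∀ ω : Fin k → Ω, ∫⁻ x, ENNReal.ofReal (Real.exp (f x) * Real.exp (∑ i, f (ω i))) ∂μ
          ≤ ENNReal.ofReal (Real.exp c) * ENNReal.ofReal (Real.exp (∑ i, f (ω i))) := fun ω => by
        simp only [ENNReal.ofReal_mul (Real.exp_pos _).le]
        rw [lintegral_mul_const _ (by fun_prop)]
        exact mul_le_mul_left hone _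
      refine (lintegral_mono e).trans ?_
      rw [lintegral_const_mul _ (hm k)]
      refine (mul_le_mul_right ih _).trans (le_of_eq ?_)
      rw [← ENNReal.ofReal_mul (Real.exp_pos _).le, ← Real.exp_add]
      congr 2
      push_cast
      ring
  refine (measure_lt_le_of_lintegral_exp_le (hprod k) (hm k) (c := k * c + τ) fun ω hω =>
    ENNReal.ofReal_le_ofReal (Real.exp_le_exp.2 hω)).trans (le_of_eq ?_)
  congr 2
  ring

/-! ### Vectors -/

variable {H : Type*} [NormedAddCommGroup H] [InnerProductSpace ℝ H]

/-- `√(1 + ‖·‖²)` is a smooth substitute for the norm: its gradient at `s` is `s / √(1 + ‖s‖²)` and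
its second derivative is at most `1`. The expansion follows from `R R' ≤ (R² + R'²) / 2`, where `R`
and `R'` are the values at `s` and `s + x`. -/
theorem sqrt_one_add_norm_add_sq_le (s x : H) :
    Real.sqrt (1 + ‖s + x‖ ^ 2) ≤ Real.sqrt (1 + ‖s‖ ^ 2)
      + inner ℝ s x / Real.sqrt (1 + ‖s‖ ^ 2) + ‖x‖ ^ 2 / 2 := by
  set R := Real.sqrt (1 + ‖s‖ ^ 2) with hR
  have hR2 : R ^ 2 = 1 + ‖s‖ ^ 2 := Real.sq_sqrt (by positivity)
  have hR1 : 1 ≤ R := Real.one_le_sqrt.2 (by nlinarith [sq_nonneg ‖s‖])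
  have hR0 : 0 < R := by linarith
  have hexp : 1 + ‖s + x‖ ^ 2 = R ^ 2 + 2 * inner ℝ s x + ‖x‖ ^ 2 := by
    rw [norm_add_sq_real, hR2]; ring
  have key : R * Real.sqrt (1 + ‖s + x‖ ^ 2) ≤ R ^ 2 + inner ℝ s x + ‖x‖ ^ 2 / 2 := by
    have h2 : Real.sqrt (1 + ‖s + x‖ ^ 2) ^ 2 = R ^ 2 + 2 * inner ℝ s x + ‖x‖ ^ 2 := by
      rw [Real.sq_sqrt (by positivity), hexp]
    nlinarith [sq_nonneg (R - Real.sqrt (1 + ‖s + x‖ ^ 2))]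
  have h3 : Real.sqrt (1 + ‖s + x‖ ^ 2) ≤ (R ^ 2 + inner ℝ s x + ‖x‖ ^ 2 / 2) / R := by
    rw [le_div_iff₀ hR0]; linarith
  refine h3.trans ?_
  have h4 : (R ^ 2 + inner ℝ s x + ‖x‖ ^ 2 / 2) / R
      = R + inner ℝ s x / R + ‖x‖ ^ 2 / 2 / R := by field_simp
  rw [h4]
  have h5 : ‖x‖ ^ 2 / 2 / R ≤ ‖x‖ ^ 2 / 2 := div_le_self (by positivity) hR1
  linarith

theorem abs_inner_div_sqrt_le (s x : H) :
    |inner ℝ s x / Real.sqrt (1 + ‖s‖ ^ 2)| ≤ ‖x‖ := by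
  have hR : ‖s‖ ≤ Real.sqrt (1 + ‖s‖ ^ 2) := Real.le_sqrt_of_sq_le (by linarith)
  have hR0 : 0 < Real.sqrt (1 + ‖s‖ ^ 2) := Real.sqrt_pos.2 (by positivity)
  rw [abs_div, abs_of_pos hR0, div_le_iff₀ hR0]
  refine (abs_real_inner_le_norm s x).trans ?_
  rw [mul_comm]
  exact mul_le_mul_of_nonneg_left hR (norm_nonneg _)

/-- The two-point case of the vector moment inequality. -/
theorem exp_sqrt_add_exp_sqrt_le (s x : H) :
    Real.exp (Real.sqrt (1 + ‖s + x‖ ^ 2)) + Real.exp (Real.sqrt (1 + ‖s - x‖ ^ 2))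
      ≤ 2 * Real.exp (Real.sqrt (1 + ‖s‖ ^ 2) + ‖x‖ ^ 2) := by
  set R := Real.sqrt (1 + ‖s‖ ^ 2) with hR
  set z := inner ℝ s x / R with hz
  have h1 := sqrt_one_add_norm_add_sq_le s x
  have h2 := sqrt_one_add_norm_add_sq_le s (-x)
  rw [← hR, ← hz] at h1
  rw [← hR, inner_neg_right, norm_neg, neg_div, ← hz, ← sub_eq_add_neg s x] at h2
  have hz2 : z ^ 2 ≤ ‖x‖ ^ 2 := by
    rw [← sq_abs z]
    exact pow_le_pow_left₀ (abs_nonneg _) (abs_inner_div_sqrt_le s x) 2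
  have hcosh : Real.exp z + Real.exp (-z) ≤ 2 * Real.exp (‖x‖ ^ 2 / 2) := by
    have h3 := Real.cosh_le_exp_half_sq z
    rw [Real.cosh_eq] at h3
    have h4 : Real.exp (z ^ 2 / 2) ≤ Real.exp (‖x‖ ^ 2 / 2) := Real.exp_le_exp.2 (by linarith)
    linarith
  calc Real.exp (Real.sqrt (1 + ‖s + x‖ ^ 2)) + Real.exp (Real.sqrt (1 + ‖s - x‖ ^ 2))
      ≤ Real.exp (R + z + ‖x‖ ^ 2 / 2) + Real.exp (R + -z + ‖x‖ ^ 2 / 2) :=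
        add_le_add (Real.exp_le_exp.2 h1) (Real.exp_le_exp.2 h2)
    _ = Real.exp (R + ‖x‖ ^ 2 / 2) * (Real.exp z + Real.exp (-z)) := by
        rw [mul_add, ← Real.exp_add, ← Real.exp_add]
        congr 2 <;> ring
    _ ≤ Real.exp (R + ‖x‖ ^ 2 / 2) * (2 * Real.exp (‖x‖ ^ 2 / 2)) :=
        mul_le_mul_of_nonneg_left hcosh (Real.exp_pos _).le
    _ = 2 * Real.exp (R + ‖x‖ ^ 2) := by
        rw [mul_left_comm, ← Real.exp_add]
        congr 2
        ring

variable [MeasurableSpace H] [BorelSpace H] [SecondCountableTopology H]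

/-- The linear term of the expansion is centred with values in `[-r, r]`, so Hoeffding's lemma costs
`r² / 2`; the quadratic term costs the other `r² / 2`. Dimension does not enter. -/
theorem lintegral_exp_sqrt_le {X : Ω → H} (hX : Measurable X) {r : ℝ} (hr : 0 ≤ r)
    (hb : ∀ x, ‖X x‖ ≤ r) (hmean : ∀ a : H, ∫ x, inner ℝ a (X x) ∂μ = 0) (s : H) :
    ∫⁻ x, ENNReal.ofReal (Real.exp (Real.sqrt (1 + ‖s + X x‖ ^ 2))) ∂μ
      ≤ ENNReal.ofReal (Real.exp (Real.sqrt (1 + ‖s‖ ^ 2) + r ^ 2)) := by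
  set R := Real.sqrt (1 + ‖s‖ ^ 2) with hR
  set Z : Ω → ℝ := fun x => inner ℝ s (X x) / R with hZ
  have hZm : Measurable Z := (measurable_const.inner hX).div_const _
  have hZb : ∀ x, |Z x| ≤ r := fun x => (abs_inner_div_sqrt_le s (X x)).trans (hb x)
  have hZ0 : ∫ x, Z x ∂μ = 0 := by
    simp only [hZ, integral_div, hmean s, zero_div]
  have hsub := ProbabilityTheory.hasSubgaussianMGF_of_mem_Icc_of_integral_eq_zero
    hZm.aemeasurable (Filter.Eventually.of_forall fun x => abs_le.1 (hZb x)) hZ0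
  have hmgf := hsub.mgf_le 1
  have hint := hsub.integrable_exp_mul 1
  simp only [ProbabilityTheory.mgf, one_mul] at hmgf hint
  have hcoe : ((((‖r - -r‖₊ / 2) ^ 2 : NNReal) : ℝ)) * 1 ^ 2 / 2 = r ^ 2 / 2 := by
    have : r - -r = 2 * r := by ring
    rw [this]
    push_cast
    rw [norm_mul, Real.norm_of_nonneg hr]
    norm_num
  rw [hcoe] at hmgf
  calc ∫⁻ x, ENNReal.ofReal (Real.exp (Real.sqrt (1 + ‖s + X x‖ ^ 2))) ∂μ
      ≤ ∫⁻ x, ENNReal.ofReal (Real.exp (R + r ^ 2 / 2)) * ENNReal.ofReal (Real.exp (Z x)) ∂μ := by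
        refine lintegral_mono fun x => ?_
        rw [← ENNReal.ofReal_mul (Real.exp_pos _).le, ← Real.exp_add]
        refine ENNReal.ofReal_le_ofReal (Real.exp_le_exp.2 ?_)
        have h1 := sqrt_one_add_norm_add_sq_le s (X x)
        have h2 : ‖X x‖ ^ 2 ≤ r ^ 2 := pow_le_pow_left₀ (norm_nonneg _) (hb x) 2
        simp only [hZ]
        linarith
    _ = ENNReal.ofReal (Real.exp (R + r ^ 2 / 2)) * ENNReal.ofReal (∫ x, Real.exp (Z x) ∂μ) := by
        rw [lintegral_const_mul _ (by fun_prop), ofReal_integral_eq_lintegral_ofReal hint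
          (Filter.Eventually.of_forall fun x => (Real.exp_pos _).le)]
    _ ≤ _ := by
        rw [← ENNReal.ofReal_mul (Real.exp_pos _).le]
        refine ENNReal.ofReal_le_ofReal
          ((mul_le_mul_of_nonneg_left hmgf (Real.exp_pos _).le).trans (le_of_eq ?_))
        rw [← Real.exp_add]
        congr 1
        ring

/-- A dimension-free Hoeffding inequality for sums of bounded centred vectors. -/
theorem measure_norm_sum_ge_le {X : Ω → H} (hX : Measurable X) (hb : ∀ x, ‖X x‖ ≤ 1)
    (hmean : ∀ a : H, ∫ x, inner ℝ a (X x) ∂μ = 0) (k : ℕ) {η : ℝ} (hη : 0 ≤ η) :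
    (Measure.pi fun _ : Fin k => μ) {ω | k * η ≤ ‖∑ i, X (ω i)‖}
      ≤ ENNReal.ofReal (Real.exp (1 - k * η ^ 2 / 4)) := by
  -- The minimiser of `lam² - lam η`. The `1` in the exponent is the value of the potential at `0`.
  set lam := η / 2 with hlam
  have hlam0 : 0 ≤ lam := by positivity
  set Y : Ω → H := fun x => lam • X x with hY
  have hYm : Measurable Y := hX.const_smul lam
  have hYb : ∀ x, ‖Y x‖ ≤ lam := fun x => by
    rw [hY, norm_smul, Real.norm_of_nonneg hlam0]
    exact mul_le_of_le_one_right hlam0 (hb x)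
  have hYmean : ∀ a : H, ∫ x, inner ℝ a (Y x) ∂μ = 0 := fun a => by
    simp only [hY, inner_smul_right, integral_const_mul, hmean a, mul_zero]
  have hm : ∀ (k : ℕ) (s : H), Measurable fun ω : Fin k → Ω =>
      ENNReal.ofReal (Real.exp (Real.sqrt (1 + ‖s + ∑ i, Y (ω i)‖ ^ 2))) := fun k s => by fun_prop
  have hmoment : ∀ (k : ℕ) (s : H), ∫⁻ ω, ENNReal.ofReal (Real.exp (Real.sqrt
      (1 + ‖s + ∑ i, Y (ω i)‖ ^ 2))) ∂(Measure.pi fun _ : Fin k => μ)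
      ≤ ENNReal.ofReal (Real.exp (Real.sqrt (1 + ‖s‖ ^ 2) + k * lam ^ 2)) := by
    intro k
    induction k with
    | zero => simp
    | succ k ih =>
      intro s
      rw [lintegral_pi_succ' μ (hm (k + 1) s)]
      simp only [Fin.sum_univ_succ, Fin.cons_zero, Fin.cons_succ, ← add_assoc]
      refine (lintegral_mono fun x => ih (s + Y x)).trans ?_
      simp only [Real.exp_add, ENNReal.ofReal_mul (Real.exp_pos _).le]
      rw [lintegral_mul_const _ (by fun_prop)]
      refine (mul_le_mul_left (lintegral_exp_sqrt_le hYm hlam0 hYb hYmean s) _).trans (le_of_eq ?_)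
      rw [← ENNReal.ofReal_mul (Real.exp_pos _).le, ← ENNReal.ofReal_mul (Real.exp_pos _).le,
        ← Real.exp_add, ← Real.exp_add]
      congr 2
      push_cast
      ring
  have h0 := hmoment k 0
  refine (measure_lt_le_of_lintegral_exp_le h0 (hm k 0) (c := lam * (k * η)) fun ω hω =>
    ENNReal.ofReal_le_ofReal (Real.exp_le_exp.2 (Real.le_sqrt_of_sq_le ?_))).trans
      (le_of_eq ?_)
  · have h1 : ‖(0 : H) + ∑ i, Y (ω i)‖ = lam * ‖∑ i, X (ω i)‖ := by
      rw [zero_add, hY, ← Finset.smul_sum, norm_smul, Real.norm_of_nonneg hlam0]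
    rw [h1]
    have h2 : lam * (k * η) ≤ lam * ‖∑ i, X (ω i)‖ := mul_le_mul_of_nonneg_left hω hlam0
    have h3 : 0 ≤ lam * (k * η) := by positivity
    linarith [pow_le_pow_left₀ h3 h2 2]
  · congr 2
    rw [norm_zero, hlam]
    norm_num
    ring

end Concentration

/-! ### Uniform convergence for contractions of linear functions -/

section Uniform

theorem exp_half_add_le (a b : ℝ) : Real.exp ((a + b) / 2) ≤ (Real.exp a + Real.exp b) / 2 := by
  have h := sq_nonneg (Real.exp (a / 2) - Real.exp (b / 2))
  have ha : Real.exp a = Real.exp (a / 2) ^ 2 := by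
    rw [← Real.exp_nat_mul]; congr 1; push_cast; ring
  have hb : Real.exp b = Real.exp (b / 2) ^ 2 := by
    rw [← Real.exp_nat_mul]; congr 1; push_cast; ring
  have hab : Real.exp ((a + b) / 2) = Real.exp (a / 2) * Real.exp (b / 2) := by
    rw [← Real.exp_add]; congr 1; ring
  rw [ha, hb, hab]
  nlinarith

/-- Increments of a convex increasing function grow with the starting point and with the length. -/
theorem exp_sub_exp_le {a b x y : ℝ} (hab : b ≤ a) (hy : 0 ≤ y) (hxy : y ≤ x) :
    Real.exp (b + y) - Real.exp b ≤ Real.exp (a + x) - Real.exp a := by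
  have h1 : Real.exp (b + y) - Real.exp b = Real.exp b * (Real.exp y - 1) := by
    rw [Real.exp_add]; ring
  have h2 : Real.exp (a + x) - Real.exp a = Real.exp a * (Real.exp x - 1) := by
    rw [Real.exp_add]; ring
  rw [h1, h2]
  have h3 : 1 ≤ Real.exp y := Real.one_le_exp hy
  exact mul_le_mul (Real.exp_le_exp.2 hab) (by linarith [Real.exp_le_exp.2 hxy]) (by linarith)
    (Real.exp_pos _).le

theorem exp_add_exp_neg_le {x y : ℝ} (h : |x| ≤ |y|) :
    Real.exp x + Real.exp (-x) ≤ Real.exp y + Real.exp (-y) := by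
  have := Real.cosh_le_cosh.2 h
  rw [Real.cosh_eq, Real.cosh_eq] at this
  linarith

/-- The contraction principle for one sign and two functions, for nonnegative arguments. -/
theorem contraction_aux {f₁ f₂ t₁ t₂ φ₁ φ₂ p q : ℝ} (h0 : 0 ≤ t₂)
    (hφ₂ : |φ₂| ≤ t₂) (hφ : |φ₁ - φ₂| ≤ t₁ - t₂)
    (hp₁ : Real.exp (f₁ + t₁) ≤ p) (hp₂ : Real.exp (f₂ + t₂) ≤ p)
    (hq₂ : Real.exp (f₂ - t₂) ≤ q) :
    Real.exp (f₁ + φ₁) + Real.exp (f₂ - φ₂) ≤ p + q := by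
  -- In the first case the increment of `exp` from `f₂ - t₂` to `f₂ - φ₂` is at most that from `f₁ +
  -- φ₁` to `f₁ + t₁`. In the second, `f₁ + φ₁` is replaced by `f₂ + φ₂`, and monotonicity of `cosh`
  -- in the absolute value applies.
  rcases le_total (f₂ + φ₂) (f₁ + φ₁) with h | h
  · have h1 := abs_le.1 hφ₂
    have h2 := abs_le.1 hφ
    have := exp_sub_exp_le (a := f₁ + φ₁) (b := f₂ - t₂) (x := t₁ - φ₁) (y := t₂ - φ₂)
      (by linarith) (by linarith) (by linarith)
    rw [show f₂ - t₂ + (t₂ - φ₂) = f₂ - φ₂ by ring, show f₁ + φ₁ + (t₁ - φ₁) = f₁ + t₁ by ring]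
      at this
    linarith
  · have h1 : Real.exp (f₁ + φ₁) ≤ Real.exp (f₂ + φ₂) := Real.exp_le_exp.2 h
    have h2 : Real.exp (f₂ + φ₂) + Real.exp (f₂ - φ₂) ≤ Real.exp (f₂ + t₂) + Real.exp (f₂ - t₂) := by
      have h3 := exp_add_exp_neg_le (x := φ₂) (y := t₂) (by rwa [abs_of_nonneg h0])
      simp only [sub_eq_add_neg, Real.exp_add]
      rw [← mul_add, ← mul_add]
      exact mul_le_mul_of_nonneg_left h3 (Real.exp_pos _).le
    linarith

/-- The contraction principle for one sign and two functions. -/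
theorem contraction_two_point {f₁ f₂ t₁ t₂ φ₁ φ₂ p q : ℝ}
    (hφ₁ : |φ₁| ≤ |t₁|) (hφ₂ : |φ₂| ≤ |t₂|) (hφ : |φ₁ - φ₂| ≤ |t₁ - t₂|)
    (hp₁ : Real.exp (f₁ + t₁) ≤ p) (hq₁ : Real.exp (f₁ - t₁) ≤ q)
    (hp₂ : Real.exp (f₂ + t₂) ≤ p) (hq₂ : Real.exp (f₂ - t₂) ≤ q) :
    Real.exp (f₁ + φ₁) + Real.exp (f₂ - φ₂) ≤ p + q := by
  have ha := abs_le.1 hφ₁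
  have hb := abs_le.1 hφ₂
  -- For equal signs, exchanging the indices or reversing the signs leads to `contraction_aux`. For
  -- opposite signs each exponential is bounded separately.
  rcases le_total 0 t₁ with h1 | h1 <;> rcases le_total 0 t₂ with h2 | h2
  · rw [abs_of_nonneg h1] at hφ₁
    rw [abs_of_nonneg h2] at hφ₂
    rcases le_total t₂ t₁ with h | h
    · rw [abs_of_nonneg (by linarith : 0 ≤ t₁ - t₂)] at hφ
      exact contraction_aux h2 hφ₂ hφ hp₁ hp₂ hq₂
    · rw [abs_sub_comm, abs_of_nonpos (by linarith : t₁ - t₂ ≤ 0)] at hφ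
      have := contraction_aux (f₁ := f₂) (f₂ := f₁) (t₁ := t₂) (t₂ := t₁) (φ₁ := -φ₂) (φ₂ := -φ₁)
        (p := p) (q := q) h1
        (by rwa [abs_neg]) (by rw [neg_sub_neg, abs_sub_comm]; linarith)
        hp₂ hp₁ hq₁
      rw [sub_neg_eq_add, ← sub_eq_add_neg] at this
      linarith
  · rw [abs_of_nonneg h1] at ha
    rw [abs_of_nonpos h2] at hb
    have e1 : Real.exp (f₁ + φ₁) ≤ Real.exp (f₁ + t₁) := Real.exp_le_exp.2 (by linarith)
    have e2 : Real.exp (f₂ - φ₂) ≤ Real.exp (f₂ - t₂) := Real.exp_le_exp.2 (by linarith)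
    linarith
  · rw [abs_of_nonpos h1] at ha
    rw [abs_of_nonneg h2] at hb
    have e1 : Real.exp (f₁ + φ₁) ≤ Real.exp (f₁ - t₁) := Real.exp_le_exp.2 (by linarith)
    have e2 : Real.exp (f₂ - φ₂) ≤ Real.exp (f₂ + t₂) := Real.exp_le_exp.2 (by linarith)
    linarith
  · rw [abs_of_nonpos h1] at hφ₁
    rw [abs_of_nonpos h2] at hφ₂
    rcases le_total t₁ t₂ with h | h
    · rw [abs_of_nonpos (by linarith : t₁ - t₂ ≤ 0)] at hφ
      have := contraction_aux (t₁ := -t₁) (t₂ := -t₂) (p := q) (q := p) (neg_nonneg.2 h2) hφ₂ (by linarith) (by rwa [← sub_eq_add_neg])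
        (f₁ := f₁) (f₂ := f₂) (by rwa [← sub_eq_add_neg]) (by rwa [sub_neg_eq_add])
      linarith
    · rw [abs_sub_comm, abs_of_nonneg (by linarith : 0 ≤ t₁ - t₂)] at hφ
      have := contraction_aux (f₁ := f₂) (f₂ := f₁) (t₁ := -t₂) (t₂ := -t₁) (φ₁ := -φ₂) (φ₂ := -φ₁)
        (p := q) (q := p) (neg_nonneg.2 h1)
        (by rwa [abs_neg]) (by rw [neg_sub_neg, abs_sub_comm]; linarith)
        (by rwa [← sub_eq_add_neg]) (by rwa [← sub_eq_add_neg]) (by rwa [sub_neg_eq_add])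
      rw [sub_neg_eq_add, ← sub_eq_add_neg] at this
      linarith

/-- `exp` as a function into `[0, ∞]`. -/
def eexp (x : ℝ) : ℝ≥0∞ := ENNReal.ofReal (Real.exp x)

theorem eexp_mono {x y : ℝ} (h : x ≤ y) : eexp x ≤ eexp y :=
  ENNReal.ofReal_le_ofReal (Real.exp_le_exp.2 h)

theorem eexp_add (x y : ℝ) : eexp (x + y) = eexp x * eexp y := by
  rw [eexp, Real.exp_add, ENNReal.ofReal_mul (Real.exp_pos _).le]
  rfl

theorem measurable_eexp : Measurable eexp := by
  unfold eexp
  fun_prop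

/-- The contraction principle for one sign. -/
theorem iSup_eexp_contraction {ι : Type*} {f t φ : ι → ℝ} (hφ : ∀ i, |φ i| ≤ |t i|)
    (hφ' : ∀ i j, |φ i - φ j| ≤ |t i - t j|) :
    (⨆ i, eexp (f i + φ i)) + (⨆ i, eexp (f i - φ i))
      ≤ (⨆ i, eexp (f i + t i)) + ⨆ i, eexp (f i - t i) := by
  rcases isEmpty_or_nonempty ι with hι | hι
  · simp
  by_cases htop : (⨆ i, eexp (f i + t i)) = ⊤ ∨ (⨆ i, eexp (f i - t i)) = ⊤
  · rcases htop with h | h <;> simp [h]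
  rw [not_or] at htop
  obtain ⟨hP, hQ⟩ := htop
  set P := ⨆ i, eexp (f i + t i)
  set Q := ⨆ i, eexp (f i - t i)
  refine ENNReal.iSup_add_iSup_le fun i j => ?_
  have hle : ∀ {x : ℝ} {R : ℝ≥0∞}, R ≠ ⊤ → eexp x ≤ R → Real.exp x ≤ R.toReal := fun hR h =>
    (ENNReal.ofReal_le_iff_le_toReal hR).1 h
  have h := contraction_two_point (hφ i) (hφ j) (hφ' i j)
    (hle hP (le_iSup (fun i => eexp (f i + t i)) i)) (hle hQ (le_iSup (fun i => eexp (f i - t i)) i))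
    (hle hP (le_iSup (fun i => eexp (f i + t i)) j)) (hle hQ (le_iSup (fun i => eexp (f i - t i)) j))
  rw [eexp, eexp, ← ENNReal.ofReal_add (Real.exp_pos _).le (Real.exp_pos _).le,
    ENNReal.ofReal_le_iff_le_toReal (ENNReal.add_ne_top.2 ⟨hP, hQ⟩), ENNReal.toReal_add hP hQ]
  exact h

theorem lintegral_half_add {Ω : Type*} [MeasurableSpace Ω] {μ : Measure Ω} {F G : Ω → ℝ≥0∞} (hF : Measurable F) (hG : Measurable G) :
    ∫⁻ x, (F x + G x) / 2 ∂μ = (∫⁻ x, F x ∂μ + ∫⁻ x, G x ∂μ) / 2 := by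
  have hFG : Measurable fun x => F x + G x := hF.add hG
  simp only [div_eq_mul_inv]
  rw [lintegral_mul_const _ hFG, lintegral_add_left hF]

theorem half_add_eexp_sqrt_le {H : Type*} [NormedAddCommGroup H] [InnerProductSpace ℝ H] {B r : ℝ}
    (hB : 0 < B) (hr : 0 ≤ r) (a : H) {v : H} (hv : ‖v‖ ≤ 1) (c : ℝ) :
    (eexp (Real.sqrt (1 + ‖B • (a + (2 * r) • v)‖ ^ 2) + c)
      + eexp (Real.sqrt (1 + ‖B • (a + (-(2 * r)) • v)‖ ^ 2) + c)) / 2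
      ≤ eexp (Real.sqrt (1 + ‖B • a‖ ^ 2) + (c + (2 * r * B) ^ 2)) := by
  rw [eexp_add, eexp_add, ← add_mul, neg_smul, ← sub_eq_add_neg a, smul_add, smul_sub]
  have h1 := exp_sqrt_add_exp_sqrt_le (B • a) (B • (2 * r) • v)
  have h2 : ‖B • (2 * r) • v‖ ^ 2 ≤ (2 * r * B) ^ 2 := by
    refine pow_le_pow_left₀ (norm_nonneg _) ?_ 2
    rw [norm_smul, norm_smul, Real.norm_of_nonneg hB.le, Real.norm_of_nonneg (by positivity)]
    calc B * (2 * r * ‖v‖) = (2 * r * B) * ‖v‖ := by ring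
      _ ≤ 2 * r * B := mul_le_of_le_one_right (by positivity) hv
  have h3 : eexp (Real.sqrt (1 + ‖B • a + B • (2 * r) • v‖ ^ 2))
      + eexp (Real.sqrt (1 + ‖B • a - B • (2 * r) • v‖ ^ 2))
      ≤ 2 * eexp (Real.sqrt (1 + ‖B • a‖ ^ 2) + (2 * r * B) ^ 2) := by
    unfold eexp
    rw [← ENNReal.ofReal_add (Real.exp_pos _).le (Real.exp_pos _).le,
      show (2 : ℝ≥0∞) = ENNReal.ofReal 2 by simp, ← ENNReal.ofReal_mul (by norm_num)]
    refine ENNReal.ofReal_le_ofReal (h1.trans ?_)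
    exact mul_le_mul_of_nonneg_left (Real.exp_le_exp.2 (by linarith)) (by norm_num)
  refine (ENNReal.div_le_div_right (mul_le_mul_left h3 _) 2).trans (le_of_eq ?_)
  rw [mul_assoc, ENNReal.mul_div_right_comm, ENNReal.div_self (by simp) (by simp), one_mul,
    ← eexp_add]
  congr 1
  ring

variable {Ω : Type*} [MeasurableSpace Ω] {μ : Measure Ω} [IsProbabilityMeasure μ]
  {ι : Type*} [Countable ι]

theorem eexp_integral_le {g : Ω → ℝ} (hg : Measurable g) {c : ℝ} (hb : ∀ x, |g x| ≤ c) :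
    eexp (∫ x, g x ∂μ) ≤ ∫⁻ x, eexp (g x) ∂μ := by
  have hint : Integrable g μ := integrable_of_abs_le hg hb
  have hexp : Integrable (fun x => Real.exp (g x)) μ :=
    integrable_of_abs_le (by fun_prop) (c := Real.exp c) fun x => by
      rw [abs_of_pos (Real.exp_pos _)]
      exact Real.exp_le_exp.2 ((le_abs_self _).trans (hb x))
  have h := convexOn_exp.map_integral_le Real.continuous_exp.continuousOn isClosed_univ
    (Filter.Eventually.of_forall fun _ => Set.mem_univ _) hint hexp
  unfold eexp
  rw [← ofReal_integral_eq_lintegral_ofReal hexp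
    (Filter.Eventually.of_forall fun _ => (Real.exp_pos _).le)]
  exact ENNReal.ofReal_le_ofReal h

/-- Symmetrization and contraction in one coordinate. -/
theorem lintegral_iSup_eexp_le {g t : ι → Ω → ℝ} (hg : ∀ i, Measurable (g i))
    {c : ℝ} (hb : ∀ i x, |g i x| ≤ c) (hgt : ∀ i x, |g i x| ≤ |t i x|)
    (hgt' : ∀ i j x, |g i x - g j x| ≤ |t i x - t j x|) (f : ι → ℝ) :
    ∫⁻ x, ⨆ i, eexp (f i + (∫ y, g i y ∂μ - g i x)) ∂μ
      ≤ ∫⁻ x, ((⨆ i, eexp (f i + 2 * t i x)) + ⨆ i, eexp (f i - 2 * t i x)) / 2 ∂μ := by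
  set P : Ω → ℝ≥0∞ := fun x => ⨆ i, eexp (f i + 2 * g i x) with hP
  set Q : Ω → ℝ≥0∞ := fun x => ⨆ i, eexp (f i - 2 * g i x) with hQ
  have hPm : Measurable P := Measurable.iSup fun i =>
    measurable_eexp.comp (((hg i).const_mul 2).const_add (f i))
  have hQm : Measurable Q := Measurable.iSup fun i =>
    measurable_eexp.comp (((hg i).const_mul 2).const_sub (f i))
  -- The mean is replaced by a ghost point `y` (Jensen), and `g y - g x` is split by midpoint
  -- convexity into `2 g y` and `-2 g x`. As `x` and `y` have the same law, an average over a random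
  -- sign remains.
  have hpt : ∀ x, (⨆ i, eexp (f i + (∫ y, g i y ∂μ - g i x))) ≤ ∫⁻ y, (P y + Q x) / 2 ∂μ := by
    intro x
    refine iSup_le fun i => ?_
    have h1 : eexp (f i + (∫ y, g i y ∂μ - g i x)) ≤ ∫⁻ y, eexp (f i + (g i y - g i x)) ∂μ := by
      have h2 := eexp_integral_le (μ := μ) (hg i) (hb i)
      have e : ∀ z, eexp (f i + (z - g i x)) = eexp (f i - g i x) * eexp z := fun z => by
        rw [← eexp_add]; congr 1; ring
      have hgm : Measurable fun y => eexp (g i y) := measurable_eexp.comp (hg i)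
      simp only [e]
      rw [lintegral_const_mul _ hgm]
      exact mul_le_mul_right h2 _
    refine h1.trans (lintegral_mono fun y => ?_)
    have h3 : eexp (f i + (g i y - g i x))
        ≤ (eexp (f i + 2 * g i y) + eexp (f i - 2 * g i x)) / 2 := by
      have h4 := exp_half_add_le (f i + 2 * g i y) (f i - 2 * g i x)
      rw [show (f i + 2 * g i y + (f i - 2 * g i x)) / 2 = f i + (g i y - g i x) by ring] at h4
      unfold eexp
      rw [← ENNReal.ofReal_add (Real.exp_pos _).le (Real.exp_pos _).le,
        show (2 : ℝ≥0∞) = ENNReal.ofReal 2 by simp, ← ENNReal.ofReal_div_of_pos (by norm_num)]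
      exact ENNReal.ofReal_le_ofReal h4
    refine h3.trans (ENNReal.div_le_div_right (add_le_add ?_ ?_) 2)
    · exact le_iSup (fun i => eexp (f i + 2 * g i y)) i
    · exact le_iSup (fun i => eexp (f i - 2 * g i x)) i
  calc ∫⁻ x, ⨆ i, eexp (f i + (∫ y, g i y ∂μ - g i x)) ∂μ
      ≤ ∫⁻ x, ∫⁻ y, (P y + Q x) / 2 ∂μ ∂μ := lintegral_mono hpt
    _ = ∫⁻ x, (P x + Q x) / 2 ∂μ := by
        have e : ∀ x, ∫⁻ y, (P y + Q x) / 2 ∂μ = (∫⁻ y, P y ∂μ + Q x) / 2 := fun x => by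
          rw [lintegral_half_add hPm measurable_const, lintegral_const, measure_univ, mul_one]
        simp only [e]
        rw [lintegral_half_add measurable_const hQm, lintegral_half_add hPm hQm, lintegral_const,
          measure_univ, mul_one]
    _ ≤ _ := by
        refine lintegral_mono fun x => ENNReal.div_le_div_right ?_ 2
        refine iSup_eexp_contraction (fun i => ?_) fun i j => ?_
        · rw [abs_mul, abs_mul]
          exact mul_le_mul_of_nonneg_left (hgt i x) (abs_nonneg _)
        · rw [← mul_sub, ← mul_sub, abs_mul, abs_mul]
          exact mul_le_mul_of_nonneg_left (hgt' i j x) (abs_nonneg _)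

variable {H : Type*} [NormedAddCommGroup H] [InnerProductSpace ℝ H]

/-- With the integrals exchanged, `x` is fixed while the moment bound `hΦ` is applied at the two
points `a ± 2r ψ(x)`; the average over the sign is then the two-point inequality. -/
theorem lintegral_lintegral_two_point_le {k : ℕ} {Φ : H → (Fin k → Ω) → ℝ≥0∞} {B r : ℝ}
    (hB : 0 < B) (hr : 0 ≤ r) {ψ : Ω → H} (hψ1 : ∀ x, ‖ψ x‖ ≤ 1) (a : H)
    (hm : ∀ s : ℝ, Measurable fun p : (Fin k → Ω) × Ω => Φ (a + s • ψ p.2) p.1)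
    (hΦ : ∀ b : H, ∫⁻ ω, Φ b ω ∂(Measure.pi fun _ : Fin k => μ)
      ≤ eexp (Real.sqrt (1 + ‖B • b‖ ^ 2) + k * (2 * r * B) ^ 2)) :
    ∫⁻ ω, ∫⁻ x, (Φ (a + (2 * r) • ψ x) ω + Φ (a + (-(2 * r)) • ψ x) ω) / 2 ∂μ
      ∂(Measure.pi fun _ : Fin k => μ)
      ≤ eexp (Real.sqrt (1 + ‖B • a‖ ^ 2) + (k + 1 : ℕ) * (2 * r * B) ^ 2) := by
  have hmeas : Measurable fun p : (Fin k → Ω) × Ω =>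
      (Φ (a + (2 * r) • ψ p.2) p.1 + Φ (a + (-(2 * r)) • ψ p.2) p.1) / 2 :=
    ((hm (2 * r)).add (hm (-(2 * r)))).div_const 2
  rw [lintegral_lintegral_swap hmeas.aemeasurable]
  have hpt : ∀ x, ∫⁻ ω, (Φ (a + (2 * r) • ψ x) ω + Φ (a + (-(2 * r)) • ψ x) ω) / 2
      ∂(Measure.pi fun _ : Fin k => μ)
      ≤ eexp (Real.sqrt (1 + ‖B • a‖ ^ 2) + (k + 1 : ℕ) * (2 * r * B) ^ 2) := fun x => by
    have hF : ∀ s : ℝ, Measurable (Φ (a + s • ψ x)) :=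
      fun s => (hm s).comp measurable_prodMk_right
    rw [lintegral_half_add (hF (2 * r)) (hF (-(2 * r)))]
    refine (ENNReal.div_le_div_right (add_le_add (hΦ (a + (2 * r) • ψ x))
      (hΦ (a + (-(2 * r)) • ψ x))) 2).trans ?_
    refine (half_add_eexp_sqrt_le hB hr a (hψ1 x) _).trans (le_of_eq ?_)
    congr 1
    push_cast
    ring
  refine (lintegral_mono hpt).trans (le_of_eq ?_)
  rw [lintegral_const, measure_univ, mul_one]

variable [MeasurableSpace H] [BorelSpace H] [SecondCountableTopology H]

/-- Coordinates are removed one at a time. Symmetrization and contraction turn the term of a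
coordinate into `± 2r ⟨zᵢ, ψ(x)⟩`, which is linear in `zᵢ` and is absorbed into `a`; this is why the
bound is claimed for every `a`. Each removal costs `(2rB)²`, and at the end `⟨zᵢ, a⟩ ≤ B ‖a‖ ≤ √(1 +
‖B a‖²)`. Countability of the index set keeps the supremum measurable. -/
theorem lintegral_pi_iSup_eexp_le {B r : ℝ} (hB : 0 < B) (hr : 0 ≤ r) {z : ι → H}
    (hz : ∀ i, ‖z i‖ ≤ B) {ψ : Ω → H} (hψ : Measurable ψ) (hψ1 : ∀ x, ‖ψ x‖ ≤ 1) {g : ι → Ω → ℝ}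
    (hg : ∀ i, Measurable (g i)) (hgt : ∀ i x, |g i x| ≤ |r * inner ℝ (z i) (ψ x)|)
    (hgt' : ∀ i j x, |g i x - g j x| ≤ |r * inner ℝ (z i) (ψ x) - r * inner ℝ (z j) (ψ x)|) (k : ℕ) :
    ∀ a : H, ∫⁻ ω, ⨆ i, eexp (inner ℝ (z i) a + ∑ j, (∫ y, g i y ∂μ - g i (ω j)))
      ∂(Measure.pi fun _ : Fin k => μ)
      ≤ eexp (Real.sqrt (1 + ‖B • a‖ ^ 2) + k * (2 * r * B) ^ 2) := by
  have hm : ∀ (k : ℕ) (a : H), Measurable fun ω : Fin k → Ω =>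
      ⨆ i, eexp (inner ℝ (z i) a + ∑ j, (∫ y, g i y ∂μ - g i (ω j))) := fun k a =>
    Measurable.iSup fun i => measurable_eexp.comp <| Measurable.const_add
      (Finset.measurable_sum _ fun j _ => ((hg i).comp (measurable_pi_apply j)).const_sub _) _
  induction k with
  | zero =>
    intro a
    have h : (⨆ i, eexp (inner ℝ (z i) a + 0)) ≤ eexp (Real.sqrt (1 + ‖B • a‖ ^ 2)) := by
      refine iSup_le fun i => eexp_mono ?_
      rw [add_zero]
      refine (real_inner_le_norm _ _).trans (Real.le_sqrt_of_sq_le ?_)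
      rw [norm_smul, Real.norm_of_nonneg hB.le]
      have := pow_le_pow_left₀ (by positivity)
        (mul_le_mul_of_nonneg_right (hz i) (norm_nonneg a)) 2
      linarith
    simpa using h
  | succ k ih =>
    intro a
    rw [lintegral_pi_succ μ (hm (k + 1) a)]
    have hb : ∀ i x, |g i x| ≤ r * B := fun i x => by
      refine (hgt i x).trans ?_
      rw [abs_mul, abs_of_nonneg hr]
      refine mul_le_mul_of_nonneg_left ((abs_real_inner_le_norm _ _).trans ?_) hr
      calc ‖z i‖ * ‖ψ x‖ ≤ B * 1 := mul_le_mul (hz i) (hψ1 x) (norm_nonneg _) hB.le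
        _ = B := mul_one B
    have hstep : ∀ ω : Fin k → Ω, ∫⁻ x, ⨆ i, eexp (inner ℝ (z i) a
          + ∑ j, (∫ y, g i y ∂μ - g i ((Fin.cons x ω : Fin (k + 1) → Ω) j))) ∂μ
        ≤ ∫⁻ x, ((⨆ i, eexp (inner ℝ (z i) (a + (2 * r) • ψ x)
            + ∑ j, (∫ y, g i y ∂μ - g i (ω j))))
          + ⨆ i, eexp (inner ℝ (z i) (a - (2 * r) • ψ x)
            + ∑ j, (∫ y, g i y ∂μ - g i (ω j)))) / 2 ∂μ := by
      intro ω
      have h := lintegral_iSup_eexp_le (μ := μ) hg hb hgt hgt'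
        (fun i => inner ℝ (z i) a + ∑ j, (∫ y, g i y ∂μ - g i (ω j)))
      refine le_trans (le_of_eq ?_) (h.trans (le_of_eq ?_))
      · refine lintegral_congr fun x => iSup_congr fun i => ?_
        rw [Fin.sum_univ_succ]
        simp only [Fin.cons_zero, Fin.cons_succ]
        congr 1
        ring
      · refine lintegral_congr fun x => ?_
        congr 2
        · refine iSup_congr fun i => ?_
          rw [inner_add_right, inner_smul_right]
          congr 1
          ring
        · refine iSup_congr fun i => ?_
          rw [inner_sub_right, inner_smul_right]
          congr 1
          ring
    refine (lintegral_mono hstep).trans ?_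
    have hmp : ∀ s : ℝ, Measurable fun p : (Fin k → Ω) × Ω =>
        ⨆ i, eexp (inner ℝ (z i) (a + s • ψ p.2) + ∑ j, (∫ y, g i y ∂μ - g i (p.1 j))) := fun s =>
      Measurable.iSup fun i => measurable_eexp.comp <| Measurable.add
        (measurable_const.inner (((hψ.comp measurable_snd).const_smul s).const_add a))
        (Finset.measurable_sum _ fun j _ =>
          ((hg i).comp ((measurable_pi_apply j).comp measurable_fst)).const_sub _)
    have hneg : ∀ x, a - (2 * r) • ψ x = a + (-(2 * r)) • ψ x := fun x => by
      rw [neg_smul, sub_eq_add_neg]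
    simp only [hneg]
    exact lintegral_lintegral_two_point_le (Φ := fun b ω =>
      ⨆ i, eexp (inner ℝ (z i) b + ∑ j, (∫ y, g i y ∂μ - g i (ω j)))) hB hr hψ1 a hmp ih

/-- Uniform one-sided deviation of the means of functions which are contractions of linear
functions. -/
theorem measure_exists_lt_sum_le {B r : ℝ} (hB : 0 < B) (hr : 0 < r) {z : ι → H}
    (hz : ∀ i, ‖z i‖ ≤ B) {ψ : Ω → H} (hψ : Measurable ψ) (hψ1 : ∀ x, ‖ψ x‖ ≤ 1) {g : ι → Ω → ℝ}
    (hg : ∀ i, Measurable (g i)) (hgt : ∀ i x, |g i x| ≤ |r * inner ℝ (z i) (ψ x)|)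
    (hgt' : ∀ i j x, |g i x - g j x| ≤ |r * inner ℝ (z i) (ψ x) - r * inner ℝ (z j) (ψ x)|) (k : ℕ)
    {s : ℝ} (hs : 0 ≤ s) :
    (Measure.pi fun _ : Fin k => μ) {ω | ∃ i, k * (8 * r * B * s)
      ≤ ∑ j, (∫ y, g i y ∂μ - g i (ω j))}
      ≤ ENNReal.ofReal (Real.exp (1 - 4 * (k * s ^ 2))) := by
  -- Then `2 lam r B = 2s`, and the exponent becomes `1 + 4ks² - 8ks²`.
  set lam := s / (r * B) with hlam
  have hlam0 : 0 ≤ lam := by positivity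
  have key := lintegral_pi_iSup_eexp_le (μ := μ) (r := lam * r) (g := fun i x => lam * g i x) hB
    (by positivity) hz hψ hψ1 (fun i => (hg i).const_mul lam)
    (fun i x => by
      rw [abs_mul, mul_assoc, abs_mul]
      exact mul_le_mul_of_nonneg_left (hgt i x) (abs_nonneg _))
    (fun i j x => by
      rw [← mul_sub, abs_mul, mul_assoc, mul_assoc, ← mul_sub, abs_mul]
      exact mul_le_mul_of_nonneg_left (hgt' i j x) (abs_nonneg _)) k 0
  have hm : Measurable fun ω : Fin k → Ω =>
      ⨆ i, eexp (inner ℝ (z i) (0 : H) + ∑ j, (∫ y, lam * g i y ∂μ - lam * g i (ω j))) :=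
    Measurable.iSup fun i => measurable_eexp.comp <| Measurable.const_add
      (Finset.measurable_sum _ fun j _ =>
        (((hg i).comp (measurable_pi_apply j)).const_mul lam).const_sub _) _
  refine (measure_lt_le_of_lintegral_exp_le key hm (c := k * (8 * s ^ 2)) fun ω hω => ?_).trans
    (le_of_eq ?_)
  · obtain ⟨i, hi⟩ := hω
    refine le_trans (eexp_mono ?_) (le_iSup (fun i => eexp (inner ℝ (z i) (0 : H)
      + ∑ j, (∫ y, lam * g i y ∂μ - lam * g i (ω j)))) i)
    rw [inner_zero_right, zero_add]
    simp only [integral_const_mul, ← mul_sub, ← Finset.mul_sum]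
    refine le_trans (le_of_eq ?_) (mul_le_mul_of_nonneg_left hi hlam0)
    rw [hlam]
    field_simp
  · congr 2
    have : 2 * (lam * r) * B = 2 * s := by rw [hlam]; field_simp
    rw [this, smul_zero, norm_zero]
    norm_num
    ring

end Uniform

/-! ### The feature map and the concept distribution -/

section Learning

variable {n : ℕ}

theorem sum_prod_sq_eq_norm_pow (x : EuclideanSpace ℝ (Fin n)) (i : ℕ) :
    ∑ k : Fin i → Fin n, (∏ j, x (k j)) ^ 2 = (‖x‖ ^ 2) ^ i := by
  rw [EuclideanSpace.norm_sq_eq]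
  simp only [Real.norm_eq_abs, sq_abs, ← Finset.prod_pow]
  rw [← Fin.prod_const i (∑ i, x i ^ 2), Finset.prod_univ_sum]
  simp

/-- The monomials of degree `i` contribute `‖x‖^(2i) ≤ 1` before normalization, and there are `d +
1` degrees. -/
theorem norm_featureMap_le (d : ℕ) {x : EuclideanSpace ℝ (Fin n)} (hx : ‖x‖ ≤ 1) :
    ‖featureMap n d x‖ ≤ 1 := by
  have hd : (0 : ℝ) < d + 1 := by positivity
  have h : ‖featureMap n d x‖ ^ 2 ≤ 1 := by
    rw [EuclideanSpace.norm_sq_eq]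
    simp only [featureMap, Real.norm_eq_abs, sq_abs, mul_pow, div_pow, one_pow,
      Real.sq_sqrt hd.le]
    rw [← Finset.mul_sum, Fintype.sum_sigma]
    simp only [sum_prod_sq_eq_norm_pow]
    have h1 : ∑ i : Fin (d + 1), (‖x‖ ^ 2) ^ (i : ℕ) ≤ ∑ _i : Fin (d + 1), (1 : ℝ) :=
      Finset.sum_le_sum fun i _ => pow_le_one₀ (sq_nonneg _) (pow_le_one₀ (norm_nonneg _) hx)
    rw [Finset.sum_const, Finset.card_univ, Fintype.card_fin, nsmul_eq_mul, mul_one] at h1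
    push_cast at h1
    rw [one_div, inv_mul_le_iff₀ hd, mul_one]
    exact h1
  nlinarith [norm_nonneg (featureMap n d x)]

theorem measurable_featureMap (n d : ℕ) : Measurable (featureMap n d) := by
  refine Continuous.measurable ?_
  unfold featureMap
  fun_prop

theorem sum_mul_kernel (d : ℕ) {m : ℕ} (α : Fin m → ℝ) (X : Fin m → EuclideanSpace ℝ (Fin n))
    (x : EuclideanSpace ℝ (Fin n)) :
    ∑ i, α i * kernel n d x (X i)
      = inner ℝ (∑ i, α i • featureMap n d (X i)) (featureMap n d x) := by
  rw [sum_inner]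
  refine Finset.sum_congr rfl fun i _ => ?_
  rw [real_inner_smul_left, kernel, real_inner_comm]

theorem IsActivation.continuous {L : ℝ} (hL : 0 ≤ L) {u : ℝ → ℝ} (hu : IsActivation L u) :
    Continuous u := by
  refine LipschitzWith.continuous (K := L.toNNReal) (LipschitzWith.of_dist_le_mul fun s t => ?_)
  rw [Real.coe_toNNReal _ hL, Real.dist_eq, Real.dist_eq]
  exact hu.lipschitz s t

/-- The feature vector of an example. -/
def feature (d : ℕ) (p : Ball n × Label) : EuclideanSpace ℝ (MonoIdx n d) :=
  featureMap n d (p.1 : EuclideanSpace ℝ (Fin n))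

theorem norm_feature_le (d : ℕ) (p : Ball n × Label) : ‖feature d p‖ ≤ 1 :=
  norm_featureMap_le d (mem_closedBall_zero_iff.1 p.1.2)

theorem measurable_feature (d : ℕ) : Measurable (feature (n := n) d) :=
  (measurable_featureMap n d).comp (measurable_subtype_coe.comp measurable_fst)

theorem abs_sub_le_one_of_mem_Icc {a b : ℝ} (ha : a ∈ Set.Icc (0 : ℝ) 1)
    (hb : b ∈ Set.Icc (0 : ℝ) 1) : |a - b| ≤ 1 := by
  rw [abs_le]
  constructor <;> linarith [ha.1, ha.2, hb.1, hb.2]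

/-- The data of a distribution with `E[y | x] = u(⟨v, ψ_d(x)⟩ + ξ(x))`. -/
structure Concept (n d : ℕ) (B L ζ ε : ℝ) (u : ℝ → ℝ) (D : Measure (Ball n × Label)) where
  v : EuclideanSpace ℝ (MonoIdx n d)
  ξ : Ball n × Label → ℝ
  act : IsActivation L u
  L_pos : 0 < L
  norm_le : ‖v‖ ≤ B
  measurable_ξ : Measurable ξ
  ξ_mem : ∀ p, ξ p ∈ Set.Icc (-ζ) ζ
  integral_le : ∫ p, ξ p ^ 2 ∂D ≤ ε
  condMean_eq : condMean D =ᵐ[D] fun p => u (inner ℝ v (feature d p) + ξ p)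
  ξ_eq : ∃ η : Ball n → ℝ, Measurable η ∧ ξ = fun p => η p.1

theorem IsConceptDistribution.exists_concept {d : ℕ} {B L ζ ε : ℝ} {u : ℝ → ℝ}
    {D : Measure (Ball n × Label)} (h : IsConceptDistribution n d B ζ ε u D) (hL : 0 < L)
    (hu : IsActivation L u) : Nonempty (Concept n d B L ζ ε u D) := by
  obtain ⟨v, ξ, hv, hm, hmem, hint, hc⟩ := h
  exact ⟨{
    v := v
    ξ := fun p => ξ p.1
    act := hu
    L_pos := hL
    norm_le := hv
    measurable_ξ := hm.comp (measurable_subtype_coe.comp measurable_fst)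
    ξ_mem := fun p => hmem _
    integral_le := hint
    condMean_eq := hc
    ξ_eq := ⟨fun x => ξ x, hm.comp measurable_subtype_coe, rfl⟩ }⟩

namespace Concept

variable {d : ℕ} {B L ζ ε : ℝ} {u : ℝ → ℝ} {D : Measure (Ball n × Label)}
  (c : Concept n d B L ζ ε u D)

/-- The conditional mean of the label. -/
def mean (p : Ball n × Label) : ℝ := u (inner ℝ c.v (feature d p) + c.ξ p)

/-- The prediction of the linear hypothesis `w`. -/
def pred (_ : Concept n d B L ζ ε u D) (w : EuclideanSpace ℝ (MonoIdx n d))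
    (p : Ball n × Label) : ℝ := u (inner ℝ w (feature d p))

theorem measurable_u (c : Concept n d B L ζ ε u D) : Measurable u :=
  (c.act.continuous c.L_pos.le).measurable

theorem measurable_mean : Measurable c.mean :=
  c.measurable_u.comp ((measurable_const.inner (measurable_feature d)).add c.measurable_ξ)

theorem measurable_pred (w : EuclideanSpace ℝ (MonoIdx n d)) : Measurable (c.pred w) :=
  c.measurable_u.comp (measurable_const.inner (measurable_feature d))

theorem mean_mem (p : Ball n × Label) : c.mean p ∈ Set.Icc (0 : ℝ) 1 := c.act.mem_Icc _

theorem pred_mem (w : EuclideanSpace ℝ (MonoIdx n d)) (p : Ball n × Label) :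
    c.pred w p ∈ Set.Icc (0 : ℝ) 1 := c.act.mem_Icc _

theorem measurable_label : Measurable fun p : Ball n × Label => (p.2 : ℝ) :=
  measurable_subtype_coe.comp measurable_snd

/-- The error of the linear hypothesis `w`. -/
def err (w : EuclideanSpace ℝ (MonoIdx n d)) : ℝ := ∫ p, (c.pred w p - c.mean p) ^ 2 ∂D

theorem genErr_hypothesis {m : ℕ} (X : Sample n m) (α : Fin m → ℝ) :
    genErr D (hypothesis d u X α) = c.err (∑ i, α i • feature d (X i)) := by
  unfold genErr err
  refine integral_congr_ae ?_
  filter_upwards [c.condMean_eq] with p hp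
  rw [hp, hypothesis, sum_mul_kernel]
  rfl

/-- The excess loss of `w` over the conditional mean. -/
def excess (w : EuclideanSpace ℝ (MonoIdx n d)) (p : Ball n × Label) : ℝ :=
  (c.pred w p - p.2) ^ 2 - (c.mean p - p.2) ^ 2

theorem measurable_excess (w : EuclideanSpace ℝ (MonoIdx n d)) : Measurable (c.excess w) :=
  (((c.measurable_pred w).sub measurable_label).pow_const 2).sub
    ((c.measurable_mean.sub measurable_label).pow_const 2)

/-- A difference of two squares contains the factor `pred - mean`. This bounds the second moment of
the excess by its expectation, which makes the validation bound multiplicative. -/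
theorem abs_excess_le (w : EuclideanSpace ℝ (MonoIdx n d)) (p : Ball n × Label) :
    |c.excess w p| ≤ 2 * |c.pred w p - c.mean p| := by
  have e : c.excess w p = ((c.pred w p - p.2) + (c.mean p - p.2)) * (c.pred w p - c.mean p) := by
    unfold excess; ring
  rw [e, abs_mul]
  refine mul_le_mul_of_nonneg_right ((abs_add_le _ _).trans ?_) (abs_nonneg _)
  linarith [abs_sub_le_one_of_mem_Icc (c.pred_mem w p) p.2.2,
    abs_sub_le_one_of_mem_Icc (c.mean_mem p) p.2.2]

theorem exists_mean_eq : ∃ g : Ball n → ℝ, Measurable g ∧ c.mean = fun p => g p.1 := by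
  obtain ⟨η, hη, h⟩ := c.ξ_eq
  refine ⟨fun x => u (inner ℝ c.v (featureMap n d x) + η x), c.measurable_u.comp
    ((measurable_const.inner ((measurable_featureMap n d).comp measurable_subtype_coe)).add hη), ?_⟩
  funext p
  rw [mean, h]
  rfl

theorem abs_excess_le_two (w : EuclideanSpace ℝ (MonoIdx n d)) (p : Ball n × Label) :
    |c.excess w p| ≤ 2 := by
  linarith [c.abs_excess_le w p, abs_sub_le_one_of_mem_Icc (c.pred_mem w p) (c.mean_mem p)]

/-- The validation sets on which the mean excess loss of `w` deviates from the error of `w`. -/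
def badVal (w : EuclideanSpace ℝ (MonoIdx n d)) (k : ℕ) (τ : ℝ) : Set (Sample n k) :=
  {S | k * (3 / 16 * c.err w) + τ ≤ ∑ j, c.excess w (S j) / 8} ∪
    {S | k * (-(1 / 16) * c.err w) + τ ≤ ∑ j, -(c.excess w (S j) / 8)}

theorem measurableSet_badVal (w : EuclideanSpace ℝ (MonoIdx n d)) (k : ℕ) (τ : ℝ) :
    MeasurableSet (c.badVal w k τ) := by
  have h : Measurable fun S : Sample n k => ∑ j, c.excess w (S j) / 8 :=
    Finset.measurable_sum _ fun j _ =>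
      ((c.measurable_excess w).comp (measurable_pi_apply j)).div_const 8
  have h' : Measurable fun S : Sample n k => ∑ j, -(c.excess w (S j) / 8) :=
    Finset.measurable_sum _ fun j _ =>
      (((c.measurable_excess w).comp (measurable_pi_apply j)).div_const 8).neg
  exact (measurableSet_le measurable_const h).union (measurableSet_le measurable_const h')

variable [IsProbabilityMeasure D]

theorem integrable_sq_sub {f g : Ball n × Label → ℝ} (hf : Measurable f) (hg : Measurable g)
    (hf1 : ∀ p, f p ∈ Set.Icc (0 : ℝ) 1) (hg1 : ∀ p, g p ∈ Set.Icc (0 : ℝ) 1) :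
    Integrable (fun p => (f p - g p) ^ 2) D :=
  integrable_of_abs_le ((hf.sub hg).pow_const 2) (c := 1) fun p => by
    rw [abs_pow]
    exact pow_le_one₀ (abs_nonneg _) (abs_sub_le_one_of_mem_Icc (hf1 p) (hg1 p))

theorem err_le_one (w : EuclideanSpace ℝ (MonoIdx n d)) : c.err w ≤ 1 := by
  have h : c.err w ≤ ∫ _p, (1 : ℝ) ∂D :=
    integral_mono (integrable_sq_sub (c.measurable_pred w) c.measurable_mean (c.pred_mem w)
      c.mean_mem) (integrable_const 1) fun p => by
        have := abs_sub_le_one_of_mem_Icc (c.pred_mem w p) (c.mean_mem p)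
        rw [← sq_abs]
        exact pow_le_one₀ (abs_nonneg _) this
  simpa using h

/-- The residual `y - E[y | x]` is orthogonal to the functions of `x`. -/
theorem integral_mul_residual {f : Ball n → ℝ} (hf : Measurable f) {b : ℝ} (hb : ∀ x, |f x| ≤ b) :
    ∫ p, f p.1 * ((p.2 : ℝ) - c.mean p) ∂D = 0 := by
  have hm : MeasurableSpace.comap (Prod.fst : Ball n × Label → Ball n) inferInstance
      ≤ (inferInstance : MeasurableSpace (Ball n × Label)) := measurable_fst.comap_le
  have hfm : Measurable fun p : Ball n × Label => f p.1 := hf.comp measurable_fst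
  have hint : Integrable (fun p : Ball n × Label => (p.2 : ℝ)) D :=
    integrable_of_abs_le measurable_label (c := 1) fun p => by
      rw [abs_le]; constructor <;> linarith [p.2.2.1, p.2.2.2]
  have hfsm : StronglyMeasurable[MeasurableSpace.comap (Prod.fst : Ball n × Label → Ball n)
      inferInstance] fun p : Ball n × Label => f p.1 :=
    (hf.comp (comap_measurable Prod.fst)).stronglyMeasurable
  have h1 := condExp_stronglyMeasurable_mul_of_bound hm hfsm hint b
    (Filter.Eventually.of_forall fun p => hb p.1)
  have hfi : Integrable (fun p : Ball n × Label => f p.1 * (p.2 : ℝ)) D :=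
    integrable_of_abs_le (hfm.mul measurable_label) (c := b * 1) fun p => by
      rw [abs_mul]
      refine mul_le_mul (hb p.1) ?_ (abs_nonneg _) ((abs_nonneg _).trans (hb p.1))
      rw [abs_le]; constructor <;> linarith [p.2.2.1, p.2.2.2]
  have hmi : Integrable (fun p : Ball n × Label => f p.1 * c.mean p) D :=
    integrable_of_abs_le (hfm.mul c.measurable_mean) (c := b * 1) fun p => by
      rw [abs_mul]
      refine mul_le_mul (hb p.1) ?_ (abs_nonneg _) ((abs_nonneg _).trans (hb p.1))
      rw [abs_le]; constructor <;> linarith [(c.mean_mem p).1, (c.mean_mem p).2]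
  have h2 : ∫ p, f p.1 * (p.2 : ℝ) ∂D = ∫ p, f p.1 * c.mean p ∂D := by
    rw [← integral_condExp hm (f := fun p : Ball n × Label => f p.1 * (p.2 : ℝ))]
    refine integral_congr_ae ?_
    filter_upwards [h1, c.condMean_eq] with p hp hq
    have e : (D[fun p : Ball n × Label => f p.1 * (p.2 : ℝ)|MeasurableSpace.comap
      (Prod.fst : Ball n × Label → Ball n) inferInstance]) p = f p.1 * condMean D p := hp
    rw [e, hq]
    rfl
  simp only [mul_sub]
  rw [integral_sub hfi hmi, h2, sub_self]

/-! ### Deviations on the training set -/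

theorem measure_residual_ge_le (k : ℕ) {η : ℝ} (hη : 0 ≤ η) :
    (Measure.pi fun _ : Fin k => D) {S : Sample n k |
      k * η ≤ ‖∑ i, (((S i).2 : ℝ) - c.mean (S i)) • feature d (S i)‖}
      ≤ ENNReal.ofReal (Real.exp (1 - k * η ^ 2 / 4)) := by
  refine measure_norm_sum_ge_le (X := fun p : Ball n × Label =>
    ((p.2 : ℝ) - c.mean p) • feature d p)
    ((measurable_label.sub c.measurable_mean).smul (measurable_feature d)) (fun p => ?_)
    (fun a => ?_) k hη
  · rw [norm_smul, Real.norm_eq_abs]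
    exact mul_le_one₀ (abs_sub_le_one_of_mem_Icc p.2.2 (c.mean_mem p)) (norm_nonneg _)
      (norm_feature_le d p)
  · have hb : ∀ x : Ball n, |inner ℝ a (featureMap n d x)| ≤ ‖a‖ := fun x => by
      refine (abs_real_inner_le_norm _ _).trans (mul_le_of_le_one_right (norm_nonneg _) ?_)
      exact norm_featureMap_le d (mem_closedBall_zero_iff.1 x.2)
    have h := c.integral_mul_residual (f := fun x => inner ℝ a (featureMap n d x))
      (measurable_const.inner ((measurable_featureMap n d).comp measurable_subtype_coe)) hb
    refine Eq.trans (integral_congr_ae (Filter.Eventually.of_forall fun p => ?_)) h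
    simp only [inner_smul_right]
    rw [mul_comm]
    rfl

/-- `ξ²/ζ²` takes values in `[0,1]`, so its second moment is at most its mean, and the Bernstein
bound applies with `c = 2ε/ζ²`. -/
theorem measure_noise_ge_le (hζ : 0 < ζ) (k : ℕ) (τ : ℝ) :
    (Measure.pi fun _ : Fin k => D) {S : Sample n k |
      k * (2 * ε) + ζ ^ 2 * τ ≤ ∑ i, c.ξ (S i) ^ 2} ≤ ENNReal.ofReal (Real.exp (-τ)) := by
  set f : Ball n × Label → ℝ := fun p => c.ξ p ^ 2 / ζ ^ 2 with hf
  have hfm : Measurable f := (c.measurable_ξ.pow_const 2).div_const _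
  have hζ2 : 0 < ζ ^ 2 := by positivity
  have hf0 : ∀ p, 0 ≤ f p := fun p => by positivity
  have hf1 : ∀ p, f p ≤ 1 := fun p => by
    rw [hf, div_le_one hζ2]
    exact sq_le_sq' (c.ξ_mem p).1 (c.ξ_mem p).2
  have hfa : ∀ p, |f p| ≤ 1 := fun p => by rw [abs_of_nonneg (hf0 p)]; exact hf1 p
  have hint : ∫ p, f p ∂D ≤ ε / ζ ^ 2 := by
    rw [hf, integral_div]
    exact div_le_div_of_nonneg_right c.integral_le hζ2.le
  have hsq : ∫ p, f p ^ 2 ∂D ≤ ∫ p, f p ∂D := by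
    refine integral_mono (integrable_of_abs_le (hfm.pow_const 2) (c := 1) fun p => ?_)
      (integrable_of_abs_le hfm hfa) fun p => ?_
    · rw [abs_pow]; exact pow_le_one₀ (abs_nonneg _) (hfa p)
    · have := mul_le_of_le_one_left (hf0 p) (hf1 p)
      rw [← sq] at this
      exact this
  have h := measure_sum_ge_le (μ := D) hfm hfa (c := 2 * ε / ζ ^ 2)
    (by rw [mul_div_assoc]; linarith) k τ
  refine (measure_mono fun S hS => ?_).trans h
  rw [Set.mem_ofPred_eq] at hS ⊢
  rw [hf, ← Finset.sum_div, le_div_iff₀ hζ2]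
  refine le_trans (le_of_eq ?_) hS
  field_simp

/-- The squared distance of the predictions of `w` and of `v`. -/
def dist2 (w : EuclideanSpace ℝ (MonoIdx n d)) (p : Ball n × Label) : ℝ :=
  (c.pred w p - c.pred c.v p) ^ 2

/-- Measured from `v`, the squared distance vanishes at `w = v` and is `2L`-Lipschitz in `⟨w, ψ⟩`,
because predictions differ by at most `1`. So it is a contraction of `2L⟨w - v, ψ⟩`. -/
theorem measure_exists_dist2_lt_le (hB : 0 < B) (k : ℕ) {s : ℝ} (hs : 0 ≤ s) :
    (Measure.pi fun _ : Fin k => D) {S : Sample n k | ∃ w, ‖w - c.v‖ ≤ B ∧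
      k * (16 * L * B * s) < ∑ j, (∫ p, c.dist2 w p ∂D - c.dist2 w (S j))}
      ≤ ENNReal.ofReal (Real.exp (1 - 4 * (k * s ^ 2))) := by
  have hL := c.L_pos
  set Z : Set (EuclideanSpace ℝ (MonoIdx n d)) := Metric.closedBall 0 B with hZ
  have : Nonempty Z := ⟨⟨0, by simp [hZ, hB.le]⟩⟩
  set z : ℕ → Z := TopologicalSpace.denseSeq Z with hz
  have hpred : ∀ w p, c.pred (c.v + w) p - c.pred c.v p
      = u (inner ℝ c.v (feature d p) + inner ℝ w (feature d p)) - u (inner ℝ c.v (feature d p)) :=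
    fun w p => by rw [pred, pred, inner_add_left]
  have h1 : ∀ w p, |c.pred (c.v + w) p - c.pred c.v p| ≤ 1 := fun w p =>
    abs_sub_le_one_of_mem_Icc (c.pred_mem _ p) (c.pred_mem _ p)
  have hm : ∀ w, Measurable (c.dist2 w) := fun w =>
    ((c.measurable_pred w).sub (c.measurable_pred _)).pow_const 2
  have hdiff : ∀ w w' p, |c.dist2 (c.v + w) p - c.dist2 (c.v + w') p|
      ≤ |(2 * L) * inner ℝ w (feature d p) - (2 * L) * inner ℝ w' (feature d p)| := by
    intro w w' p
    have e : c.dist2 (c.v + w) p - c.dist2 (c.v + w') p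
        = ((c.pred (c.v + w) p - c.pred c.v p) + (c.pred (c.v + w') p - c.pred c.v p))
          * (c.pred (c.v + w) p - c.pred (c.v + w') p) := by
      unfold dist2; ring
    rw [e, abs_mul, ← mul_sub, abs_mul, abs_of_pos (by linarith : 0 < 2 * L)]
    have h2 : |(c.pred (c.v + w) p - c.pred c.v p) + (c.pred (c.v + w') p - c.pred c.v p)| ≤ 2 :=
      (abs_add_le _ _).trans (by linarith [h1 w p, h1 w' p])
    have h3 : |c.pred (c.v + w) p - c.pred (c.v + w') p|
        ≤ L * |inner ℝ w (feature d p) - inner ℝ w' (feature d p)| := by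
      refine (c.act.lipschitz _ _).trans (le_of_eq ?_)
      rw [inner_add_left, inner_add_left, add_sub_add_left_eq_sub]
    calc _ ≤ 2 * (L * |inner ℝ w (feature d p) - inner ℝ w' (feature d p)|) :=
          mul_le_mul h2 h3 (abs_nonneg _) (by norm_num)
      _ = _ := by ring
  have hcontract : ∀ w p, |c.dist2 (c.v + w) p| ≤ |(2 * L) * inner ℝ w (feature d p)| := by
    intro w p
    have h := hdiff w 0 p
    have e : c.dist2 (c.v + 0) p = 0 := by simp [dist2]
    rwa [e, sub_zero, inner_zero_left, mul_zero, sub_zero] at h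
  have key := measure_exists_lt_sum_le (μ := D) hB (by linarith : 0 < 2 * L)
    (z := fun i => (z i : EuclideanSpace ℝ (MonoIdx n d)))
    (fun i => mem_closedBall_zero_iff.1 (z i).2) (measurable_feature d) (norm_feature_le d)
    (g := fun i => c.dist2 (c.v + z i)) (fun i => hm _) (fun i p => hcontract _ p)
    (fun i j p => hdiff _ _ p) k hs
  refine (measure_mono fun S hS => ?_).trans key
  obtain ⟨w, hw, hlt⟩ := hS
  set F : Z → ℝ := fun y => ∑ j, (∫ p, c.dist2 (c.v + y) p ∂D - c.dist2 (c.v + y) (S j)) with hF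
  have hcp : ∀ p, Continuous fun y : Z => c.dist2 (c.v + y) p := fun p => by
    have hu := c.act.continuous c.L_pos.le
    unfold dist2 pred
    fun_prop
  have hcont : Continuous F := by
    refine continuous_finsetSum _ fun j _ => Continuous.sub ?_ (hcp _)
    refine continuous_of_dominated (bound := fun _ => 1)
      (fun y => (hm _).aestronglyMeasurable) (fun y => Filter.Eventually.of_forall fun p => ?_)
      (integrable_const 1) (Filter.Eventually.of_forall fun p => hcp p)
    rw [Real.norm_eq_abs, dist2, abs_pow]
    exact pow_le_one₀ (abs_nonneg _) (h1 _ p)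
  -- The strict inequality is an open condition on `w`, so a violation in the ball forces one in its
  -- countable dense sequence.
  have hopen : IsOpen {y : Z | k * (16 * L * B * s) < F y} := isOpen_lt continuous_const hcont
  have hne : ({y : Z | k * (16 * L * B * s) < F y}).Nonempty :=
    ⟨⟨w - c.v, by simpa [hZ] using hw⟩, by simpa [hF] using hlt⟩
  obtain ⟨i, hi⟩ := (TopologicalSpace.denseRange_denseSeq Z).exists_mem_open hopen hne
  refine ⟨i, ?_⟩
  have hi' : k * (16 * L * B * s) < F (z i) := hi
  refine le_trans (le_of_eq (by ring)) hi'.le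

/-! ### Deviations on the validation set -/

/-- Expanding the square leaves a cross term with the residual, which is orthogonal to all bounded
functions of `x`. -/
theorem integral_excess (w : EuclideanSpace ℝ (MonoIdx n d)) : ∫ p, c.excess w p ∂D = c.err w := by
  obtain ⟨g, hg, hmean⟩ := c.exists_mean_eq
  have hgm : ∀ p, c.mean p = g p.1 := fun p => by rw [hmean]
  have hpm : Measurable fun x : Ball n => u (inner ℝ w (featureMap n d x)) :=
    c.measurable_u.comp (measurable_const.inner
      ((measurable_featureMap n d).comp measurable_subtype_coe))
  have hmem : ∀ x : Ball n, g x ∈ Set.Icc (0 : ℝ) 1 := fun x => by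
    have := c.mean_mem (x, ⟨0, by simp⟩)
    rwa [hgm] at this
  have h0 := c.integral_mul_residual (f := fun x => u (inner ℝ w (featureMap n d x)) - g x)
    (hpm.sub hg) (b := 1) fun x => abs_sub_le_one_of_mem_Icc (c.act.mem_Icc _) (hmem x)
  have e : ∀ p, c.excess w p = (c.pred w p - c.mean p) ^ 2
      + -2 * ((u (inner ℝ w (featureMap n d p.1)) - g p.1) * ((p.2 : ℝ) - c.mean p)) := fun p => by
    rw [← hgm p]
    change _ = _ + -2 * ((c.pred w p - _) * _)
    unfold excess
    ring
  simp only [e]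
  rw [integral_add, integral_const_mul, h0, mul_zero, add_zero, err]
  · exact integrable_sq_sub (c.measurable_pred w) c.measurable_mean (c.pred_mem w) c.mean_mem
  · refine Integrable.const_mul (integrable_of_abs_le
      (((hpm.sub hg).comp measurable_fst).mul (measurable_label.sub c.measurable_mean))
      (c := 1) fun p => ?_) _
    change |(u (inner ℝ w (featureMap n d p.1)) - g p.1) * ((p.2 : ℝ) - c.mean p)| ≤ 1
    rw [abs_mul]
    exact mul_le_one₀ (abs_sub_le_one_of_mem_Icc (c.act.mem_Icc _) (hmem p.1)) (abs_nonneg _)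
      (abs_sub_le_one_of_mem_Icc p.2.2 (c.mean_mem p))

theorem integral_excess_sq_le (w : EuclideanSpace ℝ (MonoIdx n d)) :
    ∫ p, c.excess w p ^ 2 ∂D ≤ 4 * c.err w := by
  rw [err, ← integral_const_mul]
  refine integral_mono (integrable_of_abs_le ((c.measurable_excess w).pow_const 2) (c := 2 ^ 2)
    fun p => ?_) ((integrable_sq_sub (c.measurable_pred w) c.measurable_mean (c.pred_mem w)
      c.mean_mem).const_mul 4) fun p => ?_
  · rw [abs_pow]
    exact pow_le_pow_left₀ (abs_nonneg _) (c.abs_excess_le_two w p) 2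
  · have h := pow_le_pow_left₀ (abs_nonneg _) (c.abs_excess_le w p) 2
    rw [sq_abs, mul_pow, sq_abs] at h
    refine h.trans (le_of_eq ?_)
    norm_num

/-- After division by `8` the excess is bounded by `1`, with mean `err/8` and second moment at most
`err/16`. The two tails thus have the constants `1/8 + 1/16 = 3/16` and `-1/8 + 1/16 = -1/16`. -/
theorem measure_badVal_le (w : EuclideanSpace ℝ (MonoIdx n d)) (k : ℕ) (τ : ℝ) :
    (Measure.pi fun _ : Fin k => D) (c.badVal w k τ)
      ≤ ENNReal.ofReal (2 * Real.exp (-τ)) := by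
  have hm : Measurable fun p => c.excess w p / 8 := (c.measurable_excess w).div_const 8
  have hb : ∀ p, |c.excess w p / 8| ≤ 1 := fun p => by
    rw [abs_div, abs_of_pos (by norm_num : (0 : ℝ) < 8)]
    linarith [c.abs_excess_le_two w p]
  have hsq : ∫ p, (c.excess w p / 8) ^ 2 ∂D ≤ 1 / 16 * c.err w := by
    simp only [div_pow]
    rw [integral_div]
    linarith [c.integral_excess_sq_le w]
  have h1 := measure_sum_ge_le (μ := D) hm hb (c := 3 / 16 * c.err w)
    (by rw [integral_div, integral_excess]; linarith) k τ
  have h2 := measure_sum_ge_le (μ := D) hm.neg (fun p => by simpa using hb p)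
    (c := -(1 / 16) * c.err w) (by
      simp only [Pi.neg_apply, neg_sq]
      rw [integral_neg, integral_div, integral_excess]
      linarith) k τ
  refine (measure_union_le _ _).trans ((add_le_add h1 h2).trans (le_of_eq ?_))
  rw [← ENNReal.ofReal_add (Real.exp_pos _).le (Real.exp_pos _).le, two_mul]

end Concept

end Learning

/-! ### Progress of the iterations -/

section Progress

/-- By monotonicity the product on the right is nonnegative, so the Lipschitz bound can be
multiplied by `|u s - u t|`. This makes the update a descent direction although the squared loss
need not be convex. -/
theorem IsActivation.sq_le_mul {L : ℝ} {u : ℝ → ℝ} (hu : IsActivation L u)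
    (s t : ℝ) : (u s - u t) ^ 2 ≤ L * ((u s - u t) * (s - t)) := by
  have h : 0 ≤ (u s - u t) * (s - t) := by
    rcases le_total s t with h | h
    · exact mul_nonneg_of_nonpos_of_nonpos (sub_nonpos.2 (hu.monotone h)) (sub_nonpos.2 h)
    · exact mul_nonneg (sub_nonneg.2 (hu.monotone h)) (sub_nonneg.2 h)
  calc (u s - u t) ^ 2 = |u s - u t| * |u s - u t| := by rw [← sq, sq_abs]
    _ ≤ |u s - u t| * (L * |s - t|) :=
        mul_le_mul_of_nonneg_left (hu.lipschitz s t) (abs_nonneg _)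
    _ = L * |(u s - u t) * (s - t)| := by rw [abs_mul]; ring
    _ = _ := by rw [abs_of_nonneg h]

variable {H : Type*} [NormedAddCommGroup H] [InnerProductSpace ℝ H]

theorem norm_sum_smul_sq_le {m : ℕ} (g : Fin m → ℝ) {ψ : Fin m → H} (hψ : ∀ i, ‖ψ i‖ ≤ 1) :
    ‖∑ i, g i • ψ i‖ ^ 2 ≤ m * ∑ i, g i ^ 2 := by
  have h1 : ‖∑ i, g i • ψ i‖ ≤ ∑ i, |g i| := by
    refine (norm_sum_le _ _).trans (Finset.sum_le_sum fun i _ => ?_)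
    rw [norm_smul, Real.norm_eq_abs]
    exact mul_le_of_le_one_right (abs_nonneg _) (hψ i)
  have h2 := sq_sum_le_card_mul_sum_sq (s := Finset.univ) (f := fun i => |g i|)
  simp only [sq_abs, Finset.card_univ, Fintype.card_fin] at h2
  exact (pow_le_pow_left₀ (norm_nonneg _) h1 2).trans h2

/-- The update splits into the residual part `N`, which is small by assumption, and the signal `F`.
`F` has inner product about `-E/L` with `w - v`, and its own square is at most `m E`; so with rate
`1/L` the descent wins as soon as `E` exceeds the threshold. -/
theorem norm_step_sub_sq_le {m : ℕ} [NeZero m] {L B e η ρ : ℝ} (hL : 0 < L)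
    (hη : 0 ≤ η) {u : ℝ → ℝ} (hu : IsActivation L u) {v w w' : H} {ψ : Fin m → H}
    (hψ : ∀ i, ‖ψ i‖ ≤ 1) {y ξ r : Fin m → ℝ} (hr : ∀ i, |r i - inner ℝ w (ψ i)| ≤ e)
    (hN : ‖∑ i, (y i - u (inner ℝ v (ψ i) + ξ i)) • ψ i‖ ≤ m * η) (hw : ‖w - v‖ ≤ B)
    (hρ : ∑ i, ξ i ^ 2 ≤ m * ρ)
    (hw' : w' = w + (1 / (L * m)) • ∑ i, (y i - u (r i)) • ψ i)
    (hE : m * (11 * (L ^ 2 * ρ) + 11 * (L ^ 2 * e ^ 2) + 11 * (L * η * B) + 24 * η ^ 2)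
      < ∑ i, (u (inner ℝ v (ψ i) + ξ i) - u (r i)) ^ 2) :
    ‖w' - v‖ ^ 2 ≤ ‖w - v‖ ^ 2 - 2 * η * B / L := by
  have hm : (0 : ℝ) < m := Nat.cast_pos.2 (Nat.pos_of_ne_zero (NeZero.ne m))
  have hB : 0 ≤ B := (norm_nonneg _).trans hw
  set c : Fin m → ℝ := fun i => u (inner ℝ v (ψ i) + ξ i) with hc
  set E := ∑ i, (c i - u (r i)) ^ 2 with hEdef
  set N := ∑ i, (y i - c i) • ψ i with hNdef
  set F := ∑ i, (c i - u (r i)) • ψ i with hF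
  have hG : ∑ i, (y i - u (r i)) • ψ i = N + F := by
    rw [hNdef, hF, ← Finset.sum_add_distrib]
    refine Finset.sum_congr rfl fun i _ => ?_
    rw [← add_smul, sub_add_sub_cancel]
  have hFF : ‖F‖ ^ 2 ≤ m * E := norm_sum_smul_sq_le _ hψ
  have hNN : ‖N‖ ^ 2 ≤ (m * η) ^ 2 := pow_le_pow_left₀ (norm_nonneg _) hN 2
  -- The weight `9/8` on `F` is less than the gain `3/2` in `hwF`, so that `3/8` of `E` is left
  -- over.
  have hGG : ‖N + F‖ ^ 2 ≤ 9 * (m * η) ^ 2 + 9 / 8 * (m * E) := by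
    have h1 := norm_add_le N F
    have h2 : ‖N + F‖ ^ 2 ≤ (‖N‖ + ‖F‖) ^ 2 := pow_le_pow_left₀ (norm_nonneg _) h1 2
    nlinarith [sq_nonneg (8 * ‖N‖ - ‖F‖)]
  have hwN : inner ℝ (w - v) N ≤ B * (m * η) :=
    (real_inner_le_norm _ _).trans (mul_le_mul hw hN (norm_nonneg _) hB)
  have hwF : 2 * L * inner ℝ (w - v) F ≤ -(3 / 2) * E + 4 * L ^ 2 * (m * ρ)
      + 4 * L ^ 2 * (m * e ^ 2) := by
    -- Of the gain `2a²`, two quarters are spent on the cross terms with the noise `ξ i` and with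
    -- the estimation error `k`.
    have hsum : ∀ i, 2 * L * ((c i - u (r i)) * inner ℝ (w - v) (ψ i))
        ≤ -(3 / 2) * (c i - u (r i)) ^ 2 + 4 * L ^ 2 * ξ i ^ 2 + 4 * L ^ 2 * e ^ 2 := by
      intro i
      have h1 := hu.sq_le_mul (inner ℝ v (ψ i) + ξ i) (r i)
      have h2 := hr i
      rw [inner_sub_left]
      set a := c i - u (r i) with ha
      set k := inner ℝ w (ψ i) - r i with hk
      have hk2 : k ^ 2 ≤ e ^ 2 := by
        rw [hk]
        exact sq_le_sq' (by linarith [(abs_le.1 h2).2]) (by linarith [(abs_le.1 h2).1])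
      have h1' : a ^ 2 ≤ L * (a * (inner ℝ v (ψ i) + ξ i - r i)) := h1
      have e1 : inner ℝ w (ψ i) - inner ℝ v (ψ i)
          = ξ i + k - (inner ℝ v (ψ i) + ξ i - r i) := by rw [hk]; ring
      rw [e1]
      nlinarith [sq_nonneg (a - 4 * (L * ξ i)), sq_nonneg (a - 4 * (L * k)),
        mul_le_mul_of_nonneg_left hk2 (sq_nonneg L)]
    have h := Finset.sum_le_sum fun i (_ : i ∈ Finset.univ) => hsum i
    rw [hF, inner_sum, Finset.mul_sum]
    simp only [inner_smul_right]
    refine h.trans ?_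
    rw [Finset.sum_add_distrib, Finset.sum_add_distrib, ← Finset.mul_sum, ← Finset.mul_sum,
      Finset.sum_const, Finset.card_univ, Fintype.card_fin, nsmul_eq_mul, ← hEdef]
    linarith [mul_le_mul_of_nonneg_left hρ (sq_nonneg L)]
  have hexp : ‖w' - v‖ ^ 2 = ‖w - v‖ ^ 2
      + (m * (2 * L * inner ℝ (w - v) N + 2 * L * inner ℝ (w - v) F) + ‖N + F‖ ^ 2)
        / (L * m) ^ 2 := by
    rw [hw', hG, add_sub_right_comm, norm_add_sq_real, norm_smul, inner_smul_right,
      inner_add_right, mul_pow, Real.norm_eq_abs, sq_abs]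
    field_simp
    ring
  have hLm : 0 < (L * m) ^ 2 := by positivity
  have hmain : m * (2 * L * inner ℝ (w - v) N + 2 * L * inner ℝ (w - v) F) + ‖N + F‖ ^ 2
      ≤ -(2 * η * B / L) * (L * m) ^ 2 := by
    have e2 : -(2 * η * B / L) * (L * m) ^ 2 = m * (m * (-(2 * (L * η * B)))) := by
      field_simp
    rw [e2]
    have h3 : 2 * L * inner ℝ (w - v) N ≤ m * (2 * (L * η * B)) := by
      nlinarith [mul_le_mul_of_nonneg_left hwN hL.le]
    -- It remains that `3/8 * E` covers the terms with constants `4`, `4`, `4` and `9`; multiplied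
    -- by `8/3` these are at most `11`, `11`, `11` and `24`.
    have h4 : 2 * L * inner ℝ (w - v) N + 2 * L * inner ℝ (w - v) F
        + (9 * (m * η ^ 2) + 9 / 8 * E) ≤ m * (-(2 * (L * η * B))) := by
      have h5 : 0 ≤ m * (L * η * B) := by positivity
      have h6 : 0 ≤ m * η ^ 2 := by positivity
      have h7 : 0 ≤ m * (L ^ 2 * e ^ 2) := by positivity
      have h8 : 0 ≤ m * (L ^ 2 * ρ) := by
        have h9 : 0 ≤ ∑ i, ξ i ^ 2 := Finset.sum_nonneg fun i _ => sq_nonneg _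
        rw [mul_left_comm]
        exact mul_nonneg (sq_nonneg L) (h9.trans hρ)
      linarith
    have h10 := mul_le_mul_of_nonneg_left h4 hm.le
    linarith
  rw [hexp]
  linarith [(div_le_iff₀ hLm).2 hmain]

/-- Otherwise `T` successive decreases by `κ` would make `f` negative. The bound `f t ≤ B` is
carried along, since a decrease is only guaranteed under it. -/
theorem exists_lt_of_descent {T : ℕ} {B κ : ℝ} {f : ℕ → ℝ} {Q : ℕ → Prop} (hf : ∀ t, 0 ≤ f t)
    (h0 : f 0 ≤ B) (hκ : 0 ≤ κ) (hT : B < T * κ)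
    (hstep : ∀ t < T, f t ≤ B → ¬Q t → f (t + 1) ≤ f t - κ) : ∃ t < T, f t ≤ B ∧ Q t := by
  by_contra! hcon
  have h : ∀ t ≤ T, f t ≤ B - t * κ := by
    intro t
    induction t with
    | zero => intro _; simpa using h0
    | succ t ih =>
      intro ht
      have h1 := ih (by omega)
      have h2 : f t ≤ B := h1.trans (by
        have : 0 ≤ (t : ℝ) * κ := by positivity
        linarith)
      have h3 := hstep t (by omega) h2 (hcon t (by omega) h2)
      push_cast
      linarith
  linarith [h T le_rfl, hf T]

end Progress

/-! ### Convergence on good training sets and comparison on good validation sets -/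

namespace Concept

variable {n d : ℕ} {B L ζ ε : ℝ} {u : ℝ → ℝ} {D : Measure (Ball n × Label)}
  (c : Concept n d B L ζ ε u D)

theorem sum_mul_K {m₁ m₂ : ℕ} (S : Sample n m₁ × Sample n m₂) (α : Fin m₁ → ℝ) (j : Fin m₁) :
    ∑ i, α i * (inputOf d u S).K j i
      = inner ℝ (∑ i, α i • feature d (S.1 i)) (feature d (S.1 j)) :=
  sum_mul_kernel d α _ _

theorem sum_mul_Kval {m₁ m₂ : ℕ} (S : Sample n m₁ × Sample n m₂) (α : Fin m₁ → ℝ) (j : Fin m₂) :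
    ∑ i, α i * (inputOf d u S).Kval j i
      = inner ℝ (∑ i, α i • feature d (S.1 i)) (feature d (S.2 j)) :=
  sum_mul_kernel d α _ _

/-- The training sets with the deviation bounds that the convergence proof needs. -/
structure IsGood {m : ℕ} (a : ℝ) (S : Sample n m) : Prop where
  residual_le : ‖∑ i, (((S i).2 : ℝ) - c.mean (S i)) • feature d (S i)‖ ≤ m * (4 * Real.sqrt a)
  noise_le : ∑ i, c.ξ (S i) ^ 2 ≤ m * (2 * ε + 2 * (ζ ^ 2 * a))
  dist2_le : ∀ w, ‖w - c.v‖ ≤ B →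
    ∑ j, (∫ p, c.dist2 w p ∂D - c.dist2 w (S j)) ≤ m * (16 * L * B * Real.sqrt a)

/-- The path from `u⟨w, ψ⟩` to `u⟨v, ψ⟩` passes through `u r` and the conditional mean, and `(x + y
+ z)² ≤ 3(x² + y² + z²)`. -/
theorem dist2_le_of_abs_sub_le {w : EuclideanSpace ℝ (MonoIdx n d)} {r e : ℝ}
    {p : Ball n × Label} (hr : |r - inner ℝ w (feature d p)| ≤ e) :
    c.dist2 w p ≤ 3 * (L ^ 2 * e ^ 2) + 3 * (c.mean p - u r) ^ 2 + 3 * (L ^ 2 * c.ξ p ^ 2) := by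
  have h1 : (c.pred w p - u r) ^ 2 ≤ L ^ 2 * e ^ 2 := by
    rw [← mul_pow, ← sq_abs]
    refine pow_le_pow_left₀ (abs_nonneg _) ((c.act.lipschitz _ _).trans ?_) 2
    rw [abs_sub_comm]
    exact mul_le_mul_of_nonneg_left hr c.L_pos.le
  have h2 : (c.mean p - c.pred c.v p) ^ 2 ≤ L ^ 2 * c.ξ p ^ 2 := by
    rw [← mul_pow, ← sq_abs, ← sq_abs (L * c.ξ p), abs_mul, abs_of_pos c.L_pos]
    refine pow_le_pow_left₀ (abs_nonneg _) ((c.act.lipschitz _ _).trans (le_of_eq ?_)) 2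
    rw [add_sub_cancel_left]
  have e1 : c.dist2 w p = ((c.pred w p - u r) + (u r - c.mean p)
      + (c.mean p - c.pred c.v p)) ^ 2 := by unfold dist2; ring
  rw [e1]
  nlinarith [sq_nonneg ((c.pred w p - u r) - (u r - c.mean p)),
    sq_nonneg ((c.pred w p - u r) - (c.mean p - c.pred c.v p)),
    sq_nonneg ((u r - c.mean p) - (c.mean p - c.pred c.v p))]

/-- The validation step selects an iterate whose error is comparable to the best error. -/
theorem err_le_of_valError_le {m : ℕ} {e τ : ℝ} {V : Sample n m}
    {w w' : EuclideanSpace ℝ (MonoIdx n d)} {s s' : Fin m → ℝ}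
    (hs : ∀ j, |s j - inner ℝ w (feature d (V j))| ≤ e)
    (hs' : ∀ j, |s' j - inner ℝ w' (feature d (V j))| ≤ e)
    (hw : V ∉ c.badVal w m τ) (hw' : V ∉ c.badVal w' m τ)
    (h : ∑ j, (u (s j) - (V j).2) ^ 2 ≤ ∑ j, (u (s' j) - (V j).2) ^ 2) :
    m * c.err w ≤ m * (3 * c.err w' + 8 * (L * e)) + 32 * τ := by
  have hdiff : ∀ (w : EuclideanSpace ℝ (MonoIdx n d)) (s : ℝ) (p : Ball n × Label),
      |s - inner ℝ w (feature d p)| ≤ e →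
      |(c.pred w p - p.2) ^ 2 - (u s - p.2) ^ 2| ≤ 2 * (L * e) := by
    intro w s p hs
    have e1 : (c.pred w p - p.2) ^ 2 - (u s - p.2) ^ 2
        = ((c.pred w p - p.2) + (u s - p.2)) * (c.pred w p - u s) := by ring
    rw [e1, abs_mul]
    refine mul_le_mul ((abs_add_le _ _).trans ?_) ((c.act.lipschitz _ _).trans ?_)
      (abs_nonneg _) (by norm_num)
    · linarith [abs_sub_le_one_of_mem_Icc (c.pred_mem w p) p.2.2,
        abs_sub_le_one_of_mem_Icc (c.act.mem_Icc s) p.2.2]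
    · rw [abs_sub_comm]
      exact mul_le_mul_of_nonneg_left hs c.L_pos.le
  simp only [badVal, Set.mem_union, Set.mem_ofPred_eq, not_or, not_le] at hw hw'
  have h1 := hw.2
  have h2 := hw'.1
  rw [Finset.sum_neg_distrib, ← Finset.sum_div] at h1
  rw [← Finset.sum_div] at h2
  -- The loss of the conditional mean cancels between two hypotheses, so comparing losses compares
  -- excesses; each inexact prediction costs `2Le`.
  have h3 : ∑ j, c.excess w (V j)
      ≤ ∑ j, (c.excess w' (V j) + 4 * (L * e) + ((u (s j) - (V j).2) ^ 2 -
        (u (s' j) - (V j).2) ^ 2)) := by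
    refine Finset.sum_le_sum fun j _ => ?_
    have a1 := (abs_le.1 (hdiff w (s j) (V j) (hs j))).2
    have a2 := (abs_le.1 (hdiff w' (s' j) (V j) (hs' j))).1
    unfold excess
    linarith
  rw [Finset.sum_add_distrib, Finset.sum_add_distrib, Finset.sum_sub_distrib, Finset.sum_const,
    Finset.card_univ, Fintype.card_fin, nsmul_eq_mul] at h3
  linarith

variable [IsProbabilityMeasure D]

theorem err_le_dist2 (w : EuclideanSpace ℝ (MonoIdx n d)) :
    c.err w ≤ 2 * ∫ p, c.dist2 w p ∂D + 2 * (L ^ 2 * ε) := by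
  have hξ : Integrable (fun p => c.ξ p ^ 2) D :=
    integrable_of_abs_le (c.measurable_ξ.pow_const 2) (c := ζ ^ 2) fun p => by
      rw [abs_of_nonneg (sq_nonneg _)]
      exact sq_le_sq' (c.ξ_mem p).1 (c.ξ_mem p).2
  have hd : Integrable (c.dist2 w) D :=
    integrable_sq_sub (c.measurable_pred w) (c.measurable_pred _) (c.pred_mem w) (c.pred_mem _)
  have h : c.err w ≤ ∫ p, (2 * c.dist2 w p + 2 * (L ^ 2 * c.ξ p ^ 2)) ∂D := by
    refine integral_mono (integrable_sq_sub (c.measurable_pred w) c.measurable_mean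
      (c.pred_mem w) c.mean_mem) ((hd.const_mul 2).add ((hξ.const_mul _).const_mul 2)) fun p => ?_
    have h2 : (c.pred c.v p - c.mean p) ^ 2 ≤ L ^ 2 * c.ξ p ^ 2 := by
      rw [← mul_pow, ← sq_abs, ← sq_abs (L * c.ξ p), abs_mul, abs_of_pos c.L_pos]
      refine pow_le_pow_left₀ (abs_nonneg _) ((c.act.lipschitz _ _).trans (le_of_eq ?_)) 2
      rw [sub_add_cancel_left, abs_neg]
    have e1 : (c.pred w p - c.mean p) ^ 2
        = ((c.pred w p - c.pred c.v p) + (c.pred c.v p - c.mean p)) ^ 2 := by ring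
    change (c.pred w p - c.mean p) ^ 2 ≤ 2 * (c.pred w p - c.pred c.v p) ^ 2 + _
    rw [e1]
    nlinarith [sq_nonneg ((c.pred w p - c.pred c.v p) - (c.pred c.v p - c.mean p))]
  rw [integral_add (hd.const_mul 2) ((hξ.const_mul _).const_mul 2), integral_const_mul,
    integral_const_mul, integral_const_mul] at h
  have := mul_le_mul_of_nonneg_left c.integral_le (sq_nonneg L)
  linarith

/-- On a good training set, one of the iterates has a small error. -/
theorem exists_err_le {m T : ℕ} [NeZero m] {a e : ℝ} (ha : 0 < a) (hB : 0 < B)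
    (hT : B * L ≤ T * Real.sqrt a) {S : Sample n m} (hS : c.IsGood a S)
    {A : ℕ → Fin m → ℝ} (hA0 : A 0 = 0)
    (hA : ∀ t < T, ∀ j, ∃ r,
      |r - inner ℝ (∑ i, A t i • feature d (S i)) (feature d (S j))| ≤ e ∧
      A (t + 1) j = A t j + 1 / L / m * ((S j).2 - u r)) :
    ∃ t < T, c.err (∑ i, A t i • feature d (S i)) ≤ 72 * (L ^ 2 * e ^ 2) + 146 * (L ^ 2 * ε)
      + 144 * (L ^ 2 * (ζ ^ 2 * a)) + 296 * (L * B * Real.sqrt a) + 2304 * a := by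
  have hL := c.L_pos
  have hm : (0 : ℝ) < m := Nat.cast_pos.2 (Nat.pos_of_ne_zero (NeZero.ne m))
  have hsa : 0 < Real.sqrt a := Real.sqrt_pos.2 ha
  have hsq : Real.sqrt a ^ 2 = a := Real.sq_sqrt ha.le
  choose! r hr hstep using hA
  set w : ℕ → EuclideanSpace ℝ (MonoIdx n d) := fun t => ∑ i, A t i • feature d (S i) with hw
  set ρ := 2 * ε + 2 * (ζ ^ 2 * a) with hρ
  set η := 4 * Real.sqrt a with hη
  set X := 11 * (L ^ 2 * ρ) + 11 * (L ^ 2 * e ^ 2) + 11 * (L * η * B) + 24 * η ^ 2 with hX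
  -- The potential is `‖w t - v‖²`, at most `B²` at the start. With `η = 4√a` the total decrease
  -- would be `8B T√a / L ≥ 8B²`.
  obtain ⟨t, ht, hwt, hEt⟩ := exists_lt_of_descent (T := T) (B := B ^ 2) (κ := 2 * η * B / L)
    (f := fun t => ‖w t - c.v‖ ^ 2)
    (Q := fun t => ∑ i, (u (inner ℝ c.v (feature d (S i)) + c.ξ (S i)) - u (r t i)) ^ 2 ≤ m * X)
    (fun t => sq_nonneg _)
    (by
      have : w 0 = 0 := by simp [hw, hA0]
      rw [this, zero_sub, norm_neg]
      exact pow_le_pow_left₀ (norm_nonneg _) c.norm_le 2)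
    (by positivity)
    (by
      have h1 : (T : ℝ) * (2 * η * B / L) = 8 * B * (T * Real.sqrt a) / L := by rw [hη]; ring
      rw [h1, lt_div_iff₀ hL]
      have h2 : 0 < B * (B * L) := by positivity
      nlinarith [mul_le_mul_of_nonneg_left hT hB.le])
    (fun t ht hB' hQ => norm_step_sub_sq_le (y := fun i => ((S i).2 : ℝ)) hL (by positivity)
      c.act (fun i => norm_feature_le d (S i)) (hr t ht) hS.residual_le
      (abs_le_of_sq_le_sq' hB' hB.le).2 hS.noise_le (by
        rw [Finset.smul_sum, hw, ← Finset.sum_add_distrib]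
        refine Finset.sum_congr rfl fun i _ => ?_
        rw [hstep t ht i, add_smul, smul_smul]
        congr 2
        field_simp) (not_le.1 hQ))
  refine ⟨t, ht, ?_⟩
  have hwB : ‖w t - c.v‖ ≤ B := (abs_le_of_sq_le_sq' hwt hB.le).2
  have h1 := hS.dist2_le (w t) hwB
  rw [Finset.sum_sub_distrib, Finset.sum_const, Finset.card_univ, Fintype.card_fin,
    nsmul_eq_mul] at h1
  have h2 : ∑ j, c.dist2 (w t) (S j)
      ≤ ∑ j, (3 * (L ^ 2 * e ^ 2) + 3 * (c.mean (S j) - u (r t j)) ^ 2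
        + 3 * (L ^ 2 * c.ξ (S j) ^ 2)) :=
    Finset.sum_le_sum fun j _ => c.dist2_le_of_abs_sub_le (hr t ht j)
  simp only [Finset.sum_add_distrib, ← Finset.mul_sum, Finset.sum_const, Finset.card_univ,
    Fintype.card_fin, nsmul_eq_mul] at h2
  have h3 : ∑ j, (c.mean (S j) - u (r t j)) ^ 2 ≤ m * X := hEt
  have h4 := mul_le_mul_of_nonneg_left hS.noise_le (sq_nonneg L)
  have h5 : (m : ℝ) * ∫ p, c.dist2 (w t) p ∂D
      ≤ m * (3 * (L ^ 2 * e ^ 2) + 3 * X + 3 * (L ^ 2 * ρ) + 16 * L * B * Real.sqrt a) := by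
    linarith
  have h6 := le_of_mul_le_mul_left h5 hm
  refine (c.err_le_dist2 (w t)).trans ?_
  have h7 : η ^ 2 = 16 * a := by rw [hη, mul_pow, hsq]; norm_num
  rw [hX, h7, hη, hρ] at h6
  linarith

end Concept

/-! ### The probability of failure -/

theorem Prog.fail_and_le {m₁ m₂ : ℕ} {I : Input m₁ m₂} {α : Type} (p : Prog m₁ m₂ α)
    (Q R : α → Prop) : p.fail I (fun a => Q a ∧ R a) ≤ p.fail I Q + p.fail I R := by
  unfold Prog.fail
  rw [← Prog.ev_add_const]
  refine p.ev_mono fun a => ?_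
  by_cases hQ : Q a <;> by_cases hR : R a <;> simp [Set.indicator, hQ, hR]

theorem failureProb_le_one {n d m₁ m₂ : ℕ} [NeZero m₁] {u : ℝ → ℝ} {P : Params}
    {D : Measure (Ball n × Label)} [IsProbabilityMeasure D] {b : ℝ} :
    failureProb d m₁ m₂ u P D b ≤ 1 := by
  have : IsProbabilityMeasure (dataLaw D m₁ m₂) := by unfold dataLaw; infer_instance
  refine (lintegral_mono (g := fun _ => 1) fun S => ?_).trans (by simp)
  refine ((outcome d u P S).toOuterMeasure.mono (Set.subset_univ _)).trans (le_of_eq ?_)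
  exact (PMF.toOuterMeasure_apply_eq_one_iff _ _).2 (Set.subset_univ _)

theorem failureProb_anti {n d m₁ m₂ : ℕ} [NeZero m₁] {u : ℝ → ℝ} {P : Params}
    {D : Measure (Ball n × Label)} {b b' : ℝ} (h : b ≤ b') :
    failureProb d m₁ m₂ u P D b' ≤ failureProb d m₁ m₂ u P D b :=
  lintegral_mono fun S => (outcome d u P S).toOuterMeasure.mono fun _ ho => lt_of_le_of_lt h ho

namespace Concept

variable {n d : ℕ} {B L ζ ε : ℝ} {u : ℝ → ℝ} {D : Measure (Ball n × Label)}
  (c : Concept n d B L ζ ε u D)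

/-- The linear hypothesis with coefficients `α` over a training set. -/
def weight (d : ℕ) {m : ℕ} (X : Sample n m) (α : Fin m → ℝ) : EuclideanSpace ℝ (MonoIdx n d) :=
  ∑ i, α i • feature d (X i)

theorem toOuterMeasure_outcome {m₁ m₂ : ℕ} [NeZero m₁] (P : Params) (b : ℝ)
    (S : Sample n m₁ × Sample n m₂) :
    (outcome d u P S).toOuterMeasure {o | b < genErr D (hypothesis d u S.1 o.1)}
      = (alphatronSampling m₁ m₂ P).fail (inputOf d u S) fun α => c.err (weight d S.1 α) ≤ b := by
  unfold outcome Prog.fail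
  rw [← Prog.toOuterMeasure_run]
  congr 1
  ext o
  simp only [Set.mem_ofPred_eq, not_le, c.genErr_hypothesis]
  rfl

/-- The part of the input that belongs to the training set. -/
def trainInput (d : ℕ) (u : ℝ → ℝ) {m₁ : ℕ} (m₂ : ℕ) (X : Sample n m₁) : Input m₁ m₂ where
  y i := ((X i).2 : ℝ)
  b _ := 0
  u := u
  K j i := kernel n d ((X j).1 : EuclideanSpace ℝ (Fin n)) (X i).1
  Kval _ _ := 0

/-- The indicator of the validation sets that are bad for one of the hypotheses in a list. -/
def badList {m₁ m₂ : ℕ} (τ : ℝ) (X : Sample n m₁) (V : Sample n m₂) (l : List (Fin m₁ → ℝ)) :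
    ℝ≥0∞ := {l : List (Fin m₁ → ℝ) | ∃ α ∈ l, V ∈ c.badVal (weight d X α) m₂ τ}.indicator
      (fun _ => 1) l

theorem badList_of_exists {m₁ m₂ : ℕ} {τ : ℝ} {X : Sample n m₁} {V : Sample n m₂}
    {l : List (Fin m₁ → ℝ)} (h : ∃ α ∈ l, V ∈ c.badVal (weight d X α) m₂ τ) :
    c.badList τ X V l = 1 := by
  rw [badList, Set.indicator_of_mem]
  exact h

theorem badList_of_forall {m₁ m₂ : ℕ} {τ : ℝ} {X : Sample n m₁} {V : Sample n m₂}
    {l : List (Fin m₁ → ℝ)} (h : ¬∃ α ∈ l, V ∈ c.badVal (weight d X α) m₂ τ) :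
    c.badList τ X V l = 0 := by
  rw [badList, Set.indicator_of_notMem]
  exact h

theorem measurable_badList {m₁ m₂ : ℕ} (τ : ℝ) (X : Sample n m₁) (l : List (Fin m₁ → ℝ)) :
    Measurable fun V : Sample n m₂ => c.badList τ X V l := by
  have h : MeasurableSet {V : Sample n m₂ | ∃ α ∈ l, V ∈ c.badVal (weight d X α) m₂ τ} := by
    have e : {V : Sample n m₂ | ∃ α ∈ l, V ∈ c.badVal (weight d X α) m₂ τ}
        = ⋃ α ∈ {α | α ∈ l}, c.badVal (weight d X α) m₂ τ := by ext V; simp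
    rw [e]
    exact MeasurableSet.biUnion (List.finite_toSet l).countable
      fun α _ => c.measurableSet_badVal _ _ _
  exact measurable_const.indicator (f := fun _ => (1 : ℝ≥0∞)) h

variable [IsProbabilityMeasure D]

theorem lintegral_badList_le {m₁ m₂ : ℕ} (τ : ℝ) (X : Sample n m₁) (l : List (Fin m₁ → ℝ)) :
    ∫⁻ V, c.badList τ X V l ∂(Measure.pi fun _ : Fin m₂ => D)
      ≤ l.length * ENNReal.ofReal (2 * Real.exp (-τ)) := by
  induction l with
  | nil => simp [badList]
  | cons α l ih =>
    have h : ∀ V : Sample n m₂, c.badList τ X V (α :: l)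
        ≤ (c.badVal (weight d X α) m₂ τ).indicator (fun _ => 1) V + c.badList τ X V l := by
      intro V
      by_cases h1 : V ∈ c.badVal (weight d X α) m₂ τ
      · simp only [Set.indicator_of_mem h1]
        exact le_add_right (Set.indicator_le_self' (fun _ _ => zero_le) _)
      · rw [Set.indicator_of_notMem h1, zero_add]
        have h2 : (∃ a ∈ α :: l, V ∈ c.badVal (weight d X a) m₂ τ)
            → ∃ a ∈ l, V ∈ c.badVal (weight d X a) m₂ τ := fun h =>
          ((List.exists_mem_cons_iff _ _ _).1 h).resolve_left h1
        by_cases h3 : ∃ a ∈ α :: l, V ∈ c.badVal (weight d X a) m₂ τ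
        · rw [c.badList_of_exists h3, c.badList_of_exists (h2 h3)]
        · rw [c.badList_of_forall h3]
          exact zero_le
    refine (lintegral_mono h).trans ?_
    rw [lintegral_add_right _ (c.measurable_badList τ X l),
      lintegral_indicator_const (c.measurableSet_badVal _ _ _), one_mul]
    refine (add_le_add (c.measure_badVal_le _ _ _) ih).trans (le_of_eq ?_)
    rw [List.length_cons, Nat.cast_succ]
    ring

/-- For a fixed training set the iterates are generated without the validation data, so the integral
over the validation set moves inside the program. There the list of hypotheses is fixed, and a union
bound over its `k` entries applies. -/
theorem lintegral_ev_badList_le {m₁ m₂ : ℕ} [NeZero m₁] (τ : ℝ) (P : Params) (k : ℕ) :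
    ∫⁻ S, (trainIterations P k fun _ => 0).ev (trainInput d u m₂ S.1) (c.badList τ S.1 S.2)
      ∂(dataLaw D m₁ m₂) ≤ k * ENNReal.ofReal (2 * Real.exp (-τ)) := by
  -- This half of Tonelli's theorem needs no measurability of the integrand.
  refine (lintegral_prod_le _).trans ?_
  refine (lintegral_mono (g := fun _ => k * ENNReal.ofReal (2 * Real.exp (-τ)))
    fun X => ?_).trans (by simp)
  simp only
  rw [(measurable_ev_and_lintegral_ev _ _ fun l => c.measurable_badList τ X l).2]
  refine (Prog.ev_mono_of_sat (g := fun _ => k * ENNReal.ofReal (2 * Real.exp (-τ)))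
    ((costs_trainIterations_length P k _).mono fun l _ hl => ?_)).trans (Prog.ev_const _ _).le
  rw [← hl]
  exact c.lintegral_badList_le τ X l

/-- The constants in `IsGood` make each of its three conditions fail with probability at most `δ/3`:
the tails are `e δ⁴`, `δ²` and `e δ⁴`, and `δ < 1/3`. -/
theorem measure_not_isGood_le (hB : 0 < B) (hζ : 0 < ζ) {m : ℕ} [NeZero m] {δ : ℝ} (hδ : 0 < δ)
    (hδ3 : δ < 1 / 3) :
    (Measure.pi fun _ : Fin m => D) {S | ¬c.IsGood (Real.log (1 / δ) / m) S}
      ≤ ENNReal.ofReal δ := by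
  have hm : (0 : ℝ) < m := Nat.cast_pos.2 (Nat.pos_of_ne_zero (NeZero.ne m))
  set ℓ := Real.log (1 / δ) with hℓ
  have hexp : Real.exp (-ℓ) = δ := by
    rw [hℓ, one_div, Real.log_inv, neg_neg, Real.exp_log hδ]
  have hℓ0 : 0 < ℓ := Real.log_pos (by rw [lt_one_div one_pos hδ]; linarith)
  have ha : 0 ≤ ℓ / m := by positivity
  have hma : m * (ℓ / m) = ℓ := by field_simp
  have hsq : Real.sqrt (ℓ / m) ^ 2 = ℓ / m := Real.sq_sqrt ha
  have h4 : Real.exp (1 - 4 * ℓ) ≤ δ / 3 := by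
    have e1 : Real.exp (1 - 4 * ℓ) = Real.exp 1 * δ ^ 4 := by
      rw [← hexp, ← Real.exp_nat_mul, ← Real.exp_add]; congr 1; push_cast; ring
    rw [e1]
    have h3 := Real.exp_one_lt_three.le
    have h5 : δ ^ 3 ≤ (1 / 3) ^ 3 := pow_le_pow_left₀ hδ.le hδ3.le 3
    have h6 : Real.exp 1 * δ ^ 4 ≤ 3 * δ ^ 4 := mul_le_mul_of_nonneg_right h3 (by positivity)
    nlinarith
  have h1 := c.measure_residual_ge_le m (η := 4 * Real.sqrt (ℓ / m)) (by positivity)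
  have h2 := c.measure_noise_ge_le hζ m (2 * ℓ)
  have h3 := c.measure_exists_dist2_lt_le hB m (Real.sqrt_nonneg (ℓ / m))
  have e1 : 1 - m * (4 * Real.sqrt (ℓ / m)) ^ 2 / 4 = 1 - 4 * ℓ := by
    rw [mul_pow, hsq]; linear_combination -4 * hma
  have e3 : 1 - 4 * (m * Real.sqrt (ℓ / m) ^ 2) = 1 - 4 * ℓ := by rw [hsq, hma]
  rw [e1] at h1
  rw [e3] at h3
  have e2 : Real.exp (-(2 * ℓ)) ≤ δ / 3 := by
    have : Real.exp (-(2 * ℓ)) = δ ^ 2 := by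
      rw [← hexp, ← Real.exp_nat_mul]; congr 1; push_cast; ring
    rw [this]
    nlinarith
  have h1' := h1.trans (ENNReal.ofReal_le_ofReal h4)
  have h2' := h2.trans (ENNReal.ofReal_le_ofReal e2)
  have h3' := h3.trans (ENNReal.ofReal_le_ofReal h4)
  have hsum : ENNReal.ofReal δ
      = ENNReal.ofReal (δ / 3) + ENNReal.ofReal (δ / 3) + ENNReal.ofReal (δ / 3) := by
    rw [← ENNReal.ofReal_add (by positivity) (by positivity),
      ← ENNReal.ofReal_add (by positivity) (by positivity)]
    congr 1; ring
  rw [hsum]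
  refine le_trans (measure_mono ?_) ((measure_union_le _ _).trans
    (add_le_add ((measure_union_le _ _).trans (add_le_add h1' h2')) h3'))
  intro S hS
  by_contra hcon
  simp only [Set.mem_union, not_or] at hcon
  obtain ⟨⟨c1, c2⟩, c3⟩ := hcon
  refine hS ⟨(not_le.1 c1).le, (not_le.1 c2).le.trans (le_of_eq ?_), fun w hw => ?_⟩
  · linear_combination -2 * ζ ^ 2 * hma
  · by_contra h
    exact c3 ⟨w, hw, not_le.1 h⟩

/-- The three parts of `3δ` are the training deviations, the inner product estimates and the
validation deviations. Outside these events the deterministic statement `hcore` applies. -/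
theorem failureProb_le (hB : 0 < B) (hζ : 0 < ζ) {m₁ m₂ : ℕ} [NeZero m₁] {P : Params} {b : ℝ}
    (hT : 0 < P.T) (heps : 0 < P.epsI) (hδ : 0 < P.delta) (hδ3 : P.delta < 1 / 3)
    (hK : ∀ᵐ S ∂(dataLaw D m₁ m₂), (∀ j i, |(inputOf d u S).K j i| ≤ P.Kmax) ∧
      (∀ j i, |(inputOf d u S).Kval j i| ≤ P.Kmax))
    (hcore : ∀ S : Sample n m₁ × Sample n m₂, c.IsGood (Real.log (1 / P.delta) / m₁) S.1 →
      ∀ l, IsAccurateHistory (inputOf d u S) P P.T (fun _ => 0) l →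
      (∀ p ∈ l, S.2 ∉ c.badVal (weight d S.1 p.1) m₂ (Real.log (2 * P.T / P.delta))) →
      ∀ r, IsBest (inputOf d u S) l r → c.err (weight d S.1 r) ≤ b) :
    failureProb d m₁ m₂ u P D b ≤ ENNReal.ofReal (3 * P.delta) := by
  set τ := Real.log (2 * P.T / P.delta) with hτ
  set μ₁ := Measure.pi fun _ : Fin m₁ => D with hμ₁
  -- A measurable hull of the same measure, so that measurability of the set of good samples is not
  -- needed.
  set N := toMeasurable μ₁ {S | ¬c.IsGood (Real.log (1 / P.delta) / m₁) S} with hN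
  have hNm : MeasurableSet N := measurableSet_toMeasurable _ _
  have hTr : (0 : ℝ) < P.T := Nat.cast_pos.2 hT
  have hprob : IsProbabilityMeasure (dataLaw D m₁ m₂) := by unfold dataLaw; infer_instance
  have hpoint : ∀ᵐ S ∂(dataLaw D m₁ m₂),
      (outcome d u P S).toOuterMeasure {o | b < genErr D (hypothesis d u S.1 o.1)}
      ≤ (N.indicator (fun _ => 1) S.1 + ENNReal.ofReal P.delta)
        + (trainIterations P P.T fun _ => 0).ev (trainInput d u m₂ S.1)
          (c.badList τ S.1 S.2) := by
    filter_upwards [hK] with S hS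
    rw [c.toOuterMeasure_outcome]
    by_cases hgood : c.IsGood (Real.log (1 / P.delta) / m₁) S.1
    · have h1 := fail_alphatronSampling_le (I := inputOf d u S) (P := P)
        (Q := fun α => c.err (weight d S.1 α) ≤ b)
        (R := fun l => IsAccurateHistory (inputOf d u S) P P.T (fun _ => 0) l ∧
          ∀ p ∈ l, S.2 ∉ c.badVal (weight d S.1 p.1) m₂ τ) (fun l hl => ⟨by
            obtain ⟨⟨A, s, -, rfl, -⟩, -⟩ := hl
            simpa using hT.ne', hcore S hgood l hl.1 hl.2⟩)
      refine h1.trans ((Prog.fail_and_le _ _ _).trans (add_le_add ?_ ?_))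
      · refine (fail_iterations_le hT heps hδ (by linarith) hS.1 hS.2 P.T _).trans ?_
        rw [← ENNReal.ofReal_natCast, ← ENNReal.ofReal_mul hTr.le, mul_div_cancel₀ _ hTr.ne']
        exact le_add_self
      · rw [← Prog.ev_eq_of_isTrain (I := inputOf d u S) (J := trainInput d u m₂ S.1) rfl rfl rfl
          (isTrain_trainIterations P P.T _), ← ev_iterations_fst]
        refine Prog.ev_mono _ fun l => ?_
        by_cases hl : ∀ p ∈ l, S.2 ∉ c.badVal (weight d S.1 p.1) m₂ τ
        · rw [Set.indicator_of_notMem (by rwa [Set.mem_ofPred_eq, not_not])]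
          exact zero_le
        · refine (Set.indicator_le_self' (fun _ _ => zero_le) l).trans (Eq.ge ?_)
          push Not at hl
          obtain ⟨p, hp, hb⟩ := hl
          exact c.badList_of_exists ⟨p.1, List.mem_map_of_mem hp, hb⟩
    · have hmem : S.1 ∈ N := subset_toMeasurable _ _ hgood
      rw [Set.indicator_of_mem hmem, add_assoc]
      refine le_add_right ?_
      refine (Prog.ev_mono _ (g := fun _ => 1) fun a => ?_).trans (Prog.ev_const _ _).le
      exact Set.indicator_le_self' (fun _ _ => zero_le) _
  have hfst : Measurable fun S : Sample n m₁ × Sample n m₂ => N.indicator (fun _ => (1 : ℝ≥0∞)) S.1 :=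
    (measurable_const.indicator hNm).comp measurable_fst
  have hNle : ∫⁻ S, N.indicator (fun _ => (1 : ℝ≥0∞)) S.1 ∂(dataLaw D m₁ m₂)
      ≤ ENNReal.ofReal P.delta := by
    refine (lintegral_prod_le _).trans ?_
    simp only [lintegral_const, measure_univ, mul_one]
    rw [lintegral_indicator_const hNm, one_mul, hN, measure_toMeasurable]
    exact c.measure_not_isGood_le hB hζ hδ hδ3
  -- `τ` is chosen so that the union bound over `T` iterates with two tails each gives exactly `δ`.
  have hval : (P.T : ℝ≥0∞) * ENNReal.ofReal (2 * Real.exp (-τ)) = ENNReal.ofReal P.delta := by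
    rw [← ENNReal.ofReal_natCast, ← ENNReal.ofReal_mul hTr.le, hτ, Real.exp_neg,
      Real.exp_log (by positivity)]
    congr 1
    field_simp
  unfold failureProb
  refine (lintegral_mono_ae hpoint).trans ?_
  -- Additivity requires measurability of one summand only; the term with `Prog.ev` stays on the
  -- other side.
  rw [lintegral_add_left (hfst.add_const _), lintegral_add_left hfst, lintegral_const,
    measure_univ, mul_one]
  have hsum : ENNReal.ofReal (3 * P.delta)
      = ENNReal.ofReal P.delta + ENNReal.ofReal P.delta + ENNReal.ofReal P.delta := by
    rw [← ENNReal.ofReal_add hδ.le hδ.le, ← ENNReal.ofReal_add (by positivity) hδ.le]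
    congr 1; ring
  rw [hsum]
  exact add_le_add (add_le_add hNle le_rfl) ((c.lintegral_ev_badList_le τ P P.T).trans hval.le)

end Concept

/-! ### The error of the output -/

namespace Concept

variable {n d : ℕ} {B L ζ ε : ℝ} {u : ℝ → ℝ} {D : Measure (Ball n × Label)}
  (c : Concept n d B L ζ ε u D) [IsProbabilityMeasure D]

theorem err_zero_le : c.err 0 ≤ 2 * (L * B) ^ 2 + 2 * (L ^ 2 * ε) := by
  have h : ∫ p, c.dist2 0 p ∂D ≤ ∫ _p, (L * B) ^ 2 ∂D := by
    refine integral_mono (integrable_sq_sub (c.measurable_pred 0) (c.measurable_pred _)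
      (c.pred_mem 0) (c.pred_mem _)) (integrable_const _) fun p => ?_
    change (c.pred 0 p - c.pred c.v p) ^ 2 ≤ _
    rw [← sq_abs]
    refine pow_le_pow_left₀ (abs_nonneg _) ((c.act.lipschitz _ _).trans
      (mul_le_mul_of_nonneg_left ?_ c.L_pos.le)) 2
    rw [inner_zero_left, zero_sub, abs_neg]
    refine (abs_real_inner_le_norm _ _).trans ?_
    exact (mul_le_of_le_one_right (norm_nonneg _) (norm_feature_le d p)).trans c.norm_le
  rw [integral_const, probReal_univ, one_smul] at h
  linarith [c.err_le_dist2 0]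

theorem err_le_of_isBest {m₁ m₂ : ℕ} [NeZero m₁] {P : Params} {S : Sample n m₁ × Sample n m₂}
    (hB : 0 < B) (hrate : P.rate = 1 / L) (hδ : 0 < P.delta)
    (hδ3 : P.delta < 1 / 3) (hT1 : 1 ≤ P.T)
    (hT : B * L ≤ P.T * Real.sqrt (Real.log (1 / P.delta) / m₁))
    (hm₂ : m₁ * Real.log (P.T / P.delta) ≤ m₂)
    (hS : c.IsGood (Real.log (1 / P.delta) / m₁) S.1)
    {l : List ((Fin m₁ → ℝ) × (Fin m₂ → ℝ))}
    (hl : IsAccurateHistory (inputOf d u S) P P.T (fun _ => 0) l)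
    (hbad : ∀ p ∈ l, S.2 ∉ c.badVal (weight d S.1 p.1) m₂ (Real.log (2 * P.T / P.delta)))
    {r : Fin m₁ → ℝ} (hr : IsBest (inputOf d u S) l r) :
    c.err (weight d S.1 r) ≤ 216 * (L * P.epsI) ^ 2 + 8 * (L * P.epsI) + 438 * (L ^ 2 * ε)
      + 432 * (L ^ 2 * (ζ ^ 2 * (Real.log (1 / P.delta) / m₁)))
      + 888 * (L * B * Real.sqrt (Real.log (1 / P.delta) / m₁))
      + 6976 * (Real.log (1 / P.delta) / m₁) := by
  have hm : (0 : ℝ) < m₁ := Nat.cast_pos.2 (Nat.pos_of_ne_zero (NeZero.ne m₁))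
  have hTr : (1 : ℝ) ≤ P.T := by exact_mod_cast hT1
  -- `δ < 1/3 < 1/e`, hence `log(1/δ) ≥ 1`.
  have h3 : Real.exp 1 ≤ 1 / P.delta := by
    rw [le_one_div (Real.exp_pos 1) hδ]
    refine hδ3.le.trans ?_
    exact one_div_le_one_div_of_le (Real.exp_pos 1) Real.exp_one_lt_three.le
  have hℓ : 1 ≤ Real.log (1 / P.delta) := (Real.le_log_iff_exp_le (by positivity)).2 h3
  set a := Real.log (1 / P.delta) / m₁ with ha
  have ha0 : 0 < a := by positivity
  have hlogT : 1 ≤ Real.log (P.T / P.delta) := hℓ.trans (Real.log_le_log (by positivity)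
    (div_le_div_of_nonneg_right hTr hδ.le))
  have hm₂0 : (0 : ℝ) < m₂ := lt_of_lt_of_le (by positivity) hm₂
  obtain ⟨A, s, hA0, rfl, hstep⟩ := hl
  obtain ⟨t, ht, herr⟩ := c.exists_err_le (T := P.T) (e := P.epsI) ha0 hB hT hS (A := A) hA0
    fun t ht j => by
      obtain ⟨ρ, hρ, hρ'⟩ := (hstep t ht).1 j
      rw [sum_mul_K] at hρ
      rw [hrate] at hρ'
      exact ⟨ρ, hρ, hρ'⟩
  obtain ⟨p, hp, rfl, hmin⟩ := hr
  have hmem : ∀ t < P.T, (A t, s t) ∈ (List.range P.T).map fun t => (A t, s t) := fun t ht =>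
    List.mem_map_of_mem (f := fun t => (A t, s t)) (List.mem_range.2 ht)
  obtain ⟨t', ht', rfl⟩ := List.mem_map.1 hp
  rw [List.mem_range] at ht'
  have hclose : ∀ t < P.T, ∀ j, |s t j - inner ℝ (weight d S.1 (A t)) (feature d (S.2 j))|
      ≤ P.epsI := fun t ht j => by
    have := (hstep t ht).2 j
    rwa [sum_mul_Kval] at this
  have hval := hmin _ (hmem t ht)
  unfold valError at hval
  rw [div_le_div_iff_of_pos_right hm₂0] at hval
  have hval' : ∑ j, (u (s t' j) - ((S.2 j).2 : ℝ)) ^ 2 ≤ ∑ j, (u (s t j) - ((S.2 j).2 : ℝ)) ^ 2 :=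
    hval
  have hb' : S.2 ∉ c.badVal (weight d S.1 (A t')) m₂ (Real.log (2 * P.T / P.delta)) :=
    hbad (A t', s t') (hmem t' ht')
  have hb : S.2 ∉ c.badVal (weight d S.1 (A t)) m₂ (Real.log (2 * P.T / P.delta)) :=
    hbad (A t, s t) (hmem t ht)
  have hsel := c.err_le_of_valError_le (hclose t' ht') (hclose t ht) hb' hb hval'
  have hτ : Real.log (2 * P.T / P.delta) ≤ 2 * Real.log (P.T / P.delta) := by
    rw [mul_div_assoc, Real.log_mul two_ne_zero (by positivity)]
    have : Real.log 2 ≤ 1 := by linarith [Real.log_two_lt_d9]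
    linarith
  -- Here the size of the validation set enters: `log(T/δ) ≤ m₂/m₁ ≤ m₂ a`, as `m₁ a = log(1/δ) ≥
  -- 1`.
  have h64 : 32 * Real.log (2 * P.T / P.delta) ≤ m₂ * (64 * a) := by
    have h1 : 1 ≤ m₁ * a := by rw [ha, mul_div_cancel₀ _ hm.ne']; exact hℓ
    have h2 := mul_le_mul_of_nonneg_right hm₂ ha0.le
    have h4 := mul_le_mul_of_nonneg_left h1 (zero_le_one.trans hlogT)
    linarith
  have h5 : m₂ * c.err (weight d S.1 (A t')) ≤ m₂ * (3 * c.err (weight d S.1 (A t))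
      + 8 * (L * P.epsI) + 64 * a) := by linarith
  have h6 := le_of_mul_le_mul_left h5 hm₂0
  have h7 := mul_le_mul_of_nonneg_left herr (by norm_num : (0 : ℝ) ≤ 3)
  refine h6.trans ?_
  change 3 * c.err (weight d S.1 (A t)) ≤ _ at h7
  linarith

end Concept

/-! ### Numerical estimates and the choices of `T` and `m₂` -/

/-- Used when the target is below `1`: then each term of `A₂` is at most `1` and dominates its
square. The term `a` has no counterpart in `A₂`; it is absorbed by `a ≤ C B L √a`, which explains
the constant `888 + 6976 C`. -/
theorem error_bound_le {C B L ζ ε e q a : ℝ} (hC : 1 ≤ C) (hB : 0 < B) (hL : 0 < L) (hζ : 0 < ζ)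
    (hε : 0 < ε) (he : 0 < e) (hq : 0 ≤ q) (ha : 0 ≤ a) (hqa : q ^ 2 = Real.sqrt a)
    (hsC : Real.sqrt a ≤ C * B * L)
    (h1 : (888 + 6976 * C) * (L * Real.sqrt ε + L * ζ * q + B * L * Real.sqrt a + L * e
      + L ^ 2 * e ^ 2) ≤ 1) :
    216 * (L * e) ^ 2 + 8 * (L * e) + 438 * (L ^ 2 * ε) + 432 * (L ^ 2 * (ζ ^ 2 * a))
      + 888 * (L * B * Real.sqrt a) + 6976 * a
      ≤ (888 + 6976 * C) * (L * Real.sqrt ε + L * ζ * q + B * L * Real.sqrt a + L * e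
        + L ^ 2 * e ^ 2) := by
  have hE := Real.sq_sqrt hε.le
  have hs := Real.sq_sqrt ha
  set E := Real.sqrt ε with hEdef
  set s := Real.sqrt a with hsdef
  have hE0 : 0 ≤ E := Real.sqrt_nonneg _
  have hs0 : 0 ≤ s := Real.sqrt_nonneg _
  set X := L * E with hX
  set Y := L * ζ * q with hY
  set Z := B * L * s with hZ
  have hX0 : 0 ≤ X := by positivity
  have hY0 : 0 ≤ Y := by positivity
  have hZ0 : 0 ≤ Z := by positivity
  have hLe : 0 ≤ L * e := by positivity
  have hLe2 : 0 ≤ L ^ 2 * e ^ 2 := by positivity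
  have hsum : 0 ≤ X + Y + Z + L * e + L ^ 2 * e ^ 2 := by positivity
  have haZ : a ≤ C * Z := by
    have := mul_le_mul_of_nonneg_right hsC hs0
    rw [← hs]
    calc s ^ 2 = s * s := sq s
      _ ≤ C * B * L * s := this
      _ = C * Z := by rw [hZ]; ring
  have hCs : C * (X + Y + Z + L * e + L ^ 2 * e ^ 2) ≤ 1 := by
    nlinarith [mul_nonneg (by linarith : (0 : ℝ) ≤ C) hsum]
  have hs1 : X + Y + Z + L * e + L ^ 2 * e ^ 2 ≤ 1 := by
    nlinarith [mul_le_mul_of_nonneg_right hC hsum]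
  have hX1 : X ^ 2 ≤ X := by nlinarith
  have hY1 : Y ^ 2 ≤ Y := by nlinarith
  have ha1 : a ≤ 1 := by nlinarith
  have hs2 : s ≤ 1 := by nlinarith
  have hX2 : L ^ 2 * ε = X ^ 2 := by rw [hX, mul_pow, hE]
  have hY2 : L ^ 2 * (ζ ^ 2 * a) ≤ Y ^ 2 := by
    have e1 : L ^ 2 * (ζ ^ 2 * a) = Y ^ 2 * s := by
      rw [hY, ← hs, mul_pow, hqa]; ring
    rw [e1]
    exact mul_le_of_le_one_right (sq_nonneg _) hs2
  have hC0 : ∀ x, 0 ≤ x → 0 ≤ C * x := fun x hx => mul_nonneg (by linarith) hx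
  have := hC0 X hX0
  have := hC0 Y hY0
  have := hC0 _ hLe
  have := hC0 _ hLe2
  have e2 : L * B * s = Z := by rw [hZ]; ring
  rw [hX2, e2, mul_pow]
  linarith

/-- The case of a single iteration, whose output is `0`. Then `s ≥ C B L`, so `(LB)² ≤ B L s`. -/
theorem error_zero_bound_le {C B L ζ ε e q s : ℝ} (hC : 1 ≤ C) (hB : 0 < B) (hL : 0 < L)
    (hζ : 0 < ζ) (hε : 0 < ε) (he : 0 < e) (hq : 0 ≤ q) (hs : C * B * L ≤ s)
    (h1 : (888 + 6976 * C) * (L * Real.sqrt ε + L * ζ * q + B * L * s + L * e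
      + L ^ 2 * e ^ 2) ≤ 1) :
    2 * (L * B) ^ 2 + 2 * (L ^ 2 * ε)
      ≤ (888 + 6976 * C) * (L * Real.sqrt ε + L * ζ * q + B * L * s + L * e
        + L ^ 2 * e ^ 2) := by
  have hE := Real.sq_sqrt hε.le
  set E := Real.sqrt ε with hEdef
  have hE0 : 0 ≤ E := Real.sqrt_nonneg _
  set X := L * E with hX
  set Y := L * ζ * q with hY
  set Z := B * L * s with hZ
  have hBL : 0 < B * L := by positivity
  have hs0 : B * L ≤ s := by nlinarith
  have hX0 : 0 ≤ X := by positivity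
  have hY0 : 0 ≤ Y := by positivity
  have hZ0 : (L * B) ^ 2 ≤ Z := by nlinarith
  have hLe : 0 ≤ L * e := by positivity
  have hLe2 : 0 ≤ L ^ 2 * e ^ 2 := by positivity
  have hZ1 : 0 ≤ Z := (sq_nonneg _).trans hZ0
  have hsum : X + Y + Z + L * e + L ^ 2 * e ^ 2 ≤ (888 + 6976 * C)
      * (X + Y + Z + L * e + L ^ 2 * e ^ 2) / 888 := by
    rw [le_div_iff₀ (by norm_num)]
    nlinarith [mul_nonneg (by linarith : (0 : ℝ) ≤ C)
      (by positivity : 0 ≤ X + Y + Z + L * e + L ^ 2 * e ^ 2)]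
  have hX1 : X ^ 2 ≤ X := by nlinarith
  have hX2 : L ^ 2 * ε = X ^ 2 := by rw [hX, mul_pow, hE]
  rw [hX2]
  linarith

theorem le_numVal {m₁ T : ℕ} {C' δ : ℝ} (hC' : 1 ≤ C') (hδ : 0 < δ) (hδ1 : δ < 1) (hT : 1 ≤ T) :
    m₁ * Real.log (T / δ) ≤ numVal C' δ m₁ T := by
  have hTr : (1 : ℝ) ≤ T := by exact_mod_cast hT
  have h0 : 0 ≤ Real.log (T / δ) := Real.log_nonneg (by rw [le_div_iff₀ hδ]; linarith)
  refine le_trans ?_ (Nat.le_ceil _)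
  refine mul_le_mul_of_nonneg_right ?_ h0
  exact le_mul_of_one_le_left (Nat.cast_nonneg _) hC'

theorem A₂_nonneg {m₁ : ℕ} {B L ζ ε δ : ℝ} (hB : 0 < B) (hL : 0 < L) (hζ : 0 < ζ) (hδ : 0 < δ) (hδ1 : δ < 1) :
    0 ≤ A₂ B L ζ ε δ m₁ := by
  have hℓ : 0 < Real.log (1 / δ) := Real.log_pos (by rw [lt_one_div one_pos hδ]; simpa using hδ1)
  unfold A₂
  positivity

theorem mul_sqrt_le_A₂ {m₁ : ℕ} {B L ζ ε δ : ℝ} (hB : 0 < B) (hL : 0 < L) (hζ : 0 < ζ) (hδ : 0 < δ) (hδ1 : δ < 1) :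
    L * Real.sqrt ε ≤ A₂ B L ζ ε δ m₁ := by
  have hℓ : 0 < Real.log (1 / δ) := Real.log_pos (by rw [lt_one_div one_pos hδ]; simpa using hδ1)
  unfold A₂
  rw [add_assoc]
  exact le_add_of_nonneg_right (by positivity)

variable {n d m₁ m₂ T : ℕ} [NeZero m₁] {C C' B L ζ ε δ εI Kmax : ℝ} {u : ℝ → ℝ}

theorem one_le_numIter (hC : 1 ≤ C) (hB : 0 < B) (hL : 0 < L) (hδ : 0 < δ) (hδ1 : δ < 1) :
    1 ≤ numIter C B L δ m₁ := by
  have hm : (0 : ℝ) < m₁ := Nat.cast_pos.2 (Nat.pos_of_ne_zero (NeZero.ne m₁))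
  have hℓ : 0 < Real.log (1 / δ) := Real.log_pos (by rw [lt_one_div one_pos hδ]; simpa using hδ1)
  exact Nat.ceil_pos.2 (by positivity)

/-- The run time bound of the algorithm. -/
theorem steps_numIter_le {δ₀ : ℝ} (hC : 1 ≤ C) (hC' : 1 ≤ C') (hB : 0 < B) (hL : 0 < L)
    (hδ₀ : δ₀ < 1) (hδ : 0 < δ) (hδδ : δ ≤ δ₀) (hεI : 0 < εI) (hu : IsActivation L u)
    (hT : T = numIter C B L δ m₁) (hm₂ : m₂ = numVal C' δ m₁ T)
    (S : Sample n m₁ × Sample n m₂) {o : (Fin m₁ → ℝ) × ℕ}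
    (ho : o ∈ (outcome d u { T := T, rate := 1 / L, epsI := εI, delta := δ, Kmax := Kmax }
      S).support) :
    (o.2 : ℝ) ≤ (232 * (6 + 13 / Real.log (1 / δ₀)) + 36) *
      timeExpr T (m₁ + m₂) L Kmax (εI ^ 2) δ * Real.log (2 + T * (m₁ + m₂)) ^ 2 := by
  have hδ1 : δ < 1 := hδδ.trans_lt hδ₀
  have hT1 : 1 ≤ T := hT ▸ one_le_numIter hC hB hL hδ hδ1
  refine steps_le hu.mem_Icc hδ₀ hδ hδδ hL hεI hT1 ?_ S ho
  have hmv : m₁ * Real.log (T / δ) ≤ m₂ := hm₂ ▸ le_numVal hC' hδ hδ1 hT1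
  refine le_trans (le_mul_of_one_le_left (Real.log_nonneg ?_) ?_) hmv
  · have hTr : (1 : ℝ) ≤ T := by exact_mod_cast hT1
    rw [le_div_iff₀ hδ]
    linarith
  · exact_mod_cast Nat.one_le_iff_ne_zero.2 (NeZero.ne m₁)

variable {D : Measure (Ball n × Label)} [IsProbabilityMeasure D]

/-- The error bound of the algorithm. -/
theorem failureProb_numIter_le (hC : 1 ≤ C) (hC' : 1 ≤ C') (hB : 0 < B) (hL : 0 < L) (hζ : 0 < ζ)
    (hε : 0 < ε) (hδ : 0 < δ) (hδ1 : δ < 1) (hεI : 0 < εI) (hu : IsActivation L u)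
    (hD : IsConceptDistribution n d B ζ ε u D) (hT : T = numIter C B L δ m₁)
    (hm₂ : m₂ = numVal C' δ m₁ T)
    (hK : ∀ᵐ S ∂(dataLaw D m₁ m₂), (∀ j i, |(inputOf d u S).K j i| ≤ Kmax) ∧
      (∀ j i, |(inputOf d u S).Kval j i| ≤ Kmax)) :
    failureProb d m₁ m₂ u { T := T, rate := 1 / L, epsI := εI, delta := δ, Kmax := Kmax } D
      ((888 + 6976 * C) * (A₂ B L ζ ε δ m₁ + L * εI + L ^ 2 * εI ^ 2))
      ≤ ENNReal.ofReal (3 * δ) := by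
  obtain ⟨c⟩ := hD.exists_concept hL hu
  -- For `δ ≥ 1/3` the allowed failure probability `3δ` is at least `1`.
  rcases le_or_gt (1 / 3) δ with hδ3 | hδ3
  · refine failureProb_le_one.trans ?_
    rw [← ENNReal.ofReal_one]
    exact ENNReal.ofReal_le_ofReal (by linarith)
  have hm : (0 : ℝ) < m₁ := Nat.cast_pos.2 (Nat.pos_of_ne_zero (NeZero.ne m₁))
  have hℓ : 0 < Real.log (1 / δ) := Real.log_pos (by rw [lt_one_div one_pos hδ]; simpa using hδ1)
  have hT1 : 1 ≤ T := hT ▸ one_le_numIter hC hB hL hδ hδ1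
  have hmv : m₁ * Real.log (T / δ) ≤ m₂ := hm₂ ▸ le_numVal hC' hδ hδ1 hT1
  set a := Real.log (1 / δ) / m₁ with ha
  have ha0 : 0 < a := by positivity
  set s := Real.sqrt a with hs
  have hs0 : 0 < s := Real.sqrt_pos.2 ha0
  set q := a ^ (1 / 4 : ℝ) with hq
  have hq0 : 0 ≤ q := by positivity
  have hqs : q ^ 2 = s := by
    rw [hq, hs, Real.sqrt_eq_rpow, ← Real.rpow_mul_natCast ha0.le]
    norm_num
  have hTs : numIter C B L δ m₁ = ⌈C * B * L / s⌉₊ := by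
    rw [numIter, hs, div_eq_mul_inv (C * B * L), ← Real.sqrt_inv, ha, inv_div]
  have hA : A₂ B L ζ ε δ m₁ = L * Real.sqrt ε + L * ζ * q + B * L * s := rfl
  rw [hA]
  -- A target of at least `1` is met by every hypothesis.
  rcases le_or_gt 1 ((888 + 6976 * C) * (L * Real.sqrt ε + L * ζ * q + B * L * s + L * εI
    + L ^ 2 * εI ^ 2)) with h1 | h1
  · refine c.failureProb_le hB hζ hT1 hεI hδ hδ3 hK ?_
    intro S _ l _ _ r _
    exact (c.err_le_one _).trans h1
  refine c.failureProb_le hB hζ hT1 hεI hδ hδ3 hK ?_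
  intro S hS l hl hbad r hr
  -- `T = ⌈C B L / s⌉₊`, so `T = 1` forces `C B L ≤ s` and `T ≥ 2` forces `s < C B L`.
  rcases hT1.eq_or_lt with hT1' | hT2
  · have hle : C * B * L ≤ s := by
      have h2 : C * B * L / s ≤ (1 : ℕ) := Nat.ceil_le.1 (by rw [← hTs, ← hT, hT1'])
      rwa [Nat.cast_one, div_le_one hs0] at h2
    obtain ⟨A, s', hA0, rfl, -⟩ := hl
    obtain ⟨p, hp, rfl, -⟩ := hr
    obtain ⟨t, ht, rfl⟩ := List.mem_map.1 hp
    have ht0 : t = 0 := by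
      have h3 : t < T := List.mem_range.1 ht
      omega
    have hw : Concept.weight d S.1 (A t) = 0 := by
      rw [ht0, hA0]
      simp [Concept.weight]
    simp only [hw]
    exact c.err_zero_le.trans (error_zero_bound_le hC hB hL hζ hε hεI hq0 hle h1.le)
  · have hlt : s ≤ C * B * L := by
      have h2 : ((1 : ℕ) : ℝ) < C * B * L / s := Nat.lt_ceil.1 (by rw [← hTs, ← hT]; exact hT2)
      rw [Nat.cast_one, one_lt_div hs0] at h2
      exact h2.le
    have hTB : B * L ≤ T * s := by
      have h2 : C * B * L / s ≤ T := by rw [hT, hTs]; exact Nat.le_ceil _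
      rw [div_le_iff₀ hs0] at h2
      have h3 : 0 < B * L := by positivity
      nlinarith
    refine (c.err_le_of_isBest hB rfl hδ hδ3 hT1 hTB hmv hS hl hbad hr).trans ?_
    exact error_bound_le hC hB hL hζ hε hεI hq0 ha0.le hqs hlt h1.le

end Alphatron

end

/-! ### The main theorem: choice of the constants -/

theorem mainTheorem4 :
    ∃ C₀ > (0 : ℝ), ∃ C₀' > (0 : ℝ), ∀ C ≥ C₀, ∀ C' ≥ C₀', ∃ C'' > (0 : ℝ), ∃ p : ℕ,
    ∀ δ₀ < (1 : ℝ), ∃ Ctime > (0 : ℝ),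
    ∀ (n d m₁ : ℕ) [NeZero m₁] (B L ζ ε δ εI Kmax : ℝ) (u : ℝ → ℝ)
      (D : MeasureTheory.Measure (Alphatron.Ball n × Alphatron.Label))
      [MeasureTheory.IsProbabilityMeasure D] (T m₂ : ℕ) (P : Alphatron.Params),
    0 < B → 0 < L → 0 < ζ → 0 < ε → 0 < δ → δ ≤ δ₀ → 0 < εI →
    Alphatron.IsActivation L u →
    Alphatron.IsConceptDistribution n d B ζ ε u D →
    T = Alphatron.numIter C B L δ m₁ →
    m₂ = Alphatron.numVal C' δ m₁ T →
    P = { T := T, rate := 1 / L, epsI := εI, delta := δ, Kmax := Kmax } →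
    (∀ᵐ S ∂(Alphatron.dataLaw D m₁ m₂),
      (∀ j i, |(Alphatron.inputOf d u S).K j i| ≤ Kmax) ∧
      (∀ j i, |(Alphatron.inputOf d u S).Kval j i| ≤ Kmax)) →
    (Alphatron.failureProb d m₁ m₂ u P D
        (C'' * (Alphatron.A₂ B L ζ ε δ m₁ + L * εI + L ^ 2 * εI ^ 2)) ≤ ENNReal.ofReal (3 * δ) ∧
      (∀ S : Alphatron.Sample n m₁ × Alphatron.Sample n m₂,
        ∀ o ∈ (Alphatron.outcome d u P S).support,
          (o.2 : ℝ) ≤ Ctime * Alphatron.timeExpr T (m₁ + m₂) L Kmax (εI ^ 2) δ *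
            Real.log (2 + T * (m₁ + m₂)) ^ p)) ∧
    (Alphatron.A₂ B L ζ ε δ m₁ ≤ 1 → εI = Real.sqrt ε →
      Alphatron.failureProb d m₁ m₂ u P D (C'' * Alphatron.A₂ B L ζ ε δ m₁)
          ≤ ENNReal.ofReal (3 * δ) ∧
      (∀ S : Alphatron.Sample n m₁ × Alphatron.Sample n m₂,
        ∀ o ∈ (Alphatron.outcome d u P S).support,
          (o.2 : ℝ) ≤ Ctime * Alphatron.timeExpr T (m₁ + m₂) L Kmax ε δ *
            Real.log (2 + T * (m₁ + m₂)) ^ p)) := by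
  -- The factor `3` serves the last claim: for `εI = √ε` and `A₂ ≤ 1`, both `L εI` and `L² εI²` are
  -- at most `A₂`.
  refine ⟨1, one_pos, 1, one_pos, fun C hC C' hC' => ⟨3 * (888 + 6976 * C), by linarith, 2,
    fun δ₀ hδ₀ => ?_⟩⟩
  -- For `δ₀ ≤ 0` no `δ` is admissible; otherwise `log(1/δ₀) > 0` and the time constant is positive.
  rcases le_or_gt δ₀ 0 with h0 | h0
  · refine ⟨1, one_pos, ?_⟩
    intro n d m₁ _ B L ζ ε δ εI Kmax u D _ T m₂ P _ _ _ _ hδ hδδ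
    exact absurd (hδ.trans_le hδδ) h0.not_gt
  have hlog : 0 < Real.log (1 / δ₀) :=
    Real.log_pos (by rw [lt_one_div one_pos h0]; simpa using hδ₀)
  refine ⟨232 * (6 + 13 / Real.log (1 / δ₀)) + 36, by positivity, ?_⟩
  intro n d m₁ _ B L ζ ε δ εI Kmax u D _ T m₂ P hB hL hζ hε hδ hδδ hεI hu hD hT hm₂ hP hK
  subst hP
  have hδ1 : δ < 1 := hδδ.trans_lt hδ₀
  have hA : 0 ≤ Alphatron.A₂ B L ζ ε δ m₁ := Alphatron.A₂_nonneg hB hL hζ hδ hδ1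
  have hfail := Alphatron.failureProb_numIter_le hC hC' hB hL hζ hε hδ hδ1 hεI hu hD hT hm₂ hK
  have hsteps : ∀ S : Alphatron.Sample n m₁ × Alphatron.Sample n m₂, ∀ o ∈ (Alphatron.outcome d u
      { T := T, rate := 1 / L, epsI := εI, delta := δ, Kmax := Kmax } S).support, _ :=
    fun S o ho => Alphatron.steps_numIter_le hC hC' hB hL hδ₀ hδ hδδ hεI hu hT hm₂ S ho
  refine ⟨⟨(Alphatron.failureProb_anti ?_).trans hfail, hsteps⟩, fun hA1 he =>
    ⟨(Alphatron.failureProb_anti ?_).trans hfail, ?_⟩⟩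
  · refine mul_le_mul_of_nonneg_right (by linarith) ?_
    positivity
  · rw [mul_comm (3 : ℝ), mul_assoc]
    refine mul_le_mul_of_nonneg_left ?_ (by linarith)
    have hle : L * εI ≤ Alphatron.A₂ B L ζ ε δ m₁ := he ▸ Alphatron.mul_sqrt_le_A₂ hB hL hζ hδ hδ1
    have h1 : L ^ 2 * εI ^ 2 ≤ L * εI := by
      rw [← mul_pow]
      exact pow_le_of_le_one (by positivity) (hle.trans hA1) two_ne_zero
    linarith
  · have h2 : εI ^ 2 = ε := by rw [he, Real.sq_sqrt hε.le]
    rwa [h2] at hsteps
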